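/- Let $M,N\ge 0$ be integers and $K=M+N$. Put $[a]=0$ for $1\le a\le M$ and $[a]=1$ for $M<a\le K$; put $\bar a=M+1-a$ for $a\le M$ and $\bar a=2M+N+1-a$ for $a>M$. Let $E_{ab}$ be the elementary $K\times K$ matrices. Tensor products of matrices are graded, $(E_{ij}\otimes E_{kl})(E_{ab}\otimes E_{cd})=(-1)^{([k]+[l])([a]+[b])}E_{ij}E_{ab}\otimes E_{kl}E_{cd}$, and elements of the coefficient algebra commute with the matrices $E_{ab}$. For a matrix $X=\sum_{a,b} X^{ab}E_{ab}$ write $X_1=\sum_{a,b} X^{ab}\,E_{ab}\otimes 1$ and $X_2=\sum_{a,b} X^{ab}\,1\otimes E_{ab}$. Let $P=\sum_{i,j}(-1)^{[j]}E_{ij}\otimes E_{ji}$ and $R(x)=1-\frac1x P$. The super Yangian $Y(M|N)$ is the complex associative algebra generated by $T^{ab}_{(n)}$ ($1\le a,b\le K$, $n\ge1$) with defining relations $$R(u-v)\,T_1(u)\,T_2(v)=T_2(v)\,T_1(u)\,R(u-v),\qquad T(u)=1+\sum_{n\ge1}\sum_{a,b}u^{-n}T^{ab}_{(n)}E_{ab}.$$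 Let $\theta_a\in\{1,-1\}$ ($1\le a\le K$) and $\theta_0\in\{1,-1\}$ satisfy $(-1)^{[a]}\theta_a\theta_{\bar a}=\theta_0$ for all $a$ (such signs exist exactly when $MN$ is even). Define the transposition $t$, linear over the coefficient algebra, by $E_{ab}^t=(-1)^{[a]([b]+1)}\theta_a\theta_b\,E_{\bar b\bar a}$; let $t_1$ be this transposition applied to the first tensor factor, $Q=P^{t_1}$ and $R'(x)=R^{t_1}(-x)=1+\frac1xQ$. For a matrix $X(u)$ of series in $u^{-1}$ put $\tau[X(u)]=\sum_{a,b}X^{ab}(-u)\,E_{ab}^t$. Let $$S(u)=T(u)\,\tau[T(u)]=1+\sum_{n\ge1}\sum_{a,b}u^{-n}S^{ab}_{(n)}E_{ab},$$ and let $Y(M|N)^\tau\subset Y(M|N)$ be the subalgebra generated by all $S^{ab}_{(n)}$. Relations that involve $R$ and $R'$ are identities of formal series in $u^{-1},v^{-1}$ after multiplication by the denominators $u-v$ and $u+v$. Theorem. The matrix $S(u)$ satisfies the reflection relation $$R(u-v)\,S_1(u)\,R'(u+v)\,S_2(v)=S_2(v)\,R'(u+v)\,S_1(u)\,R(u-v)$$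 and the symmetry relation $$\tau[S(u)]=S(u)+\frac{\theta_0}{2u}\bigl(S(u)-S(-u)\bigr).$$ Moreover these two relations are a presentation of $Y(M|N)^\tau$: if $\mathcal A$ is the complex associative algebra with generators $\sigma^{ab}_{(n)}$ ($1\le a,b\le K$, $n\ge1$) whose defining relations are the reflection and the symmetry relation for $\sigma(u)=1+\sum_{n\ge1}\sum_{a,b}u^{-n}\sigma^{ab}_{(n)}E_{ab}$, then there is an algebra isomorphism $\mathcal A\to Y(M|N)^\tau$ with $\sigma^{ab}_{(n)}\mapsto S^{ab}_{(n)}$ for all $a,b,n$. -/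

import Mathlib

noncomputable section

namespace TwistedSuperYangian

/-! ### Graded matrices

The index set `{1, …, M + N}` is `Fin M ⊕ Fin N`: the summand `Fin M` carries the even indices
`1, …, M`, the summand `Fin N` the odd indices `M + 1, …, M + N`. -/

/-- The set of indices of `gl(M|N)`. -/
abbrev Idx (M N : ℕ) : Type := Fin M ⊕ Fin N

/-- The degree `[a] ∈ {0, 1}` of an index. -/
def deg {M N : ℕ} : Idx M N → ℕ := Sum.elim (fun _ => 0) (fun _ => 1)

/-- The involution `a ↦ ā`, with `ā = M + 1 - a` for `a ≤ M` and `ā = 2 M + N + 1 - a`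
for `a > M`. -/
def bar {M N : ℕ} : Idx M N → Idx M N := Sum.map Fin.rev Fin.rev

/-- The elementary matrix `E_{ab}`. -/
def E {M N : ℕ} {R : Type*} [Ring R] (a b : Idx M N) : Matrix (Idx M N) (Idx M N) R :=
  Matrix.single a b 1

/-- The graded tensor product of two matrices, realised as a matrix acting on the tensor square:
`(E_{ij} ⊗ E_{kl}) (e_j ⊗ e_l) = (-1)^{([k] + [l]) [j]} e_i ⊗ e_k`. The ordinary product of
matrices indexed by pairs is the product of the graded tensor product, see `gtensor_E_mul`.
Entries of the matrices commute with the elementary matrices. -/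
def gtensor {M N : ℕ} {R : Type*} [Ring R] (A B : Matrix (Idx M N) (Idx M N) R) :
    Matrix (Idx M N × Idx M N) (Idx M N × Idx M N) R :=
  Matrix.of fun p q => (-1 : ℤˣ) ^ ((deg p.2 + deg q.2) * deg q.1) • (A p.1 q.1 * B p.2 q.2)

/-- `X₁ = ∑ X^{ab} E_{ab} ⊗ 1`. -/
def leg₁ {M N : ℕ} {R : Type*} [Ring R] (X : Matrix (Idx M N) (Idx M N) R) :
    Matrix (Idx M N × Idx M N) (Idx M N × Idx M N) R :=
  gtensor X 1

/-- `X₂ = ∑ X^{ab} 1 ⊗ E_{ab}`. -/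
def leg₂ {M N : ℕ} {R : Type*} [Ring R] (X : Matrix (Idx M N) (Idx M N) R) :
    Matrix (Idx M N × Idx M N) (Idx M N × Idx M N) R :=
  gtensor 1 X

/-- The graded permutation `P = ∑_{ij} (-1)^{[j]} E_{ij} ⊗ E_{ji}`. -/
def P {M N : ℕ} {R : Type*} [Ring R] : Matrix (Idx M N × Idx M N) (Idx M N × Idx M N) R :=
  ∑ i : Idx M N, ∑ j : Idx M N, (-1 : ℤˣ) ^ deg j • gtensor (E i j) (E j i)

/-- The transposition `X = ∑ X^{ab} E_{ab} ↦ X^t = ∑ X^{ab} E_{ab}^t`, where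
`E_{ab}^t = (-1)^{[a]([b] + 1)} θ_a θ_b E_{b̄ā}`. -/
def transp {M N : ℕ} {R : Type*} [Ring R] (θ : Idx M N → ℤˣ) (X : Matrix (Idx M N) (Idx M N) R) :
    Matrix (Idx M N) (Idx M N) R :=
  ∑ a : Idx M N, ∑ b : Idx M N,
    ((-1 : ℤˣ) ^ (deg a * (deg b + 1)) * θ a * θ b) • Matrix.single (bar b) (bar a) (X a b)

/-- The transposition `t₁` in the first tensor factor: the additive extension of
`r E_{ij} ⊗ E_{kl} ↦ r E_{ij}^t ⊗ E_{kl}`. Here the coefficient `r` of `E_{ij} ⊗ E_{kl}` in `Z` is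
`(-1)^{([k] + [l]) [j]}` times the entry of `Z` at `((i, k), (j, l))`. -/
def transp₁ {M N : ℕ} {R : Type*} [Ring R] (θ : Idx M N → ℤˣ)
    (Z : Matrix (Idx M N × Idx M N) (Idx M N × Idx M N) R) :
    Matrix (Idx M N × Idx M N) (Idx M N × Idx M N) R :=
  ∑ i : Idx M N, ∑ j : Idx M N, ∑ k : Idx M N, ∑ l : Idx M N,
    ((-1 : ℤˣ) ^ ((deg k + deg l) * deg j) • Z (i, k) (j, l)) •
      gtensor (transp θ (E i j)) (E k l)

/-- `Q = P^{t₁}`. -/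
def Q {M N : ℕ} {R : Type*} [Ring R] (θ : Idx M N → ℤˣ) :
    Matrix (Idx M N × Idx M N) (Idx M N × Idx M N) R :=
  transp₁ θ P

/-! ### The R-matrices

`R(x) = 1 - P / x` and `R'(x) = R^{t₁}(-x)`. Spectral parameters are written as fractions
`x = q / p`, and the denominator `q` of `R` is cleared. -/

/-- `q R(q / p) = q - p P`. -/
def Rmat {M N : ℕ} {R : Type*} [Ring R] (q p : R) :
    Matrix (Idx M N × Idx M N) (Idx M N × Idx M N) R :=
  q • (1 : Matrix (Idx M N × Idx M N) (Idx M N × Idx M N) R) - p • P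

/-- `q R'(q / p) = (q R(q / (-p)))^{t₁}`. -/
def Rmat' {M N : ℕ} {R : Type*} [Ring R] (θ : Idx M N → ℤˣ) (q p : R) :
    Matrix (Idx M N × Idx M N) (Idx M N × Idx M N) R :=
  transp₁ θ (Rmat q (-p))

theorem gtensor_E {M N : ℕ} {R : Type*} [Ring R] (i j k l : Idx M N) :
    gtensor (E i j : Matrix (Idx M N) (Idx M N) R) (E k l) =
      (-1 : ℤˣ) ^ ((deg k + deg l) * deg j) • Matrix.single (i, k) (j, l) 1 := by
  ext ⟨p, p'⟩ ⟨q, q'⟩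
  by_cases h1 : i = p <;> by_cases h2 : j = q <;> by_cases h3 : k = p' <;> by_cases h4 : l = q' <;>
    simp [gtensor, E, Matrix.single_apply, h1, h2, h3, h4]

/-- The product of the graded tensor product of matrix algebras:
`(E_{ij} ⊗ E_{kl}) (E_{ab} ⊗ E_{cd}) = (-1)^{([k] + [l]) ([a] + [b])} E_{ij} E_{ab} ⊗ E_{kl} E_{cd}`. -/
theorem gtensor_E_mul {M N : ℕ} {R : Type*} [Ring R] (i j k l a b c d : Idx M N) :
    gtensor (E i j : Matrix (Idx M N) (Idx M N) R) (E k l) * gtensor (E a b) (E c d) =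
      (-1 : ℤˣ) ^ ((deg k + deg l) * (deg a + deg b)) • gtensor (E i j * E a b) (E k l * E c d) := by
  have hE : ∀ i j a b : Idx M N, (E i j : Matrix (Idx M N) (Idx M N) R) * E a b =
      if j = a then E i b else 0 := by
    intro i j a b
    by_cases h : j = a <;> simp [E, h]
  have h0 : ∀ A : Matrix (Idx M N) (Idx M N) R, gtensor A 0 = 0 ∧ gtensor 0 A = 0 := by
    intro A
    constructor <;> ext p q <;> simp [gtensor]
  rw [hE, hE, gtensor_E, gtensor_E, smul_mul_smul_comm]
  by_cases h : j = a
  · by_cases h' : l = c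
    · subst h h'
      simp only [if_true, gtensor_E, Matrix.single_mul_single_same, mul_one, smul_smul]
      congr 1
      rw [← pow_add, ← pow_add]
      rcases i with i | i <;> rcases j with j | j <;> rcases k with k | k <;>
        rcases l with l | l <;> rcases b with b | b <;> rcases d with d | d <;> simp [deg] <;> rfl
    · simp [h, h', h0]
  · simp [h, h0]

theorem transp_E {M N : ℕ} {R : Type*} [Ring R] (θ : Idx M N → ℤˣ) (a b : Idx M N) :
    transp θ (E a b : Matrix (Idx M N) (Idx M N) R) =
      ((-1 : ℤˣ) ^ (deg a * (deg b + 1)) * θ a * θ b) • E (bar b) (bar a) := by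
  unfold transp
  rw [Finset.sum_eq_single a, Finset.sum_eq_single b]
  · simp [E]
  · intro j _ h; simp [E, h.symm]
  · simp
  · intro i _ h; simp [E, h.symm]
  · simp

theorem transp₁_one {M N : ℕ} {R : Type*} [Ring R] (θ : Idx M N → ℤˣ) :
    transp₁ θ (1 : Matrix (Idx M N × Idx M N) (Idx M N × Idx M N) R) = 1 := by
  have hb : ∀ a : Idx M N, bar (bar a) = a := by rintro (a | a) <;> simp [bar]
  have hE : ∀ i : Idx M N, transp θ (E i i : Matrix (Idx M N) (Idx M N) R) = E (bar i) (bar i) := by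
    rintro (i | i) <;> simp [transp_E, deg]
  have h1 : ∀ i j k l : Idx M N, ((-1 : ℤˣ) ^ ((deg k + deg l) * deg j) •
      (1 : Matrix (Idx M N × Idx M N) (Idx M N × Idx M N) R) (i, k) (j, l)) =
      if i = j then if k = l then 1 else 0 else 0 := by
    intro i j k l
    by_cases h : i = j <;> by_cases h' : k = l <;> simp [h, h', Matrix.one_apply]
  unfold transp₁
  simp only [h1]
  simp only [ite_smul, zero_smul, one_smul, Finset.sum_ite_eq, Finset.sum_ite_irrel, Finset.sum_const_zero,
    Finset.mem_univ, if_true, hE]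
  have h2 : ∀ i k : Idx M N, gtensor (E i i : Matrix (Idx M N) (Idx M N) R) (E k k) =
      Matrix.single (i, k) (i, k) 1 := by
    intro i k
    rw [gtensor_E, ← two_mul, mul_assoc, pow_mul]
    simp
  have h3 : ∀ f : Idx M N → Matrix (Idx M N × Idx M N) (Idx M N × Idx M N) R,
      ∑ i, f (bar i) = ∑ i, f i := fun f =>
    Equiv.sum_comp (⟨bar, bar, hb, hb⟩ : Idx M N ≃ Idx M N) f
  rw [h3 (fun i => ∑ k, gtensor (E i i) (E k k))]
  simp only [h2]
  rw [← Fintype.sum_prod_type (fun z : Idx M N × Idx M N =>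
    (Matrix.single z z 1 : Matrix (Idx M N × Idx M N) (Idx M N × Idx M N) R))]
  ext p q
  rw [Matrix.sum_apply, Matrix.one_apply]
  simp only [Matrix.single_apply]
  rw [Finset.sum_eq_single p]
  · simp
  · intro z _ hz
    simp [hz]
  · simp

/-- The identity `R'(x) = 1 + Q / x` for `x = q / p`. -/
theorem Rmat'_eq {M N : ℕ} {R : Type*} [Ring R] (θ : Idx M N → ℤˣ) (q p : R) :
    Rmat' θ q p =
      q • (1 : Matrix (Idx M N × Idx M N) (Idx M N × Idx M N) R) + p • Q θ := by
  have hadd : ∀ Z W : Matrix (Idx M N × Idx M N) (Idx M N × Idx M N) R,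
      transp₁ θ (Z + W) = transp₁ θ Z + transp₁ θ W := by
    intro Z W
    simp only [transp₁, Matrix.add_apply, smul_add, add_smul, Finset.sum_add_distrib]
  have hsmul : ∀ (r : R) (Z : Matrix (Idx M N × Idx M N) (Idx M N × Idx M N) R),
      transp₁ θ (r • Z) = r • transp₁ θ Z := by
    intro r Z
    simp only [transp₁, Finset.smul_sum, smul_smul, Matrix.smul_apply, smul_eq_mul, mul_smul_comm]
  rw [Rmat', Rmat, neg_smul, sub_neg_eq_add, hadd, hsmul, hsmul, transp₁_one, Q]

/-! ### Formal series

A series in `u⁻¹` is a power series in the variable `x = u⁻¹`. Two spectral parameters `u, v` give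
power series in two commuting variables `x = u⁻¹` and `y = v⁻¹`; the variables commute with the
coefficients. -/

/-- `f(u) ↦ f(-u)`. -/
def negArg {A : Type*} [Ring A] (f : PowerSeries A) : PowerSeries A :=
  PowerSeries.mk fun n => (-1 : A) ^ n * PowerSeries.coeff n f

/-- The series `f` in the variable number `i`: for `i = 0` this is `f(u)`, for `i = 1` it is
`f(v)`. -/
def inVar {A : Type*} [Ring A] (i : Fin 2) (f : PowerSeries A) : MvPowerSeries (Fin 2) A :=
  fun m => if m (1 - i) = 0 then PowerSeries.coeff (m i) f else 0

/-- `x = u⁻¹`. -/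
def x {A : Type*} [Ring A] : MvPowerSeries (Fin 2) A := MvPowerSeries.X 0

/-- `y = v⁻¹`. -/
def y {A : Type*} [Ring A] : MvPowerSeries (Fin 2) A := MvPowerSeries.X 1

/-- `R(u - v)` multiplied by `x y (u - v) = y - x`; note `u - v = (y - x) / (x y)`. -/
def Ruv (M N : ℕ) (A : Type*) [Ring A] :
    Matrix (Idx M N × Idx M N) (Idx M N × Idx M N) (MvPowerSeries (Fin 2) A) :=
  Rmat (y - x) (x * y)

/-- `R'(u + v)` multiplied by `x y (u + v) = y + x`; note `u + v = (y + x) / (x y)`. -/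
def Ruv' {M N : ℕ} (θ : Idx M N → ℤˣ) (A : Type*) [Ring A] :
    Matrix (Idx M N × Idx M N) (Idx M N × Idx M N) (MvPowerSeries (Fin 2) A) :=
  Rmat' θ (y + x) (x * y)

/-- The matrix `X₁(u)`. -/
def atU₁ {M N : ℕ} {A : Type*} [Ring A] (X : Matrix (Idx M N) (Idx M N) (PowerSeries A)) :
    Matrix (Idx M N × Idx M N) (Idx M N × Idx M N) (MvPowerSeries (Fin 2) A) :=
  leg₁ (X.map (inVar 0))

/-- The matrix `X₂(v)`. -/
def atV₂ {M N : ℕ} {A : Type*} [Ring A] (X : Matrix (Idx M N) (Idx M N) (PowerSeries A)) :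
    Matrix (Idx M N × Idx M N) (Idx M N × Idx M N) (MvPowerSeries (Fin 2) A) :=
  leg₂ (X.map (inVar 1))

/-- `τ[X(u)] = ∑ X^{ab}(-u) E_{ab}^t`. -/
def tau {M N : ℕ} {A : Type*} [Ring A] (θ : Idx M N → ℤˣ)
    (X : Matrix (Idx M N) (Idx M N) (PowerSeries A)) :
    Matrix (Idx M N) (Idx M N) (PowerSeries A) :=
  transp θ (X.map negArg)

/-! ### The three relations -/

/-- Left-hand side of the RTT relation, `R(u - v) T₁(u) T₂(v)`. -/
def rttLHS {M N : ℕ} {A : Type*} [Ring A] (T : Matrix (Idx M N) (Idx M N) (PowerSeries A)) :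
    Matrix (Idx M N × Idx M N) (Idx M N × Idx M N) (MvPowerSeries (Fin 2) A) :=
  Ruv M N A * atU₁ T * atV₂ T

/-- Right-hand side of the RTT relation, `T₂(v) T₁(u) R(u - v)`. -/
def rttRHS {M N : ℕ} {A : Type*} [Ring A] (T : Matrix (Idx M N) (Idx M N) (PowerSeries A)) :
    Matrix (Idx M N × Idx M N) (Idx M N × Idx M N) (MvPowerSeries (Fin 2) A) :=
  atV₂ T * atU₁ T * Ruv M N A

/-- Left-hand side of the reflection relation, `R(u - v) S₁(u) R'(u + v) S₂(v)`. -/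
def reflLHS {M N : ℕ} {A : Type*} [Ring A] (θ : Idx M N → ℤˣ)
    (S : Matrix (Idx M N) (Idx M N) (PowerSeries A)) :
    Matrix (Idx M N × Idx M N) (Idx M N × Idx M N) (MvPowerSeries (Fin 2) A) :=
  Ruv M N A * atU₁ S * Ruv' θ A * atV₂ S

/-- Right-hand side of the reflection relation, `S₂(v) R'(u + v) S₁(u) R(u - v)`. -/
def reflRHS {M N : ℕ} {A : Type*} [Ring A] (θ : Idx M N → ℤˣ)
    (S : Matrix (Idx M N) (Idx M N) (PowerSeries A)) :
    Matrix (Idx M N × Idx M N) (Idx M N × Idx M N) (MvPowerSeries (Fin 2) A) :=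
  atV₂ S * Ruv' θ A * atU₁ S * Ruv M N A

/-- Right-hand side of the symmetry relation, `S(u) + (θ₀ / (2 u)) (S(u) - S(-u))`. -/
def symmRHS {M N : ℕ} {A : Type*} [Ring A] [Algebra ℂ A] (θ₀ : ℤˣ)
    (S : Matrix (Idx M N) (Idx M N) (PowerSeries A)) :
    Matrix (Idx M N) (Idx M N) (PowerSeries A) :=
  S + (θ₀ • (1 / 2 : ℂ) • (PowerSeries.X : PowerSeries A)) • (S - S.map negArg)

/-! ### The algebras -/

/-- The generators: `(a, b, n)` stands for the coefficient of `u^{-(n + 1)} E_{ab}`. -/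
abbrev Gen (M N : ℕ) : Type := Idx M N × Idx M N × ℕ

/-- The matrix series `1 + ∑_{n ≥ 1} u^{-n} ∑_{ab} g(a, b, n - 1) E_{ab}`. -/
def genSeries {M N : ℕ} {A : Type*} [Ring A] (g : Gen M N → A) :
    Matrix (Idx M N) (Idx M N) (PowerSeries A) :=
  Matrix.of fun a b => PowerSeries.mk fun n =>
    match n with
    | 0 => if a = b then 1 else 0
    | k + 1 => g (a, b, k)

/-- The matrix series of the free generators. -/
def freeSeries (M N : ℕ) :
    Matrix (Idx M N) (Idx M N) (PowerSeries (FreeAlgebra ℂ (Gen M N))) :=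
  genSeries (FreeAlgebra.ι ℂ)

/-- The defining relations of the super Yangian: all coefficients of all entries of the RTT
relation. -/
inductive YangianRel (M N : ℕ) : FreeAlgebra ℂ (Gen M N) → FreeAlgebra ℂ (Gen M N) → Prop
  | rtt (p q : Idx M N × Idx M N) (m : Fin 2 →₀ ℕ) :
      YangianRel M N (MvPowerSeries.coeff m (rttLHS (freeSeries M N) p q))
        (MvPowerSeries.coeff m (rttRHS (freeSeries M N) p q))

/-- The super Yangian `Y(M|N)`. -/
abbrev Yangian (M N : ℕ) : Type := RingQuot (YangianRel M N)

/-- The generator `T^{ab}_{(n + 1)}` of `Y(M|N)`, for `(a, b, n)`. -/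
def Tgen {M N : ℕ} (g : Gen M N) : Yangian M N :=
  RingQuot.mkAlgHom ℂ (YangianRel M N) (FreeAlgebra.ι ℂ g)

/-- The matrix `T(u)`. -/
def T (M N : ℕ) : Matrix (Idx M N) (Idx M N) (PowerSeries (Yangian M N)) :=
  genSeries Tgen

/-- The matrix `S(u) = T(u) τ[T(u)]`. -/
def S {M N : ℕ} (θ : Idx M N → ℤˣ) : Matrix (Idx M N) (Idx M N) (PowerSeries (Yangian M N)) :=
  T M N * tau θ (T M N)

/-- The element `S^{ab}_{(n + 1)}` of `Y(M|N)`, for `(a, b, n)`. -/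
def Sgen {M N : ℕ} (θ : Idx M N → ℤˣ) (g : Gen M N) : Yangian M N :=
  PowerSeries.coeff (g.2.2 + 1) (S θ g.1 g.2.1)

/-- `Y(M|N)^τ`: the subalgebra of `Y(M|N)` generated by the coefficients of `S(u)`. -/
def twistedYangian {M N : ℕ} (θ : Idx M N → ℤˣ) : Subalgebra ℂ (Yangian M N) :=
  Algebra.adjoin ℂ (Set.range (Sgen θ))

/-- All coefficients of all entries of the reflection and of the symmetry relation. -/
inductive TwistedRel {M N : ℕ} (θ : Idx M N → ℤˣ) (θ₀ : ℤˣ) :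
    FreeAlgebra ℂ (Gen M N) → FreeAlgebra ℂ (Gen M N) → Prop
  | refl (p q : Idx M N × Idx M N) (m : Fin 2 →₀ ℕ) :
      TwistedRel θ θ₀ (MvPowerSeries.coeff m (reflLHS θ (freeSeries M N) p q))
        (MvPowerSeries.coeff m (reflRHS θ (freeSeries M N) p q))
  | symm (a b : Idx M N) (n : ℕ) :
      TwistedRel θ θ₀ (PowerSeries.coeff n (tau θ (freeSeries M N) a b))
        (PowerSeries.coeff n (symmRHS θ₀ (freeSeries M N) a b))

/-- The abstract algebra presented by generators `σ^{ab}_{(n)}`, `n ≥ 1`, subject to the reflection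
and the symmetry relation only. -/
abbrev Presented {M N : ℕ} (θ : Idx M N → ℤˣ) (θ₀ : ℤˣ) : Type := RingQuot (TwistedRel θ θ₀)

/-- The generator `σ^{ab}_{(n + 1)}` of the presented algebra, for `(a, b, n)`. -/
def sigma {M N : ℕ} (θ : Idx M N → ℤˣ) (θ₀ : ℤˣ) (g : Gen M N) : Presented θ θ₀ :=
  RingQuot.mkAlgHom ℂ (TwistedRel θ θ₀) (FreeAlgebra.ι ℂ g)

end TwistedSuperYangian

end

/-! Both relations are consequences of the RTT relation. Substituting `u → -u` or exchanging `u` and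
`v` produces RTT relations for all pairs among `T(u)`, `T(-u)`, `T(v)`, `T(-v)` that are needed.
Transposing one factor turns `R` into `R'` (`RTTPair.transp_left`); transposing both factors keeps
`R` and exchanges the two matrices (`RTTPair.transp_transp`). Since `P Q = Q P = θ₀ Q`, the matrices
`R` and `R'` commute, and the reflection relation follows by moving factors past each other
(`reflection_of_pairs`). The symmetry relation is the RTT relation on the line `v = -u`, used to
reorder the two factors in every entry of `T(u) τ[T(u)]` (`SatisfiesRTT.symmetry`).

For the presentation, the homomorphism from the presented algebra onto the subalgebra exists because
of the two relations; only injectivity is hard. It is a Poincaré-Birkhoff-Witt argument with an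
upper and a lower bound.

Upper bound: give `σ_(n)` weight `n`. The reflection relation makes generators supercommute modulo
lower weight (`supercommutator_mem`), and the symmetry relation identifies each generator with plus
or minus its partner modulo lower weight (`sub_star_mem`). Hence words can be sorted, repeated odd
letters removed and one letter kept from each pair of partners: ordered monomials span
(`adjoin_le_orderedSpan`).

Lower bound: the same ordered monomials in the `S_(n)` are linearly independent in `Y(M|N)`. No
basis of `Y(M|N)` is needed, only enough homomorphisms out of it. They come from products of
evaluation solutions `1 + e / (u - z)`, with a polynomial variable in which `T_(n)` has degree at
most `n - 1`. The leading coefficients of `S_(n)` are then symmetrised elements of a current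
superalgebra `gl(M|N)[z]`. In a product of `n` evaluation factors, a functional that reads one
matrix coefficient from each factor detects a chosen ordered monomial of length `n` and kills all
others of length `n` and all shorter monomials (`Separates.step`, `exists_model`). Applying this to
a word of a linear combination that is maximal in degree and then in length shows that its
coefficient is zero. -/

noncomputable section

namespace TwistedSuperYangian

open Matrix

/-- Matrices acting on the tensor square. -/
abbrev Mat₂ (M N : ℕ) (R : Type*) : Type _ :=
  Matrix (Idx M N × Idx M N) (Idx M N × Idx M N) R

/-! ### Entrywise calculus of graded tensor products, `P` and `Q` -/

section GradedMatrices

variable {M N : ℕ} {R : Type*} [Ring R]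

@[simp] theorem deg_bar (a : Idx M N) : deg (bar a) = deg a := by
  rcases a with a | a <;> rfl

@[simp] theorem bar_bar (a : Idx M N) : bar (bar a) = a := by
  rcases a with a | a <;> simp [bar]

theorem bar_injective : Function.Injective (bar : Idx M N → Idx M N) :=
  Function.LeftInverse.injective bar_bar

theorem bar_eq_iff {a b : Idx M N} : bar a = b ↔ a = bar b :=
  ⟨fun h => by rw [← h, bar_bar], fun h => by rw [h, bar_bar]⟩

theorem deg_cases (a : Idx M N) : deg a = 0 ∨ deg a = 1 := by
  rcases a with a | a <;> simp [deg]

theorem sum_bar {B : Type*} [AddCommMonoid B] (f : Idx M N → B) : ∑ i, f (bar i) = ∑ i, f i :=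
  Equiv.sum_comp (⟨bar, bar, bar_bar, bar_bar⟩ : Idx M N ≃ Idx M N) f

theorem leg₁_apply (X : Matrix (Idx M N) (Idx M N) R) (a c b d : Idx M N) :
    leg₁ X (a, c) (b, d) = if c = d then X a b else 0 := by
  by_cases h : c = d
  · subst h; simp [leg₁, gtensor]
  · simp [leg₁, gtensor, h]

theorem leg₂_apply (Y : Matrix (Idx M N) (Idx M N) R) (a c b d : Idx M N) :
    leg₂ Y (a, c) (b, d) =
      if a = b then (-1 : ℤˣ) ^ ((deg c + deg d) * deg b) • Y c d else 0 := by
  by_cases h : a = b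
  · subst h; simp [leg₂, gtensor]
  · simp [leg₂, gtensor, h]

theorem leg₁_mul_apply (X : Matrix (Idx M N) (Idx M N) R)
    (Z : Mat₂ M N R) (a c : Idx M N)
    (q : Idx M N × Idx M N) : (leg₁ X * Z) (a, c) q = ∑ e, X a e * Z (e, c) q := by
  rw [Matrix.mul_apply, Fintype.sum_prod_type]
  simp [leg₁_apply, -Fintype.sum_sum_type]

theorem mul_leg₁_apply (X : Matrix (Idx M N) (Idx M N) R)
    (Z : Mat₂ M N R) (b d : Idx M N)
    (p : Idx M N × Idx M N) : (Z * leg₁ X) p (b, d) = ∑ e, Z p (e, d) * X e b := by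
  rw [Matrix.mul_apply, Fintype.sum_prod_type]
  simp [leg₁_apply, -Fintype.sum_sum_type]

theorem leg₂_mul_apply (Y : Matrix (Idx M N) (Idx M N) R)
    (Z : Mat₂ M N R) (a c : Idx M N)
    (q : Idx M N × Idx M N) : (leg₂ Y * Z) (a, c) q =
      ∑ e, (-1 : ℤˣ) ^ ((deg c + deg e) * deg a) • (Y c e * Z (a, e) q) := by
  rw [Matrix.mul_apply, Fintype.sum_prod_type]
  simp [leg₂_apply, smul_mul_assoc, -Fintype.sum_sum_type]

theorem mul_leg₂_apply (Y : Matrix (Idx M N) (Idx M N) R)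
    (Z : Mat₂ M N R) (b d : Idx M N)
    (p : Idx M N × Idx M N) : (Z * leg₂ Y) p (b, d) =
      ∑ e, (-1 : ℤˣ) ^ ((deg e + deg d) * deg b) • (Z p (b, e) * Y e d) := by
  rw [Matrix.mul_apply, Fintype.sum_prod_type]
  simp [leg₂_apply, mul_smul_comm, -Fintype.sum_sum_type]

theorem leg₁_mul_leg₂_apply (X Y : Matrix (Idx M N) (Idx M N) R) (a c b d : Idx M N) :
    (leg₁ X * leg₂ Y) (a, c) (b, d) =
      (-1 : ℤˣ) ^ ((deg c + deg d) * deg b) • (X a b * Y c d) := by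
  rw [leg₁_mul_apply]
  simp [leg₂_apply, mul_smul_comm, -Fintype.sum_sum_type]

theorem leg₂_mul_leg₁_apply (X Y : Matrix (Idx M N) (Idx M N) R) (a c b d : Idx M N) :
    (leg₂ Y * leg₁ X) (a, c) (b, d) =
      (-1 : ℤˣ) ^ ((deg c + deg d) * deg a) • (Y c d * X a b) := by
  rw [leg₂_mul_apply]
  simp [leg₁_apply, -Fintype.sum_sum_type]

theorem P_apply (a c b d : Idx M N) :
    (P : Mat₂ M N R) (a, c) (b, d) =
      if a = d ∧ c = b then (((-1 : ℤˣ) ^ (deg a * deg c) : ℤˣ) • (1 : R)) else 0 := by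
  simp only [P, gtensor_E, smul_smul, Matrix.sum_apply, Matrix.smul_apply, Matrix.single_apply,
    Prod.mk.injEq]
  rw [Finset.sum_eq_single a, Finset.sum_eq_single c]
  · by_cases h : a = d <;> by_cases h' : c = b <;> simp [h, h', eq_comm]
    subst h h'
    rcases deg_cases a with ha | ha <;> rcases deg_cases c with hc | hc <;> simp [ha, hc]
  · intro j _ hj; simp [hj]
  · simp
  · intro i _ hi; simp [hi]
  · simp

theorem P_mul_apply (Z : Mat₂ M N R) (a c : Idx M N)
    (q : Idx M N × Idx M N) :
    ((P : Mat₂ M N R) * Z) (a, c) q = (-1 : ℤˣ) ^ (deg a * deg c) • Z (c, a) q := by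
  rw [Matrix.mul_apply, Fintype.sum_prod_type, Finset.sum_eq_single c, Finset.sum_eq_single a]
  · simp [P_apply]
  · intro j _ hj; simp [P_apply, hj.symm]
  · simp
  · intro j _ hj; simp [P_apply, hj.symm]
  · simp

theorem mul_P_apply (Z : Mat₂ M N R) (b d : Idx M N)
    (p : Idx M N × Idx M N) :
    (Z * (P : Mat₂ M N R)) p (b, d) = (-1 : ℤˣ) ^ (deg b * deg d) • Z p (d, b) := by
  rw [Matrix.mul_apply, Fintype.sum_prod_type, Finset.sum_eq_single d, Finset.sum_eq_single b]
  · simp [P_apply, mul_comm]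
  · intro j _ hj; simp [P_apply, hj]
  · simp
  · intro j _ hj; simp [P_apply, hj]
  · simp

theorem P_mul_P : (P * P : Mat₂ M N R) = 1 := by
  ext ⟨a, c⟩ ⟨b, d⟩
  rw [P_mul_apply, P_apply, Matrix.one_apply]
  by_cases h : a = b <;> by_cases h' : c = d <;> simp [h, h', smul_smul, mul_comm]

theorem P_mul_leg₁_mul_P (X : Matrix (Idx M N) (Idx M N) R) : (P : Mat₂ M N R) * leg₁ X * P = leg₂ X := by
  ext ⟨a, c⟩ ⟨b, d⟩
  rw [mul_P_apply, P_mul_apply, leg₁_apply, leg₂_apply, smul_smul, ← pow_add]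
  by_cases h : a = b
  · subst h
    simp only [if_true]
    congr 2
    ring
  · simp [h]

theorem leg₁_mul (X Y : Matrix (Idx M N) (Idx M N) R) : leg₁ (X * Y) = leg₁ X * leg₁ Y := by
  ext ⟨a, c⟩ ⟨b, d⟩
  rw [leg₁_mul_apply]
  simp only [leg₁_apply, Matrix.mul_apply]
  by_cases h : c = d <;> simp [h]

/-- Conjugation by `P` transfers multiplicativity from the first leg, where no signs occur. -/
theorem leg₂_mul (X Y : Matrix (Idx M N) (Idx M N) R) : leg₂ (X * Y) = leg₂ X * leg₂ Y := by
  rw [← P_mul_leg₁_mul_P, ← P_mul_leg₁_mul_P, ← P_mul_leg₁_mul_P, leg₁_mul]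
  have h := P_mul_P (M := M) (N := N) (R := R)
  calc P * (leg₁ X * leg₁ Y) * P = (P : Mat₂ M N R) * leg₁ X * 1 * leg₁ Y * P := by
        simp only [mul_assoc, one_mul]
    _ = _ := by rw [← h]; simp only [mul_assoc]

theorem P_mul_leg₂_mul_P (X : Matrix (Idx M N) (Idx M N) R) : (P : Mat₂ M N R) * leg₂ X * P = leg₁ X := by
  rw [← P_mul_leg₁_mul_P]
  have h := P_mul_P (M := M) (N := N) (R := R)
  calc P * ((P : Mat₂ M N R) * leg₁ X * P) * P = (P * P) * leg₁ X * (P * P) := by simp only [mul_assoc]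
    _ = _ := by rw [h]; simp

/-- The sign in `(E_{b̄ā})^t = ± E_{ab}`. -/
def transpSign (θ : Idx M N → ℤˣ) (a b : Idx M N) : ℤˣ :=
  (-1 : ℤˣ) ^ (deg b * (deg a + 1)) * θ (bar b) * θ (bar a)

theorem transp_apply (θ : Idx M N → ℤˣ) (X : Matrix (Idx M N) (Idx M N) R) (a b : Idx M N) :
    transp θ X a b = transpSign θ a b • X (bar b) (bar a) := by
  simp only [transp, Matrix.sum_apply, Matrix.smul_apply, Matrix.single_apply]
  rw [Finset.sum_eq_single (bar b), Finset.sum_eq_single (bar a)]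
  · simp [transpSign]
  · intro j _ hj; simp [bar_eq_iff, hj]
  · simp
  · intro j _ hj; simp [bar_eq_iff, hj]
  · simp

theorem Q_apply (θ : Idx M N → ℤˣ) (a c b d : Idx M N) :
    (Q θ : Mat₂ M N R) (a, c) (b, d) =
      if a = bar c ∧ b = bar d then (((-1 : ℤˣ) ^ deg c * θ c * θ d : ℤˣ) • (1 : R)) else 0 := by
  have h1 : ∀ i j k l : Idx M N,
      (((-1 : ℤˣ) ^ ((deg k + deg l) * deg j) • (P : Matrix _ _ R) (i, k) (j, l)) •
        gtensor (transp θ (E i j)) (E k l)) (a, c) (b, d) =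
      if i = d ∧ k = c ∧ j = c ∧ l = d then
        (if a = bar c ∧ b = bar d then (((-1 : ℤˣ) ^ deg c * θ c * θ d : ℤˣ) • (1 : R)) else 0)
      else 0 := by
    intro i j k l
    rw [P_apply]
    by_cases h : i = l ∧ k = j
    · obtain ⟨rfl, rfl⟩ := h
      have h0 : ∀ (A : Matrix (Idx M N) (Idx M N) R) (B : Matrix (Idx M N) (Idx M N) R) (r : R)
        (s : ℤˣ), (r • gtensor A B) (a, c) (b, d) =
          (-1 : ℤˣ) ^ ((deg c + deg d) * deg b) • (r * (A a b * B c d)) := by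
        intro A B r s
        simp [gtensor, mul_smul_comm]
      rw [h0 _ _ _ 1, transp_apply]
      by_cases h2 : k = c
      · by_cases h3 : i = d
        · subst h2 h3
          by_cases h4 : a = bar k
          · by_cases h5 : b = bar i
            · subst h4 h5
              simp only [E, transpSign, deg_bar, bar_bar]
              rcases deg_cases i with hi | hi <;> rcases deg_cases k with hk | hk <;>
                simp [hi, hk, smul_smul, mul_comm]
            · have : i ≠ bar b := fun h => h5 (by rw [h, bar_bar])
              simp [E, h5, this]
          · have : k ≠ bar a := fun h => h4 (by rw [h, bar_bar])
            simp [E, h4, this]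
        · simp [E, h3]
      · simp [E, h2]
    · rw [if_neg h, if_neg]
      · simp
      · rintro ⟨rfl, rfl, rfl, rfl⟩
        exact h ⟨rfl, rfl⟩
  simp only [Q, transp₁, Matrix.sum_apply, h1]
  rw [Finset.sum_eq_single d, Finset.sum_eq_single c, Finset.sum_eq_single c,
    Finset.sum_eq_single d]
  all_goals simp +contextual

/-- The rows of `Q` are supported on pairs `(c̄, c)`, and `P` exchanges such a pair with `(c, c̄)`.
The ratio of the two signs is `(-1)^[c] θ_c θ_c̄`, which the hypothesis makes independent of `c`. -/
theorem P_mul_Q {θ : Idx M N → ℤˣ} {θ₀ : ℤˣ}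
    (hθ : ∀ a : Idx M N, (-1 : ℤˣ) ^ deg a * θ a * θ (bar a) = θ₀) :
    (P : Mat₂ M N R) * Q θ = θ₀ • Q θ := by
  ext ⟨a, c⟩ ⟨b, d⟩
  rw [P_mul_apply, Matrix.smul_apply, Q_apply, Q_apply]
  by_cases h : a = bar c
  · subst h
    by_cases h' : b = bar d
    · subst h'
      simp only [bar_bar, and_self, if_true, deg_bar, smul_smul, ← hθ c]
      congr 1
      rcases deg_cases c with hc | hc <;>
        rcases Int.units_eq_one_or (θ c) with h1 | h1 <;> simp [hc, h1]
    · simp [h']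
  · have : c ≠ bar a := fun h' => h (by rw [h', bar_bar])
    simp [h, this]

theorem Q_mul_P {θ : Idx M N → ℤˣ} {θ₀ : ℤˣ}
    (hθ : ∀ a : Idx M N, (-1 : ℤˣ) ^ deg a * θ a * θ (bar a) = θ₀) :
    Q θ * (P : Mat₂ M N R) = θ₀ • Q θ := by
  ext ⟨a, c⟩ ⟨b, d⟩
  rw [mul_P_apply, Matrix.smul_apply, Q_apply, Q_apply]
  by_cases h : b = bar d
  · subst h
    by_cases h' : a = bar c
    · subst h'
      simp only [bar_bar, and_self, if_true, deg_bar, smul_smul, ← hθ d]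
      congr 1
      rcases deg_cases d with hc | hc <;>
        rcases Int.units_eq_one_or (θ d) with h1 | h1 <;> simp [hc, h1, mul_comm]
    · simp [h']
  · have : d ≠ bar b := fun h' => h (by rw [h', bar_bar])
    simp [h, this]

end GradedMatrices

end TwistedSuperYangian

end

noncomputable section

namespace TwistedSuperYangian

open Matrix

/-! ### The RTT relation for a pair of matrices, its transpositions, and the reflection relation -/

section Pairs

variable {M N : ℕ} {C : Type*} [Ring C]

theorem mul_smul_of_central {n : Type*} [Fintype n] {q : C} (hq : ∀ c, Commute q c)
    (Z W : Matrix n n C) : Z * (q • W) = q • (Z * W) := by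
  ext i j
  simp only [Matrix.mul_apply, Matrix.smul_apply, smul_eq_mul, Finset.mul_sum]
  exact Finset.sum_congr rfl fun k _ => by
    rw [← mul_assoc, ← (hq (Z i k)).eq, mul_assoc]

theorem Rmat_mul (q p : C) (Z : Mat₂ M N C) : Rmat q p * Z = q • Z - p • (P * Z) := by
  simp [Rmat, sub_mul]

theorem mul_Rmat {q p : C} (hq : ∀ c, Commute q c) (hp : ∀ c, Commute p c) (Z : Mat₂ M N C) :
    Z * Rmat q p = q • Z - p • (Z * P) := by
  rw [Rmat, mul_sub, mul_smul_of_central hq, mul_smul_of_central hp, mul_one]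

theorem Rmat'_mul (θ : Idx M N → ℤˣ) (q p : C) (Z : Mat₂ M N C) :
    Rmat' θ q p * Z = q • Z + p • (Q θ * Z) := by
  simp [Rmat'_eq, add_mul]

theorem mul_Rmat' (θ : Idx M N → ℤˣ) {q p : C} (hq : ∀ c, Commute q c) (hp : ∀ c, Commute p c)
    (Z : Mat₂ M N C) : Z * Rmat' θ q p = q • Z + p • (Z * Q θ) := by
  rw [Rmat'_eq, mul_add, mul_smul_of_central hq, mul_smul_of_central hp, mul_one]

/-- The relation `R X₁ Y₂ = Y₂ X₁ R` for the matrix `R = q - p P`. -/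
def RTTPair (q p : C) (X Y : Matrix (Idx M N) (Idx M N) C) : Prop :=
  Rmat q p * leg₁ X * leg₂ Y = leg₂ Y * leg₁ X * Rmat q p

/-- The sign of the exchange of `E_{ab}` and `E_{cd}`. -/
def exchSign (a b c d : Idx M N) : ℤˣ := (-1 : ℤˣ) ^ ((deg a + deg b) * (deg c + deg d))

/-- The sign in the entries of the RTT relation. -/
def rttSign (a b c : Idx M N) : ℤˣ :=
  (-1 : ℤˣ) ^ (deg a * deg c + deg a * deg b + deg c * deg b)

/-- The tensor identity, read at `((a, c), (b, d))`, is one overall sign times an identity between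
supercommutators of entries. All sign computations are carried out in this form. -/
theorem rttPair_iff {q p : C} (hq : ∀ c, Commute q c) (hp : ∀ c, Commute p c)
    {X Y : Matrix (Idx M N) (Idx M N) C} :
    RTTPair q p X Y ↔ ∀ a b c d, q * (X a b * Y c d - exchSign a b c d • (Y c d * X a b)) =
      rttSign a b c • (p * (X c b * Y a d - Y c b * X a d)) := by
  have key : ∀ a b c d, (Rmat q p * leg₁ X * leg₂ Y - leg₂ Y * leg₁ X * Rmat q p : Mat₂ M N C) (a, c) (b, d) =
      (-1 : ℤˣ) ^ ((deg c + deg d) * deg b) •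
        (q * (X a b * Y c d - exchSign a b c d • (Y c d * X a b)) -
          rttSign a b c • (p * (X c b * Y a d - Y c b * X a d))) := by
    intro a b c d
    rw [mul_assoc, Rmat_mul, mul_Rmat hq hp]
    simp only [Matrix.sub_apply, Matrix.smul_apply, leg₁_mul_leg₂_apply, leg₂_mul_leg₁_apply,
      P_mul_apply, mul_P_apply, smul_eq_mul, exchSign, rttSign]
    rcases deg_cases a with ha | ha <;> rcases deg_cases b with hb | hb <;>
      rcases deg_cases c with hc | hc <;> rcases deg_cases d with hd | hd <;>
      simp only [ha, hb, hc, hd, mul_smul_comm, mul_sub, smul_sub, smul_smul] <;>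
      simp [pow_succ, sub_eq_add_neg] <;> abel
  rw [RTTPair, ← sub_eq_zero]
  constructor
  · intro h a b c d
    have := key a b c d
    rw [h, Matrix.zero_apply, eq_comm, smul_eq_zero_iff_eq, sub_eq_zero] at this
    exact this
  · intro h
    ext ⟨a, c⟩ ⟨b, d⟩
    rw [key, h, sub_self, smul_zero, Matrix.zero_apply]

theorem RTTPair.map {D : Type*} [Ring D] (f : C →+* D) {q p : C} (hq : ∀ c, Commute q c)
    (hp : ∀ c, Commute p c) {X Y : Matrix (Idx M N) (Idx M N) C} (h : RTTPair q p X Y)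
    {q' p' : D} (hq' : ∀ c, Commute q' c) (hp' : ∀ c, Commute p' c) (hfq : f q = q')
    (hfp : f p = p') : RTTPair q' p' (X.map f) (Y.map f) := by
  rw [rttPair_iff hq hp] at h
  rw [rttPair_iff hq' hp']
  intro a b c d
  have := congrArg f (h a b c d)
  simpa only [Matrix.map_apply, Units.smul_def, map_mul, map_sub, map_zsmul, hfq, hfp] using this

/-- This is the comultiplication of the Yangian: `X'` moves past `Y` and `X` past `Y'`, so `R` can
pass through the two pairs one after the other. -/
theorem RTTPair.mul {q p : C} {X X' Y Y' : Matrix (Idx M N) (Idx M N) C} (h : RTTPair q p X Y)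
    (h' : RTTPair q p X' Y') (h₁ : leg₁ X' * leg₂ Y = leg₂ Y * leg₁ X')
    (h₂ : leg₁ X * leg₂ Y' = leg₂ Y' * leg₁ X) : RTTPair q p (X * X') (Y * Y') := by
  unfold RTTPair at *
  rw [leg₁_mul, leg₂_mul]
  calc Rmat q p * (leg₁ X * leg₁ X') * (leg₂ Y * leg₂ Y')
      = Rmat q p * leg₁ X * (leg₁ X' * leg₂ Y) * leg₂ Y' := by simp only [mul_assoc]
    _ = (Rmat q p * leg₁ X * leg₂ Y) * leg₁ X' * leg₂ Y' := by rw [h₁]; simp only [mul_assoc]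
    _ = leg₂ Y * leg₁ X * (Rmat q p * leg₁ X' * leg₂ Y') := by rw [h]; simp only [mul_assoc]
    _ = leg₂ Y * (leg₁ X * leg₂ Y') * leg₁ X' * Rmat q p := by rw [h']; simp only [mul_assoc]
    _ = _ := by rw [h₂]; simp only [mul_assoc]

/-- The Koszul signs of the two tensor products differ by the exchange sign, so supercommuting
entries give legs that commute in the ordinary sense. -/
theorem leg₁_leg₂_comm {X Y : Matrix (Idx M N) (Idx M N) C}
    (h : ∀ a b c d, X a b * Y c d = exchSign a b c d • (Y c d * X a b)) :
    leg₁ X * leg₂ Y = leg₂ Y * leg₁ X := by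
  ext ⟨a, c⟩ ⟨b, d⟩
  rw [leg₁_mul_leg₂_apply, leg₂_mul_leg₁_apply, h, smul_smul]
  congr 1
  rw [exchSign, ← pow_add]
  rcases deg_cases a with ha | ha <;> rcases deg_cases b with hb | hb <;>
      rcases deg_cases c with hc | hc <;> rcases deg_cases d with hd | hd <;>
      simp [ha, hb, hc, hd, pow_succ]

/-- The relation between `X^t` and `Y` obtained by transposing the first factor. -/
theorem RTTPair.transp_left {q p : C} (hq : ∀ c, Commute q c) (hp : ∀ c, Commute p c)
    {X Y : Matrix (Idx M N) (Idx M N) C} (θ : Idx M N → ℤˣ) (h : RTTPair q (-p) X Y) :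
    leg₁ (transp θ X) * Rmat' θ q p * leg₂ Y = leg₂ Y * Rmat' θ q p * leg₁ (transp θ X) := by
  rw [rttPair_iff hq (fun c => (hp c).neg_left)] at h
  -- `Q` has rank one up to signs, so in the products with `Q` both summation indices are forced and
  -- a single term survives.
  have hQ₁ : ∀ a c b d, (leg₁ (transp θ X) * (Q θ * leg₂ Y) : Mat₂ M N C) (a, c) (b, d) =
      ((-1 : ℤˣ) ^ ((deg b + deg d) * deg b) * (transpSign θ a (bar c) * ((-1) ^ deg c * θ c *
        θ (bar b)))) • (X c (bar a) * Y (bar b) d) := by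
    intro a c b d
    rw [leg₁_mul_apply, Finset.sum_eq_single (bar c), mul_leg₂_apply,
      Finset.sum_eq_single (bar b)]
    · simp [Q_apply, transp_apply, smul_smul, smul_mul_assoc, mul_smul_comm, mul_assoc, mul_comm,
        mul_left_comm]
    · intro e _ he
      have : b ≠ bar e := fun h => he (by rw [h, bar_bar])
      simp [Q_apply, this]
    · simp
    · intro e _ he
      rw [mul_leg₂_apply]
      simp [Q_apply, he, -Fintype.sum_sum_type]
    · simp
  have hQ₂ : ∀ a c b d, (leg₂ Y * (Q θ * leg₁ (transp θ X)) : Mat₂ M N C) (a, c) (b, d) =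
      ((-1 : ℤˣ) ^ ((deg c + deg a) * deg a) * (((-1) ^ deg a * θ (bar a) *
        θ d) * transpSign θ (bar d) b)) • (Y c (bar a) * X (bar b) d) := by
    intro a c b d
    rw [leg₂_mul_apply, Finset.sum_eq_single (bar a), mul_leg₁_apply,
      Finset.sum_eq_single (bar d)]
    · simp [Q_apply, transp_apply, smul_smul, smul_mul_assoc, mul_smul_comm, mul_assoc, mul_comm,
        mul_left_comm]
    · intro e _ he
      simp [Q_apply, he]
    · simp
    · intro e _ he
      have : a ≠ bar e := fun h => he (by rw [h, bar_bar])
      rw [mul_leg₁_apply]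
      simp [Q_apply, this, -Fintype.sum_sum_type]
    · simp
  rw [mul_assoc, Rmat'_mul, mul_assoc, Rmat'_mul, mul_add, mul_smul_of_central hq,
    mul_smul_of_central hp, mul_add, mul_smul_of_central hq, mul_smul_of_central hp]
  ext ⟨a, c⟩ ⟨b, d⟩
  simp only [Matrix.add_apply, Matrix.smul_apply, leg₁_mul_leg₂_apply, leg₂_mul_leg₁_apply,
    hQ₁, hQ₂, smul_eq_mul, transp_apply]
  -- The entry of the transposed relation is the original relation at the reflected indices of `X`.
  -- The terms with `Q` become the right-hand side of that relation; `e1`, `e2`, `e3` compare the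
  -- signs.
  have h' := h (bar b) (bar a) c d
  have e1 : (-1 : ℤˣ) ^ ((deg b + deg d) * deg b) * (transpSign θ a (bar c) * ((-1) ^ deg c * θ c *
        θ (bar b))) = rttSign (bar b) (bar a) c * ((-1) ^ ((deg c + deg d) * deg b) *
          transpSign θ a b) := by
    simp only [transpSign, rttSign, deg_bar, bar_bar]
    rcases deg_cases a with ha | ha <;> rcases deg_cases b with hb | hb <;>
      rcases deg_cases c with hc | hc <;> rcases deg_cases d with hd | hd <;>
      rcases Int.units_eq_one_or (θ c) with h1 | h1 <;>
      simp [ha, hb, hc, hd, h1, pow_succ, mul_comm]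
  have e2 : (-1 : ℤˣ) ^ ((deg c + deg a) * deg a) * (((-1) ^ deg a * θ (bar a) *
        θ d) * transpSign θ (bar d) b) = rttSign (bar b) (bar a) c *
          ((-1) ^ ((deg c + deg d) * deg b) * transpSign θ a b) := by
    simp only [transpSign, rttSign, deg_bar, bar_bar]
    rcases deg_cases a with ha | ha <;> rcases deg_cases b with hb | hb <;>
      rcases deg_cases c with hc | hc <;> rcases deg_cases d with hd | hd <;>
      rcases Int.units_eq_one_or (θ d) with h1 | h1 <;>
      simp [ha, hb, hc, hd, h1, pow_succ, mul_comm]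
  have e3 : (-1 : ℤˣ) ^ ((deg c + deg d) * deg a) = (-1 : ℤˣ) ^ ((deg c + deg d) * deg b) *
      exchSign (bar b) (bar a) c d := by
    simp only [exchSign, deg_bar]
    rcases deg_cases a with ha | ha <;> rcases deg_cases b with hb | hb <;>
      rcases deg_cases c with hc | hc <;> rcases deg_cases d with hd | hd <;>
      simp [ha, hb, hc, hd, pow_succ]
  rw [e1, e2, e3]
  generalize (-1 : ℤˣ) ^ ((deg c + deg d) * deg b) = s1 at *
  generalize transpSign θ a b = s2 at *
  generalize exchSign (bar b) (bar a) c d = s3 at *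
  generalize rttSign (bar b) (bar a) c = s4 at *
  rcases Int.units_eq_one_or s1 with rfl | rfl <;> rcases Int.units_eq_one_or s2 with rfl | rfl <;>
    rcases Int.units_eq_one_or s3 with rfl | rfl <;>
    rcases Int.units_eq_one_or s4 with rfl | rfl <;>
    simp [mul_sub, mul_add] at h' ⊢ <;>
    first
    | linear_combination (norm := module) h'
    | linear_combination (norm := module) -h'

/-- Transposition reverses products, which exchanges the roles of the two matrices, while `R` itself
is preserved. Entrywise it is the relation at the reflected indices in reverse order. -/
theorem RTTPair.transp_transp {q p : C} (hq : ∀ c, Commute q c) (hp : ∀ c, Commute p c)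
    {X Y : Matrix (Idx M N) (Idx M N) C} (θ : Idx M N → ℤˣ) (h : RTTPair q p X Y) :
    RTTPair q p (transp θ Y) (transp θ X) := by
  rw [rttPair_iff hq hp] at h ⊢
  intro a b c d
  have h' := h (bar d) (bar c) (bar b) (bar a)
  simp only [transp_apply, smul_mul_assoc, mul_smul_comm, smul_smul]
  have e1 : transpSign θ a d * transpSign θ c b = exchSign a b c d *
      rttSign a b c * rttSign (bar d) (bar c) (bar b) * (transpSign θ a b * transpSign θ c d) := by
    simp only [transpSign, rttSign, exchSign, deg_bar]
    rcases deg_cases a with ha | ha <;> rcases deg_cases b with hb | hb <;>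
      rcases deg_cases c with hc | hc <;> rcases deg_cases d with hd | hd <;>
      simp [ha, hb, hc, hd, pow_succ, mul_comm, mul_left_comm, mul_assoc]
  have e2 : exchSign (bar d) (bar c) (bar b) (bar a) = exchSign a b c d := by
    simp only [exchSign, deg_bar]
    congr 1
    ring
  rw [e2] at h'
  rw [mul_comm (transpSign θ c d) (transpSign θ a b), e1]
  generalize transpSign θ a b * transpSign θ c d = s1 at *
  generalize exchSign a b c d = s3 at *
  generalize rttSign a b c = s2 at *
  generalize rttSign (bar d) (bar c) (bar b) = s4 at *
  rcases Int.units_eq_one_or s1 with rfl | rfl <;> rcases Int.units_eq_one_or s2 with rfl | rfl <;>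
    rcases Int.units_eq_one_or s3 with rfl | rfl <;>
    rcases Int.units_eq_one_or s4 with rfl | rfl <;>
    simp [mul_sub, mul_add] at h' ⊢ <;>
    first
    | linear_combination (norm := module) h'
    | linear_combination (norm := module) -h'

/-- Multiplying `Q` by `P` from either side gives the same multiple `θ₀ Q`. -/
theorem Rmat_mul_Rmat' {θ : Idx M N → ℤˣ} {θ₀ : ℤˣ}
    (hθ : ∀ a : Idx M N, (-1 : ℤˣ) ^ deg a * θ a * θ (bar a) = θ₀) {q p q' p' : C}
    (hq : ∀ c, Commute q c) (hp : ∀ c, Commute p c) (hq' : ∀ c, Commute q' c)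
    (hp' : ∀ c, Commute p' c) : Rmat q p * Rmat' θ q' p' = Rmat' θ q' p' * Rmat q p := by
  rw [Rmat_mul, mul_Rmat hq hp, Rmat'_eq, mul_add, add_mul, mul_smul_of_central hq',
    mul_smul_of_central hp', P_mul_Q hθ, smul_mul_assoc, smul_mul_assoc, Q_mul_P hθ, mul_one,
    one_mul]

theorem P_mul_Rmat'_mul_P {θ : Idx M N → ℤˣ} {θ₀ : ℤˣ}
    (hθ : ∀ a : Idx M N, (-1 : ℤˣ) ^ deg a * θ a * θ (bar a) = θ₀) {q p : C}
    (hq : ∀ c, Commute q c) (hp : ∀ c, Commute p c) :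
    (P : Mat₂ M N C) * Rmat' θ q p * P = Rmat' θ q p := by
  rw [mul_Rmat' θ hq hp, add_mul, smul_mul_assoc, smul_mul_assoc, P_mul_P, P_mul_Q hθ, smul_mul_assoc,
    Q_mul_P hθ, smul_smul, Int.units_mul_self, one_smul, Rmat'_eq]

/-- The reflection relation for `X X'` and `Y Y'`, where `X'` and `Y'` are the transposes of
`Z = X(-u)` and `W = Y(-v)`. -/
theorem reflection_of_pairs {θ : Idx M N → ℤˣ} {θ₀ : ℤˣ}
    (hθ : ∀ a : Idx M N, (-1 : ℤˣ) ^ deg a * θ a * θ (bar a) = θ₀) {q p q' : C}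
    (hq : ∀ c, Commute q c) (hp : ∀ c, Commute p c) (hq' : ∀ c, Commute q' c)
    {X Y Z W : Matrix (Idx M N) (Idx M N) C} (hXY : RTTPair q p X Y) (hZY : RTTPair q' (-p) Z Y)
    (hWX : RTTPair q' (-p) W X) (hWZ : RTTPair q p W Z) :
    Rmat q p * leg₁ (X * transp θ Z) * Rmat' θ q' p * leg₂ (Y * transp θ W) =
      leg₂ (Y * transp θ W) * Rmat' θ q' p * leg₁ (X * transp θ Z) * Rmat q p := by
  have h1 := hZY.transp_left hq' hp θ
  have h2 : leg₂ (transp θ W) * Rmat' θ q' p * leg₁ X = leg₁ X * Rmat' θ q' p * leg₂ (transp θ W) := by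
    have h := hWX.transp_left hq' hp θ
    have hP := P_mul_P (M := M) (N := N) (R := C)
    -- Conjugation by `P` exchanges the legs and fixes `R'`, turning the relation for `W^t` in the
    -- first leg into one for `W^t` in the second.
    rw [← P_mul_leg₁_mul_P (transp θ W), ← P_mul_leg₂_mul_P X,
      ← P_mul_Rmat'_mul_P hθ hq' hp]
    have hc : ∀ A B D : Mat₂ M N C, P * A * P * (P * B * P) * (P * D * P) = P * (A * B * D) * P := by
      intro A B D
      calc P * A * P * (P * B * P) * (P * D * P) = P * A * (P * P) * B * (P * P) * D * P := by
            simp only [mul_assoc]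
        _ = _ := by rw [hP]; simp only [mul_assoc, mul_one]
    rw [hc, hc, h]
  have h3 := hWZ.transp_transp hq hp θ
  have h4 := Rmat_mul_Rmat' hθ hq hp hq' hp
  unfold RTTPair at hXY h3
  rw [leg₁_mul, leg₂_mul]
  generalize Rmat' θ q' p = R' at *
  generalize Rmat q p = R at *
  calc R * (leg₁ X * leg₁ (transp θ Z)) * R' * (leg₂ Y * leg₂ (transp θ W))
      = R * leg₁ X * (leg₁ (transp θ Z) * R' * leg₂ Y) * leg₂ (transp θ W) := by
        simp only [mul_assoc]
    _ = (R * leg₁ X * leg₂ Y) * R' * leg₁ (transp θ Z) * leg₂ (transp θ W) := by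
        rw [h1]; simp only [mul_assoc]
    _ = leg₂ Y * leg₁ X * (R * R') * leg₁ (transp θ Z) * leg₂ (transp θ W) := by
        rw [hXY]; simp only [mul_assoc]
    _ = leg₂ Y * leg₁ X * R' * (R * leg₁ (transp θ Z) * leg₂ (transp θ W)) := by
        rw [h4]; simp only [mul_assoc]
    _ = leg₂ Y * (leg₁ X * R' * leg₂ (transp θ W)) * leg₁ (transp θ Z) * R := by
        rw [h3]; simp only [mul_assoc]
    _ = _ := by rw [← h2]; simp only [mul_assoc]

end Pairs

end TwistedSuperYangian

end

noncomputable section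

namespace TwistedSuperYangian

open Matrix

/-! ### Substitutions in series of one and of two variables -/

section Series

variable {A : Type*} [Ring A]

theorem coeff_inVar (i : Fin 2) (f : PowerSeries A) (m : Fin 2 →₀ ℕ) :
    MvPowerSeries.coeff m (inVar i f) =
      if m (1 - i) = 0 then PowerSeries.coeff (m i) f else 0 := rfl

theorem coeff_negArg (f : PowerSeries A) (n : ℕ) :
    PowerSeries.coeff n (negArg f) = (-1 : ℤˣ) ^ n • PowerSeries.coeff n f := by
  rcases Nat.even_or_odd n with h | h <;> simp [negArg, h.neg_one_pow]

theorem eq_single_of_apply_eq_zero {i : Fin 2} {m : Fin 2 →₀ ℕ} (h : m (1 - i) = 0) :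
    m = Finsupp.single i (m i) := by
  ext j
  fin_cases i <;> fin_cases j <;> simp_all

/-- The ring homomorphism `f ↦ f(-u)`. -/
def negArgHom : PowerSeries A →+* PowerSeries A where
  toFun := negArg
  map_one' := by
    ext n
    rw [coeff_negArg, PowerSeries.coeff_one]
    split_ifs with h <;> simp [h]
  map_zero' := by ext n; simp [coeff_negArg]
  map_add' f g := by ext n; simp [coeff_negArg, smul_add]
  map_mul' f g := by
    ext n
    rw [coeff_negArg, PowerSeries.coeff_mul, PowerSeries.coeff_mul, Finset.smul_sum]
    refine Finset.sum_congr rfl fun p hp => ?_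
    rw [coeff_negArg, coeff_negArg, smul_mul_smul_comm, ← pow_add,
      Finset.HasAntidiagonal.mem_antidiagonal.1 hp]

theorem negArgHom_apply (f : PowerSeries A) : negArgHom f = negArg f := rfl

theorem negArg_negArg (f : PowerSeries A) : negArg (negArg f) = f := by
  ext n
  rw [coeff_negArg, coeff_negArg, smul_smul, Int.units_mul_self, one_smul]

/-- The ring homomorphism sending a series to the same series in the variable number `i`. -/
def inVarHom (i : Fin 2) : PowerSeries A →+* MvPowerSeries (Fin 2) A where
  toFun := inVar i
  map_one' := by
    ext m
    rw [coeff_inVar, PowerSeries.coeff_one, MvPowerSeries.coeff_one]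
    have : m = 0 ↔ m (1 - i) = 0 ∧ m i = 0 := by
      constructor
      · rintro rfl; simp
      · rintro ⟨h1, h2⟩; rw [eq_single_of_apply_eq_zero h1, h2, Finsupp.single_zero]
    by_cases h1 : m (1 - i) = 0 <;> by_cases h2 : m i = 0 <;> simp [this, h1, h2]
  map_zero' := by ext m; simp [coeff_inVar]
  map_add' f g := by ext m; simp only [coeff_inVar, map_add]; split_ifs <;> simp
  map_mul' f g := by
    ext m
    rw [MvPowerSeries.coeff_mul, coeff_inVar]
    split_ifs with h
    · rw [eq_single_of_apply_eq_zero h, Finsupp.antidiagonal_single, Finset.sum_map,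
        Finsupp.single_eq_same, PowerSeries.coeff_mul]
      refine Finset.sum_congr rfl fun p _ => ?_
      have hi : i ≠ 1 - i := by fin_cases i <;> simp
      simp [coeff_inVar, hi]
    · symm
      refine Finset.sum_eq_zero fun p hp => ?_
      rw [coeff_inVar, coeff_inVar]
      have := DFunLike.congr_fun (Finset.HasAntidiagonal.mem_antidiagonal.1 hp) (1 - i)
      rw [Finsupp.add_apply] at this
      split_ifs with h1 h2
      · exact absurd (by omega) h
      all_goals simp

theorem inVarHom_apply (i : Fin 2) (f : PowerSeries A) : inVarHom i f = inVar i f := rfl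

/-- The exchange of the two variables. -/
def swapVarsFun (f : MvPowerSeries (Fin 2) A) : MvPowerSeries (Fin 2) A :=
  fun m => MvPowerSeries.coeff (Finsupp.domCongr (Equiv.swap 0 1) m) f

theorem coeff_swapVarsFun (f : MvPowerSeries (Fin 2) A) (m : Fin 2 →₀ ℕ) :
    MvPowerSeries.coeff m (swapVarsFun f) =
      MvPowerSeries.coeff (Finsupp.domCongr (Equiv.swap 0 1) m) f := rfl

/-- The ring homomorphism exchanging the two variables. -/
def swapVars : MvPowerSeries (Fin 2) A →+* MvPowerSeries (Fin 2) A where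
  toFun := swapVarsFun
  map_one' := by
    ext m
    simp only [coeff_swapVarsFun, MvPowerSeries.coeff_one, EmbeddingLike.map_eq_zero_iff]
  map_zero' := rfl
  map_add' f g := rfl
  map_mul' f g := by
    ext m
    rw [coeff_swapVarsFun, MvPowerSeries.coeff_mul, MvPowerSeries.coeff_mul]
    symm
    let e : (Fin 2 →₀ ℕ) ≃+ (Fin 2 →₀ ℕ) := Finsupp.domCongr (Equiv.swap 0 1)
    refine Finset.sum_equiv (e.toEquiv.prodCongr e.toEquiv) (fun p => ?_) (fun p _ => rfl)
    simp only [Finset.HasAntidiagonal.mem_antidiagonal]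
    exact ⟨fun h => by rw [← h]; exact (map_add e _ _).symm,
      fun h => e.injective ((map_add e _ _).trans h)⟩

theorem coeff_swapVars (f : MvPowerSeries (Fin 2) A) (m : Fin 2 →₀ ℕ) :
    MvPowerSeries.coeff m (swapVars f) =
      MvPowerSeries.coeff (Finsupp.domCongr (Equiv.swap 0 1) m) f := rfl

/-- The change of sign of the first variable. -/
def negFirstFun (f : MvPowerSeries (Fin 2) A) : MvPowerSeries (Fin 2) A :=
  fun m => (-1 : ℤˣ) ^ m 0 • MvPowerSeries.coeff m f

theorem coeff_negFirstFun (f : MvPowerSeries (Fin 2) A) (m : Fin 2 →₀ ℕ) :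
    MvPowerSeries.coeff m (negFirstFun f) = (-1 : ℤˣ) ^ m 0 • MvPowerSeries.coeff m f := rfl

/-- The ring homomorphism changing the sign of the first variable. -/
def negFirst : MvPowerSeries (Fin 2) A →+* MvPowerSeries (Fin 2) A where
  toFun := negFirstFun
  map_one' := by
    ext m
    rw [coeff_negFirstFun, MvPowerSeries.coeff_one]
    split_ifs with h <;> simp [h]
  map_zero' := by ext m; simp [coeff_negFirstFun]
  map_add' f g := by ext m; simp [coeff_negFirstFun, smul_add]
  map_mul' f g := by
    ext m
    rw [coeff_negFirstFun, MvPowerSeries.coeff_mul, MvPowerSeries.coeff_mul, Finset.smul_sum]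
    refine Finset.sum_congr rfl fun p hp => ?_
    rw [coeff_negFirstFun, coeff_negFirstFun, smul_mul_smul_comm, ← pow_add,
      ← Finset.HasAntidiagonal.mem_antidiagonal.1 hp, Finsupp.add_apply]

theorem coeff_negFirst (f : MvPowerSeries (Fin 2) A) (m : Fin 2 →₀ ℕ) :
    MvPowerSeries.coeff m (negFirst f) = (-1 : ℤˣ) ^ m 0 • MvPowerSeries.coeff m f := rfl

theorem negFirst_x : negFirst (x : MvPowerSeries (Fin 2) A) = -x := by
  ext m
  rw [coeff_negFirst, x, map_neg, MvPowerSeries.coeff_X]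
  split_ifs with h <;> simp [h]

theorem negFirst_y : negFirst (y : MvPowerSeries (Fin 2) A) = y := by
  ext m
  rw [coeff_negFirst, y, MvPowerSeries.coeff_X]
  split_ifs with h <;> simp [h]

theorem swapVars_X (i : Fin 2) : swapVars (MvPowerSeries.X i : MvPowerSeries (Fin 2) A) =
    MvPowerSeries.X (1 - i) := by
  ext m
  rw [coeff_swapVars, MvPowerSeries.coeff_X, MvPowerSeries.coeff_X]
  have h : Finsupp.domCongr (Equiv.swap 0 1) (Finsupp.single (1 - i) 1) =
      (Finsupp.single i 1 : Fin 2 →₀ ℕ) := by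
    fin_cases i <;> simp
  simp only [← h, EmbeddingLike.apply_eq_iff_eq]

theorem swapVars_x : swapVars (x : MvPowerSeries (Fin 2) A) = y := swapVars_X 0

theorem swapVars_y : swapVars (y : MvPowerSeries (Fin 2) A) = x := swapVars_X 1

theorem swapVars_inVar (i : Fin 2) (f : PowerSeries A) :
    swapVars (inVar i f) = inVar (1 - i) f := by
  ext m
  rw [coeff_swapVars, coeff_inVar, coeff_inVar]
  fin_cases i <;> simp

theorem negFirst_inVar_zero (f : PowerSeries A) : negFirst (inVar 0 f) = inVar 0 (negArg f) := by
  ext m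
  rw [coeff_negFirst, coeff_inVar, coeff_inVar, coeff_negArg]
  split_ifs <;> simp

theorem negFirst_inVar_one (f : PowerSeries A) : negFirst (inVar 1 f) = inVar 1 f := by
  ext m
  rw [coeff_negFirst, coeff_inVar]
  split_ifs with h
  · have : m 0 = 0 := h
    simp [this]
  · simp

theorem coeff_inVar_zero_mul_inVar_one (f g : PowerSeries A) (m : Fin 2 →₀ ℕ) :
    MvPowerSeries.coeff m (inVar 0 f * inVar 1 g) =
      PowerSeries.coeff (m 0) f * PowerSeries.coeff (m 1) g := by
  rw [MvPowerSeries.coeff_mul,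
    Finset.sum_eq_single (Finsupp.single 0 (m 0), Finsupp.single 1 (m 1))]
  · simp [coeff_inVar]
  · rintro ⟨p, q⟩ hp hne
    rw [coeff_inVar, coeff_inVar]
    split_ifs with h1 h2
    · exfalso
      apply hne
      have h := Finset.HasAntidiagonal.mem_antidiagonal.1 hp
      have h0 := DFunLike.congr_fun h 0
      have h1' := DFunLike.congr_fun h 1
      simp only [Finsupp.add_apply] at h0 h1'
      have e1 := eq_single_of_apply_eq_zero h1
      have e2 := eq_single_of_apply_eq_zero h2
      simp only [sub_zero, sub_self] at h1 h2 e1 e2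
      rw [e1, e2, Prod.mk.injEq]
      constructor <;> congr 1 <;> omega
    all_goals simp
  · intro h
    exfalso
    apply h
    rw [Finset.HasAntidiagonal.mem_antidiagonal]
    ext j
    fin_cases j <;> simp

theorem coeff_inVar_one_mul_inVar_zero (f g : PowerSeries A) (m : Fin 2 →₀ ℕ) :
    MvPowerSeries.coeff m (inVar 1 g * inVar 0 f) =
      PowerSeries.coeff (m 1) g * PowerSeries.coeff (m 0) f := by
  have : inVar 1 g * inVar 0 f = swapVars (inVar 0 g * inVar 1 f) := by
    rw [map_mul, swapVars_inVar, swapVars_inVar]; rfl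
  rw [this, coeff_swapVars, coeff_inVar_zero_mul_inVar_one]
  simp

theorem commute_x (f : MvPowerSeries (Fin 2) A) : Commute x f :=
  (MvPowerSeries.commute_X f 0).symm

theorem commute_y (f : MvPowerSeries (Fin 2) A) : Commute y f :=
  (MvPowerSeries.commute_X f 1).symm

theorem commute_y_sub_x (f : MvPowerSeries (Fin 2) A) : Commute (y - x) f :=
  (commute_y f).sub_left (commute_x f)

theorem commute_y_add_x (f : MvPowerSeries (Fin 2) A) : Commute (y + x) f :=
  (commute_y f).add_left (commute_x f)

theorem commute_x_mul_y (f : MvPowerSeries (Fin 2) A) : Commute (x * y) f :=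
  (commute_x f).mul_left (commute_y f)

theorem commute_neg_x_mul_y (f : MvPowerSeries (Fin 2) A) : Commute (-(x * y)) f :=
  Commute.neg_left (commute_x_mul_y f)

end Series

/-! ### The reflection relation for `T(u) τ[T(u)]` -/

section Reflection

variable {M N : ℕ} {A : Type*} [Ring A]

/-- The RTT relation for a matrix of series. -/
def SatisfiesRTT (T : Matrix (Idx M N) (Idx M N) (PowerSeries A)) : Prop :=
  RTTPair (y - x) (x * y) (T.map (inVar 0)) (T.map (inVar 1))

theorem satisfiesRTT_iff (T : Matrix (Idx M N) (Idx M N) (PowerSeries A)) :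
    SatisfiesRTT T ↔ rttLHS T = rttRHS T := Iff.rfl

variable {T : Matrix (Idx M N) (Idx M N) (PowerSeries A)}

/-- Replacing `x` by `-x` turns the denominator `y - x` into `y + x` and the numerator `x y` into
`-(x y)`, which is the form required by `RTTPair.transp_left`. -/
theorem SatisfiesRTT.neg_fst (h : SatisfiesRTT T) :
    RTTPair (y + x) (-(x * y)) ((T.map negArg).map (inVar 0)) (T.map (inVar 1)) := by
  have h1 := h.map negFirst commute_y_sub_x commute_x_mul_y commute_y_add_x
    commute_neg_x_mul_y (by rw [map_sub, negFirst_x, negFirst_y, sub_neg_eq_add])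
    (by rw [map_mul, negFirst_x, negFirst_y, neg_mul])
  simpa only [Matrix.map_map, Function.comp_def, negFirst_inVar_zero, negFirst_inVar_one] using h1

theorem SatisfiesRTT.neg_snd (h : SatisfiesRTT T) :
    RTTPair (y + x) (-(x * y)) ((T.map negArg).map (inVar 1)) (T.map (inVar 0)) := by
  have h1 := h.neg_fst.map swapVars commute_y_add_x commute_neg_x_mul_y
    commute_y_add_x
    commute_neg_x_mul_y (by rw [map_add, swapVars_x, swapVars_y, add_comm])
    (by rw [map_neg, map_mul, swapVars_x, swapVars_y, (commute_y x).eq])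
  simpa only [Matrix.map_map, Function.comp_def, swapVars_inVar] using! h1

/-- The difference of the arguments `-v` and `-u` is again `u - v`, so the original `R` reappears
with the two matrices exchanged. -/
theorem SatisfiesRTT.neg_neg (h : SatisfiesRTT T) :
    RTTPair (y - x) (x * y) ((T.map negArg).map (inVar 1)) ((T.map negArg).map (inVar 0)) := by
  have h1 := h.neg_snd.map negFirst commute_y_add_x commute_neg_x_mul_y
    commute_y_sub_x commute_x_mul_y
    (by rw [map_add, negFirst_x, negFirst_y, sub_eq_add_neg])
    (by rw [map_neg, map_mul, negFirst_x, negFirst_y, neg_mul, _root_.neg_neg])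
  simpa only [Matrix.map_map, Function.comp_def, negFirst_inVar_zero, negFirst_inVar_one] using h1

theorem transp_map {B C : Type*} [Ring B] [Ring C] (θ : Idx M N → ℤˣ) (f : B →+* C)
    (X : Matrix (Idx M N) (Idx M N) B) : (transp θ X).map f = transp θ (X.map f) := by
  ext a b
  rw [Matrix.map_apply, transp_apply, transp_apply, Matrix.map_apply, Units.smul_def,
    Units.smul_def, map_zsmul]

theorem mul_tau_map_inVar (θ : Idx M N → ℤˣ) (i : Fin 2) :
    (T * tau θ T).map (inVar i) =
      T.map (inVar i) * transp θ ((T.map negArg).map (inVar i)) := by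
  have h := Matrix.map_mul (L := T) (M := tau θ T) (f := inVarHom i)
  rw [tau, transp_map] at h
  exact h

/-- The reflection relation for `T(u) τ[T(u)]`. -/
theorem SatisfiesRTT.reflection {θ : Idx M N → ℤˣ} {θ₀ : ℤˣ}
    (hθ : ∀ a : Idx M N, (-1 : ℤˣ) ^ deg a * θ a * θ (bar a) = θ₀) (h : SatisfiesRTT T) :
    reflLHS θ (T * tau θ T) = reflRHS θ (T * tau θ T) := by
  rw [reflLHS, reflRHS, atU₁, atV₂, Ruv, Ruv', mul_tau_map_inVar, mul_tau_map_inVar]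
  exact reflection_of_pairs hθ commute_y_sub_x commute_x_mul_y commute_y_add_x h h.neg_fst
    h.neg_snd h.neg_neg

end Reflection

end TwistedSuperYangian

end

noncomputable section

namespace TwistedSuperYangian

open Matrix

/-! ### Restriction to the line `v = -u` -/

section AntiDiagonal

variable {A : Type*} [Ring A]

theorem coeff_X_mul (i : Fin 2) (f : MvPowerSeries (Fin 2) A) (m : Fin 2 →₀ ℕ) :
    MvPowerSeries.coeff m (MvPowerSeries.X i * f) =
      if m i = 0 then 0 else MvPowerSeries.coeff (m - Finsupp.single i 1) f := by
  classical
  rw [MvPowerSeries.X_def, MvPowerSeries.coeff_monomial_mul, one_mul]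
  by_cases h : m i = 0
  · rw [if_pos h, if_neg]
    rw [Finsupp.single_le_iff]
    omega
  · rw [if_neg h, if_pos]
    rw [Finsupp.single_le_iff]
    omega

/-- The restriction of a series in `u⁻¹, v⁻¹` to `v = -u`. -/
def antiDiag : MvPowerSeries (Fin 2) A →+ PowerSeries A where
  toFun f := PowerSeries.mk fun n => ∑ p ∈ Finset.HasAntidiagonal.antidiagonal n,
    (-1 : ℤˣ) ^ p.2 • MvPowerSeries.coeff (Finsupp.single 0 p.1 + Finsupp.single 1 p.2) f
  map_zero' := by ext n; simp
  map_add' f g := by ext n; simp [smul_add, Finset.sum_add_distrib]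

theorem coeff_antiDiag (f : MvPowerSeries (Fin 2) A) (n : ℕ) :
    PowerSeries.coeff n (antiDiag f) = ∑ p ∈ Finset.HasAntidiagonal.antidiagonal n,
      (-1 : ℤˣ) ^ p.2 •
        MvPowerSeries.coeff (Finsupp.single 0 p.1 + Finsupp.single 1 p.2) f := by
  simp [antiDiag]

theorem antiDiag_x_mul (f : MvPowerSeries (Fin 2) A) :
    antiDiag (x * f) = PowerSeries.X * antiDiag f := by
  ext n
  rcases n with _ | n
  · simp [coeff_antiDiag, x]
  · rw [coeff_antiDiag, Finset.Nat.sum_antidiagonal_succ, PowerSeries.coeff_succ_X_mul,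
      coeff_antiDiag, x, coeff_X_mul]
    simp only [Finsupp.single_zero, zero_add, Finsupp.single_apply]
    simp only [one_ne_zero, if_false, if_true, smul_zero, zero_add]
    refine Finset.sum_congr rfl fun p _ => ?_
    rw [coeff_X_mul, if_neg (by simp)]
    congr 3
    ext j
    fin_cases j <;> simp

theorem antiDiag_y_mul (f : MvPowerSeries (Fin 2) A) :
    antiDiag (y * f) = -(PowerSeries.X * antiDiag f) := by
  ext n
  rcases n with _ | n
  · simp [coeff_antiDiag, y]
  · rw [coeff_antiDiag, Finset.Nat.sum_antidiagonal_succ', map_neg, PowerSeries.coeff_succ_X_mul,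
      coeff_antiDiag, y, coeff_X_mul]
    simp only [Finsupp.single_zero, add_zero, Finsupp.single_apply]
    simp only [zero_ne_one, if_false, if_true, smul_zero]
    rw [zero_add, ← Finset.sum_neg_distrib]
    refine Finset.sum_congr rfl fun p _ => ?_
    rw [coeff_X_mul, if_neg (by simp), pow_succ, mul_neg_one, Units.neg_smul]
    congr 4
    ext j
    fin_cases j <;> simp

theorem antiDiag_inVar_zero_mul (f g : PowerSeries A) :
    antiDiag (inVar 0 f * inVar 1 g) = f * negArg g := by
  ext n
  rw [coeff_antiDiag, PowerSeries.coeff_mul]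
  refine Finset.sum_congr rfl fun p _ => ?_
  rw [coeff_inVar_zero_mul_inVar_one, coeff_negArg, mul_smul_comm]
  simp

theorem antiDiag_inVar_one_mul (f g : PowerSeries A) :
    antiDiag (inVar 1 g * inVar 0 f) = negArg g * f := by
  ext n
  rw [coeff_antiDiag, PowerSeries.coeff_mul, ← Finset.Nat.sum_antidiagonal_swap]
  refine Finset.sum_congr rfl fun p _ => ?_
  rw [coeff_inVar_one_mul_inVar_zero, coeff_negArg, smul_mul_assoc]
  simp

theorem antiDiag_units_smul (s : ℤˣ) (f : MvPowerSeries (Fin 2) A) :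
    antiDiag (s • f) = s • antiDiag f := by
  rw [Units.smul_def, Units.smul_def, map_zsmul]

theorem X_mul_cancel' {f g : PowerSeries A} (h : PowerSeries.X * f = PowerSeries.X * g) :
    f = g := by
  ext n
  rw [← PowerSeries.coeff_succ_X_mul, h, PowerSeries.coeff_succ_X_mul]

end AntiDiagonal

/-! ### The symmetry relation for `T(u) τ[T(u)]` -/

section Symmetry

variable {M N : ℕ} {A : Type*} [Ring A] {T : Matrix (Idx M N) (Idx M N) (PowerSeries A)}

/-- On the line `y = -x` the factors `y - x` and `x y` become `-2 x` and `-x²`; one factor `-x`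
cancels. -/
theorem SatisfiesRTT.exchange (h : SatisfiesRTT T) (a b c d : Idx M N) :
    (2 : ℤ) • (T a b * negArg (T c d) - exchSign a b c d • (negArg (T c d) * T a b)) =
      rttSign a b c •
        (PowerSeries.X * (T c b * negArg (T a d) - negArg (T c b) * T a d)) := by
  have h1 := congrArg antiDiag ((rttPair_iff commute_y_sub_x commute_x_mul_y).1 h a b c d)
  simp only [Matrix.map_apply, sub_mul, map_sub, antiDiag_units_smul, mul_assoc, antiDiag_x_mul,
    antiDiag_y_mul, antiDiag_inVar_zero_mul, antiDiag_inVar_one_mul] at h1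
  apply X_mul_cancel'
  rw [mul_smul_comm, mul_smul_comm]
  generalize T a b * negArg (T c d) - exchSign a b c d • (negArg (T c d) * T a b) = F at *
  rcases Int.units_eq_one_or (rttSign a b c) with h2 | h2 <;> rw [h2] at h1 ⊢ <;>
    simp only [mul_neg, one_smul, Units.neg_smul] at h1 ⊢ <;>
    linear_combination (norm := module) -h1

theorem SatisfiesRTT.exchange_neg (h : SatisfiesRTT T) (a b c d : Idx M N) :
    (2 : ℤ) • (negArg (T a b) * T c d - exchSign a b c d • (T c d * negArg (T a b))) =
      rttSign a b c •
        (PowerSeries.X * (T c b * negArg (T a d) - negArg (T c b) * T a d)) := by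
  have hX : negArg (PowerSeries.X : PowerSeries A) = -PowerSeries.X := by
    ext n
    rw [coeff_negArg, map_neg, PowerSeries.coeff_X]
    split_ifs with h <;> simp [h]
  have h1 := congrArg negArgHom (h.exchange a b c d)
  simp only [map_zsmul, map_sub, map_mul, Units.smul_def, negArgHom_apply, negArg_negArg, hX] at h1
  simp only [Units.smul_def]
  rw [h1, neg_mul, ← mul_neg, neg_sub]

variable [Algebra ℂ A]

/-- The entries of `τ[S(u)]` are sums of products `T(-u) T(u)`, those of `S(u)` are sums of products
`T(u) T(-u)`. Reordering each summand by `SatisfiesRTT.exchange_neg` produces a correction with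
factor `1 / (2 u)`; its two terms sum to `S(u)` and `S(-u)`. -/
theorem SatisfiesRTT.symmetry {θ : Idx M N → ℤˣ} {θ₀ : ℤˣ}
    (hθ : ∀ a : Idx M N, (-1 : ℤˣ) ^ deg a * θ a * θ (bar a) = θ₀) (h : SatisfiesRTT T) :
    tau θ (T * tau θ T) = symmRHS θ₀ (T * tau θ T) := by
  ext1 a c
  have hS : ∀ a c, (T * tau θ T) a c =
      ∑ b, transpSign θ b c • (T a b * negArg (T (bar c) (bar b))) := by
    intro a c
    rw [Matrix.mul_apply]
    refine Finset.sum_congr rfl fun b _ => ?_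
    rw [tau, transp_apply, mul_smul_comm, Matrix.map_apply]
  have hN : ∀ a c, negArg ((T * tau θ T) a c) =
      ∑ b, transpSign θ b c • (negArg (T a b) * T (bar c) (bar b)) := by
    intro a c
    rw [hS, ← negArgHom_apply, map_sum]
    refine Finset.sum_congr rfl fun b _ => ?_
    rw [Units.smul_def, map_zsmul, map_mul, negArgHom_apply, negArgHom_apply, negArg_negArg,
      Units.smul_def]
  have h1 : ∀ b, transpSign θ a c • transpSign θ b (bar a) •
      (negArg (T (bar c) b) * T (bar (bar a)) (bar b)) =
      transpSign θ (bar b) c • (T a (bar b) * negArg (T (bar c) (bar (bar b)))) +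
      (θ₀ • (1 / 2 : ℂ) • (PowerSeries.X : PowerSeries A)) *
        (transpSign θ b c • (T a b * negArg (T (bar c) (bar b))) -
          transpSign θ b c • (negArg (T a b) * T (bar c) (bar b))) := by
    intro b
    -- The sign of the reordered term. Replacing `b` by `b̄` costs the constant `θ₀`, and `θ₀`
    -- enters again through `a`; the two cancel.
    have e1 : transpSign θ (bar b) c = transpSign θ a c * transpSign θ b (bar a) *
        exchSign (bar c) b a (bar b) := by
      have h2 := hθ a
      have h3 := hθ b
      simp only [transpSign, exchSign, deg_bar, bar_bar]
      rw [← h2] at h3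
      have h4 : θ b = (-1 : ℤˣ) ^ deg a * (-1 : ℤˣ) ^ deg b * θ a * θ (bar a) * θ (bar b) := by
        rcases deg_cases a with ha | ha <;> rcases deg_cases b with hb | hb <;>
        rcases Int.units_eq_one_or (θ (bar b)) with h5 | h5 <;>
        simp [ha, hb, h5] at h3 ⊢ <;> simp [← h3]
      rw [h4]
      rcases deg_cases a with ha | ha <;> rcases deg_cases b with hb | hb <;>
        rcases deg_cases c with hc | hc <;>
        simp [ha, hb, hc, pow_succ, mul_comm, mul_left_comm, mul_assoc]
    -- The sign of the correction; here one factor `θ₀` survives, as in the symmetry relation.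
    have e2 : θ₀ * transpSign θ b c = transpSign θ a c * transpSign θ b (bar a) *
        rttSign (bar c) b a := by
      rw [← hθ a]
      simp only [transpSign, rttSign, deg_bar, bar_bar]
      rcases deg_cases a with ha | ha <;> rcases deg_cases b with hb | hb <;>
        rcases deg_cases c with hc | hc <;>
        simp [ha, hb, hc, pow_succ, mul_comm, mul_left_comm, mul_assoc]
    have h2 := h.exchange_neg (bar c) b a (bar b)
    have h3 : (θ₀ • (1 / 2 : ℂ) • (PowerSeries.X : PowerSeries A)) *
        (transpSign θ b c • (T a b * negArg (T (bar c) (bar b))) -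
          transpSign θ b c • (negArg (T a b) * T (bar c) (bar b))) =
        (θ₀ * transpSign θ b c) • (1 / 2 : ℂ) • (PowerSeries.X *
          (T a b * negArg (T (bar c) (bar b)) - negArg (T a b) * T (bar c) (bar b))) := by
      rw [← smul_sub, smul_mul_assoc, mul_smul_comm, smul_mul_assoc, smul_smul]
    rw [h3, e2, e1, bar_bar, bar_bar]
    generalize transpSign θ a c = s1 at *
    generalize transpSign θ b (bar a) = s2 at *
    generalize exchSign (bar c) b a (bar b) = s3 at *
    generalize rttSign (bar c) b a = s4 at *
    rcases Int.units_eq_one_or s1 with rfl | rfl <;>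
      rcases Int.units_eq_one_or s2 with rfl | rfl <;>
      rcases Int.units_eq_one_or s3 with rfl | rfl <;>
      rcases Int.units_eq_one_or s4 with rfl | rfl <;>
      simp only [mul_neg, _root_.neg_neg, Units.neg_smul, one_smul, mul_one] at h2 ⊢ <;>
      first
      | linear_combination (norm := module) (1 / 2 : ℂ) • h2
      | linear_combination (norm := module) -((1 / 2 : ℂ) • h2)
  -- The reordered terms carry `b̄` in place of `b`; summing over all `b` removes the difference.
  rw [tau, transp_apply, Matrix.map_apply, hN, Finset.smul_sum, symmRHS, Matrix.add_apply,
    Matrix.smul_apply, Matrix.sub_apply, Matrix.map_apply, hN, hS, Finset.sum_congr rfl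
    (fun b _ => h1 b), Finset.sum_add_distrib, ← Finset.mul_sum, Finset.sum_sub_distrib,
    sum_bar (fun b => transpSign θ b c • (T a b * negArg (T (bar c) (bar b)))), smul_eq_mul]

end Symmetry

end TwistedSuperYangian

end

noncomputable section

namespace TwistedSuperYangian

open Matrix

/-! ### Compatibility of all constructions with homomorphisms of the coefficients -/

section Naturality

variable {M N : ℕ} {A B : Type*} [Ring A] [Ring B] (f : A →+* B)

theorem inVar_map (i : Fin 2) (g : PowerSeries A) :
    inVar i (PowerSeries.map f g) = MvPowerSeries.map f (inVar i g) := by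
  ext m
  rw [coeff_inVar, MvPowerSeries.coeff_map, coeff_inVar]
  split_ifs <;> simp

theorem negArg_map (g : PowerSeries A) :
    negArg (PowerSeries.map f g) = PowerSeries.map f (negArg g) := by
  ext n
  simp [coeff_negArg, Units.smul_def]

theorem leg₁_map (X : Matrix (Idx M N) (Idx M N) A) : leg₁ (X.map f) = (leg₁ X).map f := by
  ext ⟨a, c⟩ ⟨b, d⟩
  simp only [leg₁_apply, Matrix.map_apply]
  split_ifs <;> simp

theorem leg₂_map (X : Matrix (Idx M N) (Idx M N) A) : leg₂ (X.map f) = (leg₂ X).map f := by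
  ext ⟨a, c⟩ ⟨b, d⟩
  simp only [leg₂_apply, Matrix.map_apply]
  split_ifs <;> simp [Units.smul_def]

theorem P_map : (P : Mat₂ M N A).map f = P := by
  ext ⟨a, c⟩ ⟨b, d⟩
  rw [P_apply, Matrix.map_apply, P_apply]
  split_ifs <;> simp [Units.smul_def]

theorem Q_map (θ : Idx M N → ℤˣ) : (Q θ : Mat₂ M N A).map f = Q θ := by
  ext ⟨a, c⟩ ⟨b, d⟩
  rw [Q_apply, Matrix.map_apply, Q_apply]
  split_ifs <;> simp [Units.smul_def]

theorem Rmat_map (q p : A) : (Rmat q p : Mat₂ M N A).map f = Rmat (f q) (f p) := by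
  rw [Rmat, Rmat, ← P_map f]
  ext i j
  simp only [Matrix.map_apply, Matrix.sub_apply, Matrix.smul_apply, map_sub, smul_eq_mul, map_mul,
    Matrix.one_apply]
  split_ifs <;> simp

theorem Rmat'_map (θ : Idx M N → ℤˣ) (q p : A) :
    (Rmat' θ q p : Mat₂ M N A).map f = Rmat' θ (f q) (f p) := by
  rw [Rmat'_eq, Rmat'_eq, ← Q_map f]
  ext i j
  simp only [Matrix.map_apply, Matrix.add_apply, Matrix.smul_apply, map_add, smul_eq_mul, map_mul,
    Matrix.one_apply]
  split_ifs <;> simp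

theorem map_x : MvPowerSeries.map f x = x := MvPowerSeries.map_X _ _

theorem map_y : MvPowerSeries.map f y = y := MvPowerSeries.map_X _ _

theorem Ruv_map : (Ruv M N A).map (MvPowerSeries.map f) = Ruv M N B := by
  rw [Ruv, Rmat_map, map_sub, map_mul, map_x, map_y, Ruv]

theorem Ruv'_map (θ : Idx M N → ℤˣ) :
    (Ruv' θ A).map (MvPowerSeries.map f) = Ruv' θ B := by
  rw [Ruv', Rmat'_map, map_add, map_mul, map_x, map_y, Ruv']

variable (X : Matrix (Idx M N) (Idx M N) (PowerSeries A))

theorem atU₁_map : atU₁ (X.map (PowerSeries.map f)) = (atU₁ X).map (MvPowerSeries.map f) := by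
  rw [atU₁, atU₁, ← leg₁_map, Matrix.map_map, Matrix.map_map]
  congr 1
  ext1 a b
  exact inVar_map f 0 _

theorem atV₂_map : atV₂ (X.map (PowerSeries.map f)) = (atV₂ X).map (MvPowerSeries.map f) := by
  rw [atV₂, atV₂, ← leg₂_map, Matrix.map_map, Matrix.map_map]
  congr 1
  ext1 a b
  exact inVar_map f 1 _

theorem rttLHS_map : rttLHS (X.map (PowerSeries.map f)) = (rttLHS X).map (MvPowerSeries.map f) := by
  rw [rttLHS, rttLHS, Matrix.map_mul, Matrix.map_mul, atU₁_map, atV₂_map, Ruv_map]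

theorem rttRHS_map : rttRHS (X.map (PowerSeries.map f)) = (rttRHS X).map (MvPowerSeries.map f) := by
  rw [rttRHS, rttRHS, Matrix.map_mul, Matrix.map_mul, atU₁_map, atV₂_map, Ruv_map]

theorem reflLHS_map (θ : Idx M N → ℤˣ) :
    reflLHS θ (X.map (PowerSeries.map f)) = (reflLHS θ X).map (MvPowerSeries.map f) := by
  rw [reflLHS, reflLHS, Matrix.map_mul, Matrix.map_mul, Matrix.map_mul, atU₁_map, atV₂_map,
    Ruv_map, Ruv'_map]

theorem reflRHS_map (θ : Idx M N → ℤˣ) :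
    reflRHS θ (X.map (PowerSeries.map f)) = (reflRHS θ X).map (MvPowerSeries.map f) := by
  rw [reflRHS, reflRHS, Matrix.map_mul, Matrix.map_mul, Matrix.map_mul, atU₁_map, atV₂_map,
    Ruv_map, Ruv'_map]

theorem tau_map (θ : Idx M N → ℤˣ) :
    tau θ (X.map (PowerSeries.map f)) = (tau θ X).map (PowerSeries.map f) := by
  rw [tau, tau, transp_map, Matrix.map_map, Matrix.map_map]
  congr 1
  ext1 a b
  exact negArg_map f _

theorem symmRHS_map {A B : Type*} [Ring A] [Ring B] [Algebra ℂ A] [Algebra ℂ B] (f : A →ₐ[ℂ] B)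
    (X : Matrix (Idx M N) (Idx M N) (PowerSeries A)) (θ₀ : ℤˣ) :
    symmRHS θ₀ (X.map (PowerSeries.map (f : A →+* B))) =
      (symmRHS θ₀ X).map (PowerSeries.map (f : A →+* B)) := by
  ext a b n
  have h : ∀ s : PowerSeries A, PowerSeries.map (f : A →+* B)
      ((θ₀ • (1 / 2 : ℂ) • (PowerSeries.X : PowerSeries A)) * s) =
      (θ₀ • (1 / 2 : ℂ) • (PowerSeries.X : PowerSeries B)) * PowerSeries.map (f : A →+* B) s := by
    intro s
    ext n
    simp only [smul_mul_assoc, Units.smul_def, map_zsmul, PowerSeries.coeff_map]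
    rw [PowerSeries.coeff_smul, PowerSeries.coeff_smul]
    rcases n with _ | n <;> simp [PowerSeries.coeff_succ_X_mul]
  simp only [symmRHS, Matrix.add_apply, Matrix.smul_apply, Matrix.sub_apply, Matrix.map_apply,
    smul_eq_mul, map_add, map_sub, h, negArg_map]

theorem genSeries_map (g : Gen M N → A) :
    (genSeries g).map (PowerSeries.map f) = genSeries (fun i => f (g i)) := by
  ext a b n
  rcases n with _ | n
  · by_cases h : a = b <;> simp [genSeries, h]
  · simp [genSeries]

theorem coeff_zero_genSeries (g : Gen M N → A) (a b : Idx M N) :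
    PowerSeries.coeff 0 (genSeries g a b) = if a = b then 1 else 0 := by
  simp [genSeries, -PowerSeries.coeff_zero_eq_constantCoeff]

theorem coeff_succ_genSeries (g : Gen M N → A) (a b : Idx M N) (n : ℕ) :
    PowerSeries.coeff (n + 1) (genSeries g a b) = g (a, b, n) := by
  simp [genSeries]

/-- A matrix of series with constant term one is determined by its higher coefficients. -/
theorem eq_genSeries (X : Matrix (Idx M N) (Idx M N) (PowerSeries A))
    (h : ∀ a b, PowerSeries.coeff 0 (X a b) = if a = b then 1 else 0) :
    X = genSeries fun g => PowerSeries.coeff (g.2.2 + 1) (X g.1 g.2.1) := by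
  ext a b n
  rcases n with _ | n
  · rw [h, coeff_zero_genSeries]
  · rw [coeff_succ_genSeries]

end Naturality

/-! ### Universal properties of the two presented algebras -/

section Universal

variable {M N : ℕ} {B : Type*} [Ring B] [Algebra ℂ B]

theorem freeSeries_map (g : Gen M N → B) :
    (freeSeries M N).map (PowerSeries.map (FreeAlgebra.lift ℂ g : _ →+* B)) = genSeries g := by
  rw [freeSeries, genSeries_map]
  congr 1
  ext i
  exact FreeAlgebra.lift_ι_apply g i

theorem freeSeries_map_comp (f : FreeAlgebra ℂ (Gen M N) →ₐ[ℂ] B) :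
    (freeSeries M N).map (PowerSeries.map (f : _ →+* B)) =
      genSeries fun i => f (FreeAlgebra.ι ℂ i) := by
  rw [freeSeries, genSeries_map]
  rfl

theorem satisfiesRTT_T : SatisfiesRTT (T M N) := by
  rw [satisfiesRTT_iff, T]
  have h := freeSeries_map_comp (RingQuot.mkAlgHom ℂ (YangianRel M N))
  change _ = genSeries Tgen at h
  rw [← h, rttLHS_map, rttRHS_map]
  ext p q m
  rw [Matrix.map_apply, Matrix.map_apply, MvPowerSeries.coeff_map, MvPowerSeries.coeff_map]
  exact RingQuot.mkAlgHom_rel ℂ (YangianRel.rtt p q m)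

/-- A solution of the RTT relation defines a homomorphism from the super Yangian. -/
theorem exists_yangian_hom (g : Gen M N → B) (h : SatisfiesRTT (genSeries g)) :
    ∃ ψ : Yangian M N →ₐ[ℂ] B, ∀ i, ψ (Tgen i) = g i := by
  refine ⟨RingQuot.liftAlgHom ℂ ⟨FreeAlgebra.lift ℂ g, ?_⟩, fun i => ?_⟩
  · rintro _ _ ⟨p, q, m⟩
    rw [satisfiesRTT_iff, ← freeSeries_map, rttLHS_map, rttRHS_map] at h
    have := congrArg (MvPowerSeries.coeff m) (congrFun (congrFun h p) q)
    rwa [Matrix.map_apply, Matrix.map_apply, MvPowerSeries.coeff_map,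
      MvPowerSeries.coeff_map] at this
  · rw [Tgen, RingQuot.liftAlgHom_mkAlgHom_apply, FreeAlgebra.lift_ι_apply]

variable (θ : Idx M N → ℤˣ) (θ₀ : ℤˣ)

theorem reflection_sigma : reflLHS θ (genSeries (sigma θ θ₀)) = reflRHS θ (genSeries (sigma θ θ₀)) := by
  have h := freeSeries_map_comp (RingQuot.mkAlgHom ℂ (TwistedRel θ θ₀))
  change _ = genSeries (sigma θ θ₀) at h
  rw [← h, reflLHS_map, reflRHS_map]
  ext p q m
  rw [Matrix.map_apply, Matrix.map_apply, MvPowerSeries.coeff_map, MvPowerSeries.coeff_map]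
  exact RingQuot.mkAlgHom_rel ℂ (TwistedRel.refl p q m)

theorem symmetry_sigma : tau θ (genSeries (sigma θ θ₀)) = symmRHS θ₀ (genSeries (sigma θ θ₀)) := by
  have h := freeSeries_map_comp (RingQuot.mkAlgHom ℂ (TwistedRel θ θ₀))
  change _ = genSeries (sigma θ θ₀) at h
  rw [← h, tau_map, symmRHS_map]
  ext a b n
  rw [Matrix.map_apply, Matrix.map_apply, PowerSeries.coeff_map, PowerSeries.coeff_map]
  exact RingQuot.mkAlgHom_rel ℂ (TwistedRel.symm a b n)

/-- A solution of the reflection and the symmetry relation defines a homomorphism from the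
presented algebra. -/
theorem exists_presented_hom (g : Gen M N → B)
    (hr : reflLHS θ (genSeries g) = reflRHS θ (genSeries g))
    (hs : tau θ (genSeries g) = symmRHS θ₀ (genSeries g)) :
    ∃ ψ : Presented θ θ₀ →ₐ[ℂ] B, ∀ i, ψ (sigma θ θ₀ i) = g i := by
  refine ⟨RingQuot.liftAlgHom ℂ ⟨FreeAlgebra.lift ℂ g, ?_⟩, fun i => ?_⟩
  · rintro _ _ (⟨p, q, m⟩ | ⟨a, b, n⟩)
    · rw [← freeSeries_map, reflLHS_map, reflRHS_map] at hr
      have := congrArg (MvPowerSeries.coeff m) (congrFun (congrFun hr p) q)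
      rwa [Matrix.map_apply, Matrix.map_apply, MvPowerSeries.coeff_map,
        MvPowerSeries.coeff_map] at this
    · rw [← freeSeries_map, tau_map, symmRHS_map] at hs
      have := congrArg (PowerSeries.coeff n) (congrFun (congrFun hs a) b)
      rwa [Matrix.map_apply, Matrix.map_apply, PowerSeries.coeff_map,
        PowerSeries.coeff_map] at this
  · rw [sigma, RingQuot.liftAlgHom_mkAlgHom_apply, FreeAlgebra.lift_ι_apply]

theorem coeff_tau_zero {A : Type*} [Ring A] {X : Matrix (Idx M N) (Idx M N) (PowerSeries A)}
    (h : ∀ a b, PowerSeries.coeff 0 (X a b) = if a = b then 1 else 0) (a b : Idx M N) :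
    PowerSeries.coeff 0 (tau θ X a b) = if a = b then 1 else 0 := by
  rw [tau, transp_apply, Matrix.map_apply, Units.smul_def, map_zsmul, coeff_negArg, h, pow_zero,
    one_smul]
  simp only [bar_injective.eq_iff]
  by_cases hab : a = b
  · subst hab
    simp only [if_true, transpSign]
    -- On the diagonal the sign is `(-1)^([a]([a]+1)) θ_ā²`, which is one.
    rcases deg_cases a with ha | ha <;> simp [ha]
  · simp [hab, Ne.symm hab]

theorem coeff_mul_zero {A : Type*} [Ring A] {X Y : Matrix (Idx M N) (Idx M N) (PowerSeries A)}
    (hX : ∀ a b, PowerSeries.coeff 0 (X a b) = if a = b then 1 else 0)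
    (hY : ∀ a b, PowerSeries.coeff 0 (Y a b) = if a = b then 1 else 0) (a b : Idx M N) :
    PowerSeries.coeff 0 ((X * Y) a b) = if a = b then 1 else 0 := by
  simp only [Matrix.mul_apply, map_sum, PowerSeries.coeff_mul,
    Finset.HasAntidiagonal.antidiagonal_zero, Finset.sum_singleton, hX, hY]
  simp [-Fintype.sum_sum_type]

theorem S_eq_genSeries : S θ = genSeries (Sgen θ) := by
  refine eq_genSeries (S θ) fun a b => ?_
  exact coeff_mul_zero (coeff_zero_genSeries _) (coeff_tau_zero θ (coeff_zero_genSeries _)) a b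

end Universal

end TwistedSuperYangian

end

noncomputable section

namespace TwistedSuperYangian

open Matrix

/-! ### Words in the generators, their weights and partners -/

section Letters

variable {M N : ℕ}

/-- The weight of a generator: the coefficient of `u^{-n}` has weight `n`. -/
def weight (g : Gen M N) : ℤ := g.2.2 + 1

/-- The total weight of a word in the generators. -/
def wordWeight (l : List (Gen M N)) : ℤ := (l.map weight).sum

@[simp] theorem wordWeight_nil : wordWeight ([] : List (Gen M N)) = 0 := rfl

@[simp] theorem wordWeight_cons (g : Gen M N) (l : List (Gen M N)) :
    wordWeight (g :: l) = weight g + wordWeight l := by simp [wordWeight]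

theorem wordWeight_append (l l' : List (Gen M N)) :
    wordWeight (l ++ l') = wordWeight l + wordWeight l' := by simp [wordWeight]

theorem weight_pos (g : Gen M N) : 0 < weight g := by unfold weight; omega

theorem wordWeight_nonneg (l : List (Gen M N)) : 0 ≤ wordWeight l := by
  induction l with
  | nil => rfl
  | cons g l ih => rw [wordWeight_cons]; linarith [weight_pos g]

theorem wordWeight_perm {l l' : List (Gen M N)} (h : l.Perm l') : wordWeight l = wordWeight l' :=
  (h.map weight).sum_eq

/-- The partner of a generator under the symmetry relation. -/
def star (g : Gen M N) : Gen M N := (bar g.2.1, bar g.1, g.2.2)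

@[simp] theorem star_star (g : Gen M N) : star (star g) = g := by simp [star]

@[simp] theorem weight_star (g : Gen M N) : weight (star g) = weight g := rfl

/-- The sign relating a generator and its partner. -/
def starSign (θ : Idx M N → ℤˣ) (g : Gen M N) : ℤˣ :=
  (-1 : ℤˣ) ^ (g.2.2 + 1) * transpSign θ g.1 g.2.1

/-- The parity of a generator. -/
def parity (g : Gen M N) : ℕ := deg g.1 + deg g.2.1

/-- The sign of the exchange of two generators. -/
def genSign (g h : Gen M N) : ℤˣ := exchSign g.1 g.2.1 h.1 h.2.1

theorem genSign_self_of_odd {g : Gen M N} (h : ¬Even (parity g)) : genSign g g = -1 := by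
  rw [Nat.not_even_iff_odd] at h
  exact (h.mul h).neg_one_pow

/-- Representatives of the generators modulo the symmetry relation. -/
def IsBasic (θ : Idx M N → ℤˣ) (g : Gen M N) : Prop :=
  Encodable.encode g < Encodable.encode (star g) ∨ (star g = g ∧ starSign θ g = 1)

/-- The order of the letters in an ordered monomial; odd letters are not repeated. -/
def Precedes (g h : Gen M N) : Prop :=
  Encodable.encode g < Encodable.encode h ∨ (g = h ∧ Even (parity g))

/-- The words of the ordered monomials. -/
def IsOrdered (θ : Idx M N → ℤˣ) (l : List (Gen M N)) : Prop :=
  (∀ g ∈ l, IsBasic θ g) ∧ l.Pairwise Precedes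

end Letters

/-! ### The weight filtration and the relations modulo lower weight -/

section Filtration

variable {M N : ℕ} {A : Type*} [Ring A] (σ : Gen M N → A)

/-- The monomial of a word. -/
def monomial (l : List (Gen M N)) : A := (l.map σ).prod

@[simp] theorem monomial_nil : monomial σ [] = 1 := rfl

@[simp] theorem monomial_cons (g : Gen M N) (l : List (Gen M N)) :
    monomial σ (g :: l) = σ g * monomial σ l := by simp [monomial]

theorem monomial_append (l l' : List (Gen M N)) :
    monomial σ (l ++ l') = monomial σ l * monomial σ l' := by simp [monomial]

variable [Algebra ℂ A]

/-- The span of the monomials of weight at most `j`. -/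
def filt (j : ℤ) : Submodule ℂ A := Submodule.span ℂ {a | ∃ l, wordWeight l ≤ j ∧ monomial σ l = a}

variable {σ}

theorem monomial_mem_filt {l : List (Gen M N)} {j : ℤ} (h : wordWeight l ≤ j) :
    monomial σ l ∈ filt σ j := Submodule.subset_span ⟨l, h, rfl⟩

theorem filt_mono {i j : ℤ} (h : i ≤ j) : filt σ i ≤ filt σ j :=
  Submodule.span_mono fun _ ⟨l, hl, ha⟩ => ⟨l, hl.trans h, ha⟩

theorem filt_of_neg {j : ℤ} (h : j < 0) : filt σ j = ⊥ := by
  rw [filt, Submodule.span_eq_bot]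
  rintro _ ⟨l, hl, -⟩
  have := wordWeight_nonneg l
  omega

theorem filt_mul_filt (i j : ℤ) : filt σ i * filt σ j ≤ filt σ (i + j) := by
  rw [filt, filt, Submodule.span_mul_span, Submodule.span_le]
  rintro _ ⟨_, ⟨l, hl, rfl⟩, _, ⟨l', hl', rfl⟩, rfl⟩
  change monomial σ l * monomial σ l' ∈ filt σ (i + j)
  rw [← monomial_append]
  exact monomial_mem_filt (by rw [wordWeight_append]; omega)

theorem mul_mem_filt {i j k : ℤ} {a b : A} (ha : a ∈ filt σ i) (hb : b ∈ filt σ j)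
    (h : i + j ≤ k) : a * b ∈ filt σ k :=
  filt_mono h (filt_mul_filt i j (Submodule.mul_mem_mul ha hb))

theorem gen_mem_filt (g : Gen M N) : σ g ∈ filt σ (weight g) := by
  have := monomial_mem_filt (σ := σ) (l := [g]) (j := weight g) (by simp)
  simpa using this

theorem one_mem_filt {j : ℤ} (h : 0 ≤ j) : (1 : A) ∈ filt σ j := by
  have := monomial_mem_filt (σ := σ) (l := []) (j := j) (by simpa using h)
  simpa using this

theorem units_smul_mem {V : Submodule ℂ A} (s : ℤˣ) {a : A} (h : a ∈ V) : s • a ∈ V := by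
  rcases Int.units_eq_one_or s with rfl | rfl
  · simpa using h
  · simpa using h

theorem coeff_genSeries_mem (a b : Idx M N) (n : ℕ) :
    PowerSeries.coeff n (genSeries σ a b) ∈ filt σ n := by
  rcases n with _ | n
  · rw [coeff_zero_genSeries]
    split_ifs
    · exact one_mem_filt (by simp)
    · exact Submodule.zero_mem _
  · rw [coeff_succ_genSeries]
    simpa [weight] using gen_mem_filt (σ := σ) (a, b, n)

variable (σ) in
/-- The series whose coefficients at `u^{-k} v^{-l}` have weight at most `k + l - d`. -/
def seriesFilt (d : ℤ) : AddSubgroup (MvPowerSeries (Fin 2) A) where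
  carrier := {f | ∀ m : Fin 2 →₀ ℕ, MvPowerSeries.coeff m f ∈ filt σ (m 0 + m 1 - d)}
  zero_mem' m := by simp
  add_mem' hf hg m := by rw [map_add]; exact add_mem (hf m) (hg m)
  neg_mem' hf m := by rw [map_neg]; exact neg_mem (hf m)

theorem mul_mem_seriesFilt {d e k : ℤ} {f g : MvPowerSeries (Fin 2) A} (hf : f ∈ seriesFilt σ d)
    (hg : g ∈ seriesFilt σ e) (h : k ≤ d + e) : f * g ∈ seriesFilt σ k := by
  intro m
  rw [MvPowerSeries.coeff_mul]
  refine Submodule.sum_mem _ fun p hp => mul_mem_filt (hf p.1) (hg p.2) ?_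
  rw [← Finset.HasAntidiagonal.mem_antidiagonal.1 hp]
  simp only [Finsupp.add_apply]
  push_cast
  omega

theorem X_mem_seriesFilt (i : Fin 2) : (MvPowerSeries.X i : MvPowerSeries (Fin 2) A) ∈
    seriesFilt σ 1 := by
  intro m
  rw [MvPowerSeries.coeff_X]
  split_ifs with h
  · refine one_mem_filt ?_
    subst h
    fin_cases i <;> simp
  · exact Submodule.zero_mem _

theorem inVar_genSeries_mem (i : Fin 2) (a b : Idx M N) :
    inVar i (genSeries σ a b) ∈ seriesFilt σ 0 := by
  intro m
  rw [coeff_inVar]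
  split_ifs
  · refine filt_mono ?_ (coeff_genSeries_mem a b (m i))
    fin_cases i <;> simp
  · exact Submodule.zero_mem _

theorem units_smul_mem_addSubgroup {G : Type*} [AddCommGroup G] {V : AddSubgroup G} (s : ℤˣ)
    {a : G} (h : a ∈ V) : s • a ∈ V := by
  rcases Int.units_eq_one_or s with rfl | rfl
  · simpa using h
  · simpa using h

theorem one_mem_seriesFilt : (1 : MvPowerSeries (Fin 2) A) ∈ seriesFilt σ 0 := by
  intro m
  rw [MvPowerSeries.coeff_one]
  split_ifs
  · exact one_mem_filt (by omega)
  · exact Submodule.zero_mem _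

/-- Cancellation of the factor `y - x`. -/
theorem mem_of_y_sub_x_mul_mem {d : ℤ} {f : MvPowerSeries (Fin 2) A}
    (h : (y - x) * f ∈ seriesFilt σ (d + 1)) : f ∈ seriesFilt σ d := by
  have key : ∀ (i : ℕ) (m : Fin 2 →₀ ℕ), m 0 = i →
      MvPowerSeries.coeff m f ∈ filt σ (m 0 + m 1 - d) := by
    intro i
    induction i with
    | zero =>
      intro m hm
      -- The coefficient of `(y - x) f` at `u^{-k} v^{-(l + 1)}` is the coefficient of `f` at `(k,
      -- l)` minus the one at `(k - 1, l + 1)`. The latter is absent for `k = 0`, and for `k > 0` it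
      -- is known by induction on `k`.
      have h1 := h (m + Finsupp.single 1 1)
      rw [sub_mul, map_sub, y, x, coeff_X_mul, coeff_X_mul] at h1
      simp [hm] at h1
      rw [hm]
      refine filt_mono ?_ h1
      push_cast; omega
    | succ i ih =>
      intro m hm
      have h1 := h (m + Finsupp.single 1 1)
      rw [sub_mul, map_sub, y, x, coeff_X_mul, coeff_X_mul] at h1
      have h2 := ih (m + Finsupp.single 1 1 - Finsupp.single 0 1) (by simp [hm])
      simp [hm] at h1 h2
      rw [hm]
      have h3 := Submodule.add_mem _ (filt_mono (σ := σ)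
        (show ((i : ℤ) + 1 + (m 1 + 1) - (d + 1) : ℤ) ≤ (i + 1 : ℕ) + m 1 - d by
          push_cast; omega) h1)
        (filt_mono (σ := σ) (show (i + (m 1 + 1) - d : ℤ) ≤ (i + 1 : ℕ) + m 1 - d by
          push_cast; omega) h2)
      rwa [sub_add_cancel] at h3
  exact fun m => key _ m rfl

/-- The substitution `x → -x` preserves the filtration and reduces the claim to the factor `y - x`.
-/
theorem mem_of_y_add_x_mul_mem {d : ℤ} {f : MvPowerSeries (Fin 2) A}
    (h : (y + x) * f ∈ seriesFilt σ (d + 1)) : f ∈ seriesFilt σ d := by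
  have hn : ∀ {e : ℤ} {g : MvPowerSeries (Fin 2) A}, g ∈ seriesFilt σ e →
      negFirst g ∈ seriesFilt σ e := fun hg m => by
    rw [coeff_negFirst]; exact units_smul_mem _ (hg m)
  have h1 := hn h
  rw [map_mul, map_add, negFirst_x, negFirst_y, ← sub_eq_add_neg] at h1
  have h2 := hn (mem_of_y_sub_x_mul_mem h1)
  have h3 : negFirst (negFirst f) = f := by
    ext m
    rw [coeff_negFirst, coeff_negFirst, smul_smul, Int.units_mul_self, one_smul]
  rwa [h3] at h2

variable (σ) in
/-- The matrices with entries in a given step of the filtration. -/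
def matFilt (d : ℤ) : AddSubgroup (Mat₂ M N (MvPowerSeries (Fin 2) A)) where
  carrier := {Z | ∀ p q, Z p q ∈ seriesFilt σ d}
  zero_mem' _ _ := zero_mem _
  add_mem' hf hg p q := add_mem (hf p q) (hg p q)
  neg_mem' hf p q := neg_mem (hf p q)

theorem mul_mem_matFilt {d e k : ℤ} {Z W : Mat₂ M N (MvPowerSeries (Fin 2) A)}
    (hZ : Z ∈ matFilt σ d) (hW : W ∈ matFilt σ e) (h : k ≤ d + e) : Z * W ∈ matFilt σ k := by
  intro p q
  rw [Matrix.mul_apply]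
  exact sum_mem fun r _ => mul_mem_seriesFilt (hZ p r) (hW r q) h

theorem smul_mem_matFilt {d e k : ℤ} {f : MvPowerSeries (Fin 2) A}
    {W : Mat₂ M N (MvPowerSeries (Fin 2) A)}
    (hf : f ∈ seriesFilt σ d) (hW : W ∈ matFilt σ e) (h : k ≤ d + e) : f • W ∈ matFilt σ k :=
  fun p q => mul_mem_seriesFilt hf (hW p q) h

theorem P_mem_matFilt : P ∈ matFilt (M := M) (N := N) σ 0 := by
  rintro ⟨a, c⟩ ⟨b, d⟩
  rw [P_apply]
  split_ifs
  · exact units_smul_mem_addSubgroup _ one_mem_seriesFilt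
  · exact zero_mem _

theorem Q_mem_matFilt (θ : Idx M N → ℤˣ) : Q θ ∈ matFilt (M := M) (N := N) σ 0 := by
  rintro ⟨a, c⟩ ⟨b, d⟩
  rw [Q_apply]
  split_ifs
  · exact units_smul_mem_addSubgroup _ one_mem_seriesFilt
  · exact zero_mem _

theorem atU₁_mem_matFilt : atU₁ (genSeries σ) ∈ matFilt σ 0 := by
  rintro ⟨a, c⟩ ⟨b, d⟩
  rw [atU₁, leg₁_apply]
  split_ifs
  · exact inVar_genSeries_mem 0 a b
  · exact zero_mem _

theorem atV₂_mem_matFilt : atV₂ (genSeries σ) ∈ matFilt σ 0 := by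
  rintro ⟨a, c⟩ ⟨b, d⟩
  rw [atV₂, leg₂_apply]
  split_ifs
  · exact units_smul_mem_addSubgroup _ (inVar_genSeries_mem 1 c d)
  · exact zero_mem _

/-- The supercommutator of two generators has lower weight than their product. -/
theorem supercommutator_mem {θ : Idx M N → ℤˣ}
    (h : reflLHS θ (genSeries σ) = reflRHS θ (genSeries σ)) (g g' : Gen M N) :
    σ g * σ g' - genSign g g' • (σ g' * σ g) ∈ filt σ (weight g + weight g' - 1) := by
  have hU := atU₁_mem_matFilt (σ := σ)
  have hV := atV₂_mem_matFilt (σ := σ)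
  have hP := P_mem_matFilt (M := M) (N := N) (σ := σ)
  have hQ := Q_mem_matFilt (σ := σ) θ
  have hx : (x : MvPowerSeries (Fin 2) A) ∈ seriesFilt σ 1 := X_mem_seriesFilt 0
  have hy : (y : MvPowerSeries (Fin 2) A) ∈ seriesFilt σ 1 := X_mem_seriesFilt 1
  have hm : y - x ∈ seriesFilt σ 1 := sub_mem hy hx
  have hp : y + x ∈ seriesFilt σ 1 := add_mem hy hx
  have hxy : x * y ∈ seriesFilt σ 2 := mul_mem_seriesFilt hx hy (by norm_num)
  rw [reflLHS, reflRHS, Ruv, Ruv', mul_assoc, mul_assoc, mul_assoc, mul_assoc, Rmat_mul, Rmat'_mul,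
    mul_Rmat commute_y_sub_x commute_x_mul_y, Rmat'_mul] at h
  have hc1 : ∀ Z W : Mat₂ M N (MvPowerSeries (Fin 2) A), Z * ((y + x) • W) = (y + x) • (Z * W) :=
    mul_smul_of_central commute_y_add_x
  have hc2 : ∀ Z W : Mat₂ M N (MvPowerSeries (Fin 2) A), Z * ((y - x) • W) = (y - x) • (Z * W) :=
    mul_smul_of_central commute_y_sub_x
  have hc3 : ∀ Z W : Mat₂ M N (MvPowerSeries (Fin 2) A), Z * ((x * y) • W) = (x * y) • (Z * W) :=
    mul_smul_of_central commute_x_mul_y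
  simp only [mul_add, mul_sub, hc1, hc2, hc3, smul_add, smul_sub] at h
  -- All terms of the expanded relation except the two with `(y - x)(y + x)` contain `x y`, of order
  -- two, and a further factor of order at least one. So the commutator of the legs times `(y - x)(y
  -- + x)` has order three, and cancelling the two linear factors leaves order one: the weight drops
  -- by one.
  have hD : ((y - x : MvPowerSeries (Fin 2) A) • (y + x : MvPowerSeries (Fin 2) A) • (atU₁ (genSeries σ) * atV₂ (genSeries σ) -
      atV₂ (genSeries σ) * atU₁ (genSeries σ)) : Mat₂ M N (MvPowerSeries (Fin 2) A)) ∈ matFilt σ 3 := by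
    have hc : (y - x : MvPowerSeries (Fin 2) A) • (y + x : MvPowerSeries (Fin 2) A) • (atV₂ (genSeries σ) * atU₁ (genSeries σ)) =
        (y + x : MvPowerSeries (Fin 2) A) • (y - x : MvPowerSeries (Fin 2) A) •
          (atV₂ (genSeries σ) * atU₁ (genSeries σ)) := by
      rw [smul_smul, smul_smul, (commute_y_add_x (y - x)).eq]
    rw [smul_sub, smul_sub, hc]
    have h0 : ∀ {Z W : Mat₂ M N (MvPowerSeries (Fin 2) A)}, Z ∈ matFilt σ 0 → W ∈ matFilt σ 0 →
        Z * W ∈ matFilt σ 0 := fun hZ hW => mul_mem_matFilt hZ hW (by norm_num)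
    have h1 : ∀ {f : MvPowerSeries (Fin 2) A} {Z : Mat₂ M N (MvPowerSeries (Fin 2) A)},
        f ∈ seriesFilt σ 1 → Z ∈ matFilt σ 0 → (x * y) • f • Z ∈ matFilt σ 3 := fun hf hZ =>
      smul_mem_matFilt hxy (smul_mem_matFilt hf hZ le_rfl) (by norm_num)
    have h1' : ∀ {f : MvPowerSeries (Fin 2) A} {Z : Mat₂ M N (MvPowerSeries (Fin 2) A)},
        f ∈ seriesFilt σ 1 → Z ∈ matFilt σ 0 → f • (x * y) • Z ∈ matFilt σ 3 := fun hf hZ =>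
      smul_mem_matFilt hf (smul_mem_matFilt hxy hZ le_rfl) (by norm_num)
    have h2 : ∀ {Z : Mat₂ M N (MvPowerSeries (Fin 2) A)},
        Z ∈ matFilt σ 0 → (x * y) • (x * y) • Z ∈ matFilt σ 3 := fun hZ =>
      smul_mem_matFilt hxy (smul_mem_matFilt hxy hZ le_rfl) (by norm_num)
    have h3 : ∀ {G : Type _} [AddCommGroup G] {a b c d e f g k : G},
        a + b - (c + d) = e - f + (g - k) → a - e = -b + c + d - f + g - k := by
      intro G _ a b c d e f g k h
      linear_combination (norm := module) h
    rw [h3 h]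
    refine sub_mem (add_mem (sub_mem (add_mem (add_mem (neg_mem ?_) ?_) ?_) ?_) ?_) ?_
    · exact h1' hm (h0 hU (h0 hQ hV))
    · exact h1 hp (h0 hP (h0 hU hV))
    · exact h2 (h0 hP (h0 hU (h0 hQ hV)))
    · exact h1' hp (h0 hV (h0 hU hP))
    · exact h1 hm (h0 hV (h0 hQ hU))
    · exact h2 (h0 hV (h0 hQ (h0 hU hP)))
  have hE := hD (g.1, g'.1) (g.2.1, g'.2.1)
  simp only [Matrix.smul_apply, smul_eq_mul] at hE
  have hE' := mem_of_y_add_x_mul_mem (d := 1) (mem_of_y_sub_x_mul_mem (d := 2) hE)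
  have hF := hE' (Finsupp.single 0 (g.2.2 + 1) + Finsupp.single 1 (g'.2.2 + 1))
  rw [Matrix.sub_apply, atU₁, atV₂, leg₁_mul_leg₂_apply, leg₂_mul_leg₁_apply,
    map_sub, Units.smul_def, Units.smul_def, map_zsmul, map_zsmul, Matrix.map_apply,
    Matrix.map_apply, coeff_inVar_zero_mul_inVar_one, coeff_inVar_one_mul_inVar_zero,
    ← Units.smul_def, ← Units.smul_def] at hF
  simp only [Finsupp.add_apply, Finsupp.single_apply, if_true, one_ne_zero, zero_ne_one, if_false,
    add_zero, zero_add, coeff_succ_genSeries] at hF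
  -- The signs of the two products of legs combine to the exchange sign.
  have hs : (-1 : ℤˣ) ^ ((deg g'.1 + deg g'.2.1) * deg g.2.1) *
      (-1 : ℤˣ) ^ ((deg g'.1 + deg g'.2.1) * deg g.1) = genSign g g' := by
    rw [genSign, exchSign, ← pow_add]
    congr 1
    ring
  have hG := units_smul_mem ((-1 : ℤˣ) ^ ((deg g'.1 + deg g'.2.1) * deg g.2.1)) hF
  rw [smul_sub, smul_smul, smul_smul, hs, Int.units_mul_self, one_smul] at hG
  refine filt_mono ?_ hG
  simp only [weight]
  push_cast
  omega

/-- The symmetry relation identifies a generator with its partner up to lower weight. -/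
theorem sub_star_mem {θ : Idx M N → ℤˣ} {θ₀ : ℤˣ}
    (h : tau θ (genSeries σ) = symmRHS θ₀ (genSeries σ)) (g : Gen M N) :
    σ g - starSign θ g • σ (star g) ∈ filt σ (weight g - 1) := by
  obtain ⟨a, b, k⟩ := g
  have h1 := congrArg (PowerSeries.coeff (k + 1)) (congrFun (congrFun h a) b)
  rw [tau, transp_apply, Matrix.map_apply, Units.smul_def, map_zsmul, coeff_negArg,
    coeff_succ_genSeries, symmRHS, Matrix.add_apply, map_add, coeff_succ_genSeries,
    Matrix.smul_apply, Matrix.sub_apply, Matrix.map_apply, smul_eq_mul, smul_mul_assoc,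
    smul_mul_assoc, Units.smul_def θ₀, map_zsmul, PowerSeries.coeff_smul,
    PowerSeries.coeff_succ_X_mul, map_sub, coeff_negArg] at h1
  have h2 : starSign θ (a, b, k) • σ (star (a, b, k)) = ((transpSign θ a b : ℤˣ) : ℤ) •
      (-1 : ℤˣ) ^ (k + 1) • σ (bar b, bar a, k) := by
    rw [← Units.smul_def, smul_smul, mul_comm]
    rfl
  rw [h2, h1, sub_add_cancel_left, ← Units.smul_def]
  have hk : weight ((a, b, k) : Gen M N) - 1 = k := by simp [weight]
  rw [hk]
  -- The correction carries a factor `u⁻¹`, so only the coefficient at `u^{-k}`, of weight at most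
  -- `k`, enters at `u^{-(k + 1)}`.
  have h3 := coeff_genSeries_mem (σ := σ) a b k
  exact neg_mem (units_smul_mem _ (Submodule.smul_mem _ _ (sub_mem h3 (units_smul_mem _ h3))))

end Filtration

end TwistedSuperYangian

end

noncomputable section

namespace TwistedSuperYangian

/-! ### Ordered monomials span -/

section Spanning

variable {M N : ℕ} {A : Type*} [Ring A] [Algebra ℂ A] {σ : Gen M N → A} {θ : Idx M N → ℤˣ}

/-- Each exchange of neighbouring letters costs a sign and an error of lower weight. The sign
depends on the chain of exchanges and its value is not needed. -/
theorem monomial_perm (hc : ∀ g h, σ g * σ h - genSign g h • (σ h * σ g) ∈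
    filt σ (weight g + weight h - 1)) {l l' : List (Gen M N)} (h : l.Perm l') :
    ∃ s : ℤˣ, monomial σ l - s • monomial σ l' ∈ filt σ (wordWeight l - 1) := by
  induction h with
  | nil => exact ⟨1, by simp⟩
  | @cons g l l' _ ih =>
    obtain ⟨s, hs⟩ := ih
    refine ⟨s, ?_⟩
    rw [monomial_cons, monomial_cons, ← mul_smul_comm, ← mul_sub, wordWeight_cons]
    exact mul_mem_filt (gen_mem_filt g) hs (by omega)
  | swap g h l =>
    refine ⟨genSign h g, ?_⟩
    simp only [monomial_cons, wordWeight_cons]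
    rw [← mul_assoc, ← mul_assoc, ← smul_mul_assoc, ← sub_mul]
    exact mul_mem_filt (hc h g) (monomial_mem_filt le_rfl) (by omega)
  | @trans l₁ l₂ l₃ h₁ h₂ ih₁ ih₂ =>
    obtain ⟨s, hs⟩ := ih₁
    obtain ⟨s', hs'⟩ := ih₂
    refine ⟨s * s', ?_⟩
    rw [← wordWeight_perm h₁] at hs'
    have := add_mem hs (units_smul_mem s hs')
    rwa [smul_sub, smul_smul, sub_add_sub_cancel] at this

/-- An odd generator supercommutes with itself with sign `-1`, so twice its square has lower weight.
-/
theorem sq_mem_of_odd (hc : ∀ g h, σ g * σ h - genSign g h • (σ h * σ g) ∈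
    filt σ (weight g + weight h - 1)) {g : Gen M N} (h : ¬Even (parity g)) :
    σ g * σ g ∈ filt σ (weight g + weight g - 1) := by
  have := hc g g
  rw [genSign_self_of_odd h, Units.neg_smul, one_smul, sub_neg_eq_add, ← two_smul ℂ (σ g * σ g)] at this
  exact (Submodule.smul_mem_iff _ two_ne_zero).1 this

/-- A sorted word fails to be ordered only by repeating an odd letter. Repeated letters are adjacent
after sorting, and an odd square lowers the weight. -/
theorem pairwise_precedes_or_mem (hc : ∀ g h, σ g * σ h - genSign g h • (σ h * σ g) ∈
    filt σ (weight g + weight h - 1)) {l : List (Gen M N)}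
    (h : l.Pairwise fun g h => Encodable.encode g ≤ Encodable.encode h) :
    l.Pairwise Precedes ∨ monomial σ l ∈ filt σ (wordWeight l - 1) := by
  induction l with
  | nil => exact Or.inl List.Pairwise.nil
  | cons g t ih =>
    rw [List.pairwise_cons] at h
    rcases ih h.2 with ht | ht
    · by_cases hg : ∀ k ∈ t, Precedes g k
      · exact Or.inl (List.pairwise_cons.2 ⟨hg, ht⟩)
      · right
        push Not at hg
        obtain ⟨k, hk, hgk⟩ := hg
        rcases t with _ | ⟨e, t⟩
        · simp at hk
        -- The letter `e` next to `g` lies between `g` and its repetition `k`, so all three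
        -- coincide.
        have h1 : Encodable.encode e ≤ Encodable.encode k := by
          rcases List.mem_cons.1 hk with rfl | hk
          · exact le_rfl
          · exact (List.pairwise_cons.1 h.2).1 k hk
        have h2 := h.1 e List.mem_cons_self
        have h3 : ¬Encodable.encode g < Encodable.encode k := fun h' => hgk (Or.inl h')
        have h4 : g = e := Encodable.encode_injective (by omega)
        have h5 : g = k := Encodable.encode_injective (by omega)
        have h6 : ¬Even (parity g) := fun h' => hgk (Or.inr ⟨h5, h'⟩)
        subst h4
        rw [monomial_cons, monomial_cons, ← mul_assoc]
        refine mul_mem_filt (sq_mem_of_odd hc h6) (monomial_mem_filt le_rfl) ?_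
        simp only [wordWeight_cons]
        omega
    · right
      rw [monomial_cons]
      refine mul_mem_filt (gen_mem_filt g) ht ?_
      simp only [wordWeight_cons]
      omega

variable (σ θ) in
/-- The span of the monomials of weight at most `j` in the basic letters. -/
def basicFilt (j : ℤ) : Submodule ℂ A :=
  Submodule.span ℂ {a | ∃ l, (∀ g ∈ l, IsBasic θ g) ∧ wordWeight l ≤ j ∧ monomial σ l = a}

theorem basicFilt_le (j : ℤ) : basicFilt σ θ j ≤ filt σ j :=
  Submodule.span_mono fun _ ⟨l, _, h⟩ => ⟨l, h⟩

theorem basicFilt_mul (i j : ℤ) : basicFilt σ θ i * basicFilt σ θ j ≤ basicFilt σ θ (i + j) := by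
  rw [basicFilt, basicFilt, Submodule.span_mul_span, Submodule.span_le]
  rintro _ ⟨_, ⟨l, hb, hl, rfl⟩, _, ⟨l', hb', hl', rfl⟩, rfl⟩
  refine Submodule.subset_span ⟨l ++ l', ?_, ?_, monomial_append _ _ _⟩
  · intro g hg
    rcases List.mem_append.1 hg with h | h
    exacts [hb g h, hb' g h]
  · rw [wordWeight_append]
    omega

/-- If a letter is not basic, either its partner is basic and replaces it, or it is its own partner
with sign `-1`; then twice the generator has lower weight. -/
theorem gen_mem_basicFilt_sup
    (hs : ∀ g, σ g - starSign θ g • σ (star g) ∈ filt σ (weight g - 1)) (g : Gen M N) :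
    σ g ∈ filt σ (weight g - 1) ⊔ basicFilt σ θ (weight g) := by
  have hb : ∀ g, IsBasic θ g → σ g ∈ basicFilt σ θ (weight g) := fun g hg =>
    Submodule.subset_span ⟨[g], by simpa using hg, by simp, by simp⟩
  by_cases h : IsBasic θ g
  · exact Submodule.mem_sup_right (hb g h)
  · rw [IsBasic, not_or] at h
    by_cases h2 : star g = g
    · have h3 : starSign θ g = -1 :=
        (Int.units_eq_one_or _).resolve_left fun h' => h.2 ⟨h2, h'⟩
      have h4 := hs g
      rw [h2, h3, Units.neg_smul, one_smul, sub_neg_eq_add, ← two_smul ℂ (σ g)] at h4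
      exact Submodule.mem_sup_left ((Submodule.smul_mem_iff _ two_ne_zero).1 h4)
    · have h3 : IsBasic θ (star g) := by
        left
        rw [star_star]
        have : Encodable.encode (star g) ≠ Encodable.encode g := fun h' =>
          h2 (Encodable.encode_injective h')
        omega
      rw [← sub_add_cancel (σ g) (starSign θ g • σ (star g))]
      exact add_mem (Submodule.mem_sup_left (hs g))
        (Submodule.mem_sup_right (units_smul_mem _ (hb _ h3)))

theorem monomial_mem_basicFilt_sup
    (hg : ∀ g, σ g ∈ filt σ (weight g - 1) ⊔ basicFilt σ θ (weight g)) (l : List (Gen M N)) :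
    monomial σ l ∈ filt σ (wordWeight l - 1) ⊔ basicFilt σ θ (wordWeight l) := by
  induction l with
  | nil => exact Submodule.mem_sup_right (Submodule.subset_span ⟨[], by simp, le_rfl, rfl⟩)
  | cons g l ih =>
    rw [monomial_cons, wordWeight_cons]
    obtain ⟨a, ha, b, hb, hab⟩ := Submodule.mem_sup.1 (hg g)
    obtain ⟨c, hc, d, hd, hcd⟩ := Submodule.mem_sup.1 ih
    rw [← hab, ← hcd, add_mul, mul_add b, ← add_assoc]
    refine add_mem (Submodule.mem_sup_left (add_mem ?_ ?_)) (Submodule.mem_sup_right ?_)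
    · exact mul_mem_filt ha (add_mem (filt_mono (by omega) hc) (basicFilt_le _ hd)) (by omega)
    · exact mul_mem_filt (basicFilt_le _ hb) hc (by omega)
    · exact basicFilt_mul _ _ (Submodule.mul_mem_mul hb hd)

variable (σ θ) in
/-- The span of the ordered monomials. -/
def orderedSpan : Submodule ℂ A := Submodule.span ℂ {a | ∃ l, IsOrdered θ l ∧ monomial σ l = a}

/-- Induction on the weight: replacing letters by basic ones, sorting, and discarding words with a
repeated odd letter all have errors of lower weight. The index `n - 1` lets the induction start at
the zero space. -/
theorem filt_le_orderedSpan
    (hc : ∀ g h, σ g * σ h - genSign g h • (σ h * σ g) ∈ filt σ (weight g + weight h - 1))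
    (hs : ∀ g, σ g - starSign θ g • σ (star g) ∈ filt σ (weight g - 1)) (n : ℕ) :
    filt σ (n - 1) ≤ orderedSpan σ θ := by
  induction n with
  | zero => rw [filt_of_neg (by simp)]; exact bot_le
  | succ n ih =>
    have hb : basicFilt σ θ n ≤ orderedSpan σ θ := by
      refine Submodule.span_le.2 ?_
      rintro _ ⟨l, hl, hw, rfl⟩
      let l' := l.insertionSort fun g h => Encodable.encode g ≤ Encodable.encode h
      have hperm : l'.Perm l := List.perm_insertionSort _ _
      have hsort : l'.Pairwise fun g h => Encodable.encode g ≤ Encodable.encode h := by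
        have : Std.Total fun g h : Gen M N => Encodable.encode g ≤ Encodable.encode h :=
          ⟨fun a b => le_total _ _⟩
        have : IsTrans (Gen M N) fun g h => Encodable.encode g ≤ Encodable.encode h :=
          ⟨fun a b c => le_trans⟩
        exact List.pairwise_insertionSort _ _
      have h' : monomial σ l' ∈ orderedSpan σ θ := by
        rcases pairwise_precedes_or_mem hc hsort with h | h
        · exact Submodule.subset_span
            ⟨l', ⟨fun g hg => hl g (hperm.mem_iff.1 hg), h⟩, rfl⟩
        · refine ih (filt_mono ?_ h)
          rw [wordWeight_perm hperm]
          omega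
      obtain ⟨s, hs'⟩ := monomial_perm hc hperm.symm
      rw [SetLike.mem_coe, ← sub_add_cancel (monomial σ l) (s • monomial σ l')]
      exact add_mem (ih (filt_mono (by omega) hs')) (units_smul_mem s h')
    refine Submodule.span_le.2 ?_
    rintro _ ⟨l, hl, rfl⟩
    have h1 := monomial_mem_basicFilt_sup (fun g => gen_mem_basicFilt_sup hs g) l
    push_cast at hl
    have h2 : filt σ (wordWeight l - 1) ≤ orderedSpan σ θ := (filt_mono (by omega)).trans ih
    have h3 : basicFilt σ θ (wordWeight l) ≤ orderedSpan σ θ := by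
      refine le_trans (Submodule.span_mono ?_) hb
      rintro _ ⟨l, h, h', h''⟩
      exact ⟨l, h, by omega, h''⟩
    exact sup_le h2 h3 h1

theorem adjoin_le_orderedSpan
    (hc : ∀ g h, σ g * σ h - genSign g h • (σ h * σ g) ∈ filt σ (weight g + weight h - 1))
    (hs : ∀ g, σ g - starSign θ g • σ (star g) ∈ filt σ (weight g - 1)) {a : A}
    (ha : a ∈ Algebra.adjoin ℂ (Set.range σ)) : a ∈ orderedSpan σ θ := by
  rw [← Subalgebra.mem_toSubmodule, Algebra.adjoin_eq_span] at ha
  refine Submodule.span_le.2 (fun a ha => ?_) ha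
  have : ∃ l, monomial σ l = a := by
    induction ha using Submonoid.closure_induction with
    | mem a ha =>
      obtain ⟨g, rfl⟩ := ha
      exact ⟨[g], by simp⟩
    | one => exact ⟨[], rfl⟩
    | mul a b _ _ iha ihb =>
      obtain ⟨l, rfl⟩ := iha
      obtain ⟨l', rfl⟩ := ihb
      exact ⟨l ++ l', monomial_append _ _ _⟩
  obtain ⟨l, rfl⟩ := this
  refine filt_le_orderedSpan hc hs ((wordWeight l).toNat + 1) (monomial_mem_filt ?_)
  have := wordWeight_nonneg l
  push_cast
  omega

end Spanning

end TwistedSuperYangian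

end

noncomputable section

namespace TwistedSuperYangian

open Matrix

/-! ### Evaluation solutions of the RTT relation and their products -/

section Evaluation

variable {M N : ℕ} {C : Type*} [Ring C]

/-- The supercommutation relations of `gl(M|N)`. -/
theorem supercommutator_of_mul {e : Idx M N → Idx M N → C}
    (he : ∀ a b c d, e a b * e c d = if b = c then (-1 : ℤˣ) ^ deg b • e a d else 0)
    (a b c d : Idx M N) :
    e a b * e c d - exchSign a b c d • (e c d * e a b) =
      rttSign a b c • ((if b = c then e a d else 0) - (if d = a then e c b else 0)) := by
  rw [he, he]
  have h1 : b = c → (-1 : ℤˣ) ^ deg b = rttSign a b c := by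
    rintro rfl
    rw [rttSign]
    rcases deg_cases a with ha | ha <;> rcases deg_cases b with hb | hb <;>
      simp [ha, hb, pow_succ]
  have h2 : d = a → exchSign a b c d * (-1 : ℤˣ) ^ deg d = rttSign a b c := by
    rintro rfl
    rw [rttSign, exchSign]
    rcases deg_cases d with ha | ha <;> rcases deg_cases b with hb | hb <;>
      rcases deg_cases c with hc | hc <;> simp [ha, hb, hc, pow_succ]
  by_cases hb : b = c <;> by_cases hd : d = a
  · rw [if_pos hb, if_pos hd, if_pos hb, if_pos hd, smul_smul, h2 hd, h1 hb, smul_sub]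
  · rw [if_pos hb, if_neg hd, if_pos hb, if_neg hd, h1 hb]; simp
  · rw [if_neg hb, if_pos hd, if_neg hb, if_pos hd, smul_smul, h2 hd]; simp
  · rw [if_neg hb, if_neg hd, if_neg hb, if_neg hd]; simp

/-- Think of `α = 1 / (u - z)` and `β = 1 / (v - z)`; the hypothesis `h` is the partial fraction
identity `(u - v) α β = β - α`. The left side of the entrywise relation reduces to `α β` times a
supercommutator of `gl(M|N)`, and on the right the terms quadratic in `e` cancel. -/
theorem rttPair_evaluation {q p α β : C} (hq : ∀ c, Commute q c) (hp : ∀ c, Commute p c)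
    (hαβ : Commute α β) (h : q * (α * β) = p * (β - α)) {e : Idx M N → Idx M N → C}
    (hα : ∀ a b, Commute α (e a b)) (hβ : ∀ a b, Commute β (e a b))
    (he : ∀ a b c d, e a b * e c d = if b = c then (-1 : ℤˣ) ^ deg b • e a d else 0) :
    RTTPair q p (Matrix.of fun a b => (if a = b then 1 else 0) + α * e a b)
      (Matrix.of fun a b => (if a = b then 1 else 0) + β * e a b) := by
  rw [rttPair_iff hq hp]
  intro a b c d
  simp only [Matrix.of_apply]
  have h1 : ∀ u v : C, (u - exchSign a b c d • v) =
      (u - v) + (v - exchSign a b c d • v) := fun u v => by abel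
  have ha : a = b → exchSign a b c d = 1 := by
    rintro rfl
    rw [exchSign]
    rcases deg_cases a with ha | ha <;> simp [ha, pow_mul]
  have hc : c = d → exchSign a b c d = 1 := by
    rintro rfl
    rw [exchSign, mul_comm]
    rcases deg_cases c with hc | hc <;> simp [hc, pow_mul]
  have hL : (((if a = b then 1 else 0) + α * e a b) * ((if c = d then 1 else 0) + β * e c d) -
      exchSign a b c d • (((if c = d then 1 else 0) + β * e c d) *
        ((if a = b then 1 else 0) + α * e a b))) =
      α * β * (e a b * e c d - exchSign a b c d • (e c d * e a b)) := by
    have e1 : α * e a b * (β * e c d) = α * β * (e a b * e c d) := by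
      rw [mul_assoc, ← mul_assoc (e a b), ← (hβ a b).eq, mul_assoc, mul_assoc]
    have e2 : β * e c d * (α * e a b) = α * β * (e c d * e a b) := by
      rw [mul_assoc, ← mul_assoc (e c d), ← (hα c d).eq, hαβ.eq, mul_assoc, mul_assoc]
    by_cases hab : a = b
    · rw [if_pos hab, ha hab, one_smul, one_smul, mul_sub, ← e1, ← e2]
      split_ifs <;> noncomm_ring
    · rw [if_neg hab]
      by_cases hcd : c = d
      · rw [if_pos hcd, hc hcd, one_smul, one_smul, mul_sub, ← e1, ← e2]
        noncomm_ring
      · rw [if_neg hcd, mul_sub, mul_smul_comm, ← e1, ← e2]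
        simp
  have hR : ((if c = b then 1 else 0) + α * e c b) * ((if a = d then 1 else 0) + β * e a d) -
      ((if c = b then 1 else 0) + β * e c b) * ((if a = d then 1 else 0) + α * e a d) =
      (β - α) * ((if b = c then e a d else 0) - (if d = a then e c b else 0)) := by
    have e1 : α * e c b * (β * e a d) = α * β * (e c b * e a d) := by
      rw [mul_assoc, ← mul_assoc (e c b), ← (hβ c b).eq, mul_assoc, mul_assoc]
    have e2 : β * e c b * (α * e a d) = α * β * (e c b * e a d) := by
      rw [mul_assoc, ← mul_assoc (e c b), ← (hα c b).eq, hαβ.eq, mul_assoc, mul_assoc]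
    simp only [add_mul, mul_add, e1, e2, @eq_comm _ c b, @eq_comm _ a d]
    split_ifs <;> noncomm_ring
  rw [hL, hR, supercommutator_of_mul he, mul_smul_comm, mul_smul_comm, ← mul_assoc, h, mul_assoc]

/-- Every product in the entrywise relation involves the same four indices, hence acquires the same
power of `γ`. -/
theorem RTTPair.twist {q p γ : C} (hq : ∀ c, Commute q c) (hp : ∀ c, Commute p c)
    {X Y : Matrix (Idx M N) (Idx M N) C} (h : RTTPair q p X Y)
    (hX : ∀ a b, Commute γ (X a b)) (hY : ∀ a b, Commute γ (Y a b)) :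
    RTTPair q p (Matrix.of fun a b => X a b * γ ^ (deg a + deg b))
      (Matrix.of fun a b => Y a b * γ ^ (deg a + deg b)) := by
  rw [rttPair_iff hq hp] at h ⊢
  intro a b c d
  simp only [Matrix.of_apply]
  have h1 : ∀ {u v : C} (m n : ℕ), Commute γ v →
      u * γ ^ m * (v * γ ^ n) = u * v * γ ^ (m + n) := by
    intro u v m n hv
    rw [mul_assoc, ← mul_assoc (γ ^ m), (hv.pow_left m).eq, pow_add]
    simp only [mul_assoc]
  rw [h1 _ _ (hY c d), h1 _ _ (hX a b), h1 _ _ (hY a d), h1 _ _ (hX a d),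
    add_comm (deg c + deg d), show deg c + deg b + (deg a + deg d) = deg a + deg b + (deg c + deg d) by ring,
    ← smul_mul_assoc, ← sub_mul, ← sub_mul, ← mul_assoc, ← mul_assoc, h, smul_mul_assoc]

variable {D : Type*} [Ring D]

theorem inVar_comm {f g : PowerSeries D} {s : ℤˣ}
    (h : ∀ i j, PowerSeries.coeff i f * PowerSeries.coeff j g =
      s • (PowerSeries.coeff j g * PowerSeries.coeff i f)) :
    inVar 0 f * inVar 1 g = s • (inVar 1 g * inVar 0 f) := by
  ext m
  rw [Units.smul_def, map_zsmul, coeff_inVar_zero_mul_inVar_one, coeff_inVar_one_mul_inVar_zero, h,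
    Units.smul_def]

theorem genSeries_comm {X Y : Matrix (Idx M N) (Idx M N) (PowerSeries D)} {g k : Gen M N → D}
    (hX : X = genSeries g) (hY : Y = genSeries k)
    (h : ∀ i j, g i * k j = genSign i j • (k j * g i)) (a b c d : Idx M N) (m n : ℕ) :
    PowerSeries.coeff m (X a b) * PowerSeries.coeff n (Y c d) =
      exchSign a b c d • (PowerSeries.coeff n (Y c d) * PowerSeries.coeff m (X a b)) := by
  have ha : a = b → exchSign a b c d = 1 := by
    rintro rfl
    rw [exchSign]
    rcases deg_cases a with ha | ha <;> simp [ha, pow_mul]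
  have hc : c = d → exchSign a b c d = 1 := by
    rintro rfl
    rw [exchSign, mul_comm]
    rcases deg_cases c with hc | hc <;> simp [hc, pow_mul]
  subst hX hY
  rcases m with _ | m
  · rw [coeff_zero_genSeries]
    split_ifs with h
    · rw [ha h]; simp
    · simp
  · rcases n with _ | n
    · rw [coeff_zero_genSeries]
      split_ifs with h
      · rw [hc h]; simp
      · simp
    · rw [coeff_succ_genSeries, coeff_succ_genSeries, h]
      rfl

theorem exchSign_comm (a b c d : Idx M N) : exchSign a b c d = exchSign c d a b := by
  rw [exchSign, exchSign, mul_comm]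

theorem genSign_comm (g h : Gen M N) : genSign g h = genSign h g := exchSign_comm _ _ _ _

/-- The product of two supercommuting solutions of the RTT relation is a solution. -/
theorem SatisfiesRTT.mul {g k : Gen M N → D} (hg : SatisfiesRTT (genSeries g))
    (hk : SatisfiesRTT (genSeries k)) (h : ∀ i j, g i * k j = genSign i j • (k j * g i)) :
    SatisfiesRTT (genSeries g * genSeries k) := by
  have h' : ∀ i j, k i * g j = genSign i j • (g j * k i) := by
    intro i j
    rw [h, smul_smul, genSign_comm, Int.units_mul_self, one_smul]
  have h1 : ∀ i, (genSeries g * genSeries k).map (inVar i) =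
      (genSeries g).map (inVar i) * (genSeries k).map (inVar i) := fun i =>
    Matrix.map_mul (f := inVarHom i)
  rw [SatisfiesRTT, h1, h1]
  refine RTTPair.mul hg hk (leg₁_leg₂_comm fun a b c d => ?_) (leg₁_leg₂_comm fun a b c d => ?_)
  · exact inVar_comm (genSeries_comm rfl rfl h' a b c d)
  · exact inVar_comm (genSeries_comm rfl rfl h a b c d)

theorem inVar_X (i : Fin 2) : inVar i (PowerSeries.X : PowerSeries D) = MvPowerSeries.X i := by
  ext m
  rw [coeff_inVar, PowerSeries.coeff_X, MvPowerSeries.coeff_X]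
  have : m = Finsupp.single i 1 ↔ m (1 - i) = 0 ∧ m i = 1 := by
    constructor
    · rintro rfl; fin_cases i <;> simp
    · rintro ⟨h1, h2⟩; rw [eq_single_of_apply_eq_zero h1, h2]
  by_cases h1 : m (1 - i) = 0 <;> by_cases h2 : m i = 1 <;> simp [this, h1, h2]

theorem inVar_C (i : Fin 2) (d : D) : inVar i (PowerSeries.C d) = MvPowerSeries.C d := by
  ext m
  rw [coeff_inVar, PowerSeries.coeff_C, MvPowerSeries.coeff_C]
  have : m = 0 ↔ m (1 - i) = 0 ∧ m i = 0 := by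
    constructor
    · rintro rfl; simp
    · rintro ⟨h1, h2⟩; rw [eq_single_of_apply_eq_zero h1, h2, Finsupp.single_zero]
  by_cases h1 : m (1 - i) = 0 <;> by_cases h2 : m i = 0 <;> simp [this, h1, h2]

/-- The evaluation solution `1 + e / (u - z)` of the RTT relation. -/
theorem satisfiesRTT_evaluation {z : D} (hz : ∀ d, Commute z d) {e : Idx M N → Idx M N → D}
    (he : ∀ a b c d, e a b * e c d = if b = c then (-1 : ℤˣ) ^ deg b • e a d else 0) :
    SatisfiesRTT (genSeries fun g : Gen M N => z ^ g.2.2 * e g.1 g.2.1) := by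
  -- The expansion of `1 / (u - z)` in powers of `u⁻¹`; it is characterised by `s = u⁻¹ (1 + z s)`.
  let s : PowerSeries D := PowerSeries.X * PowerSeries.mk fun n => z ^ n
  have hs : s = PowerSeries.X * (1 + PowerSeries.C z * s) := by
    ext n
    rcases n with _ | n
    · simp [s]
    · rw [PowerSeries.coeff_succ_X_mul, PowerSeries.coeff_succ_X_mul, map_add,
        PowerSeries.coeff_C_mul, PowerSeries.coeff_mk]
      rcases n with _ | n
      · simp [s]
      · rw [PowerSeries.coeff_succ_X_mul, PowerSeries.coeff_mk, pow_succ']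
        simp [PowerSeries.coeff_one]
  have hi : ∀ i, inVar i s = MvPowerSeries.X i * (1 + MvPowerSeries.C z * inVar i s) := by
    intro i
    conv_lhs => rw [hs]
    rw [← inVarHom_apply, map_mul, map_add, map_one, map_mul, inVarHom_apply, inVarHom_apply,
      inVarHom_apply, inVar_X, inVar_C]
  have hzc : ∀ f : MvPowerSeries (Fin 2) D, Commute (MvPowerSeries.C z) f := by
    intro f
    ext m
    rw [MvPowerSeries.coeff_C_mul, MvPowerSeries.coeff_mul_C]
    exact hz _
  have hsc : ∀ (n : ℕ) (d : D), Commute (PowerSeries.coeff n s) d := by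
    intro n d
    rcases n with _ | n
    · simp [s]
    · rw [PowerSeries.coeff_succ_X_mul, PowerSeries.coeff_mk]
      exact (hz d).pow_left n
  have hsC : ∀ (i : Fin 2) (d : D), Commute (inVar i s) (MvPowerSeries.C d) := by
    intro i d
    ext m
    rw [MvPowerSeries.coeff_C_mul, MvPowerSeries.coeff_mul_C, coeff_inVar]
    split_ifs
    · exact hsc _ d
    · simp
  have hαβ : Commute (inVar 0 s) (inVar 1 s) := by
    ext m
    rw [coeff_inVar_zero_mul_inVar_one, coeff_inVar_one_mul_inVar_zero]
    exact hsc _ _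
  have key : (y - x) * (inVar 0 s * inVar 1 s) = x * y * (inVar 1 s - inVar 0 s) := by
    have h0 := hi 0
    have h1 := hi 1
    change _ = x * _ at h0
    change _ = y * _ at h1
    generalize inVar 0 s = α at *
    generalize inVar 1 s = β at *
    have e1 : y * (α * β) = x * y * (β + MvPowerSeries.C z * (α * β)) := by
      conv_lhs => rw [h0]
      rw [← mul_assoc, ← mul_assoc, (commute_y x).eq, mul_assoc, add_mul, one_mul, mul_assoc]
      simp only [mul_assoc]
    have e2 : x * (α * β) = x * y * (α + MvPowerSeries.C z * (α * β)) := by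
      conv_lhs => rw [h1]
      rw [← mul_assoc α, ← (commute_y α).eq, mul_assoc y, mul_add, mul_one, ← mul_assoc α,
        ← (hzc α).eq, mul_assoc, mul_assoc]
    rw [sub_mul, e1, e2]
    noncomm_ring
  have hE : ∀ i, (genSeries fun g : Gen M N => z ^ g.2.2 * e g.1 g.2.1).map (inVar i) =
      Matrix.of fun a b => (if a = b then 1 else 0) + inVar i s * MvPowerSeries.C (e a b) := by
    intro i
    ext1 a b
    have h1 : genSeries (fun g : Gen M N => z ^ g.2.2 * e g.1 g.2.1) a b =
        (if a = b then 1 else 0) + s * PowerSeries.C (e a b) := by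
      ext n
      rcases n with _ | n
      · rw [coeff_zero_genSeries]
        split_ifs <;> simp [s]
      · rw [coeff_succ_genSeries, map_add, PowerSeries.coeff_mul_C, PowerSeries.coeff_succ_X_mul,
          PowerSeries.coeff_mk]
        split_ifs <;> simp [PowerSeries.coeff_one]
    rw [Matrix.map_apply, h1, Matrix.of_apply, ← inVarHom_apply, map_add, map_mul, inVarHom_apply,
      inVarHom_apply i (PowerSeries.C _), inVar_C]
    congr 1
    split_ifs
    · exact map_one (inVarHom i)
    · exact map_zero (inVarHom i)
  rw [SatisfiesRTT, hE, hE]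
  refine rttPair_evaluation commute_y_sub_x commute_x_mul_y hαβ key (fun a b => hsC _ _)
    (fun a b => hsC _ _) fun a b c d => ?_
  rw [← map_mul, he]
  split_ifs
  · rw [Units.smul_def, Units.smul_def, map_zsmul]
  · exact map_zero _

/-- Twisting a solution of the RTT relation by a commuting involution. -/
theorem SatisfiesRTT.twist {g : Gen M N → D} (h : SatisfiesRTT (genSeries g)) {γ : D}
    (hγ : γ * γ = 1) (hg : ∀ i, Commute γ (g i)) :
    SatisfiesRTT (genSeries fun i => g i * γ ^ parity i) := by
  have hc : ∀ i a b, Commute (MvPowerSeries.C γ) ((genSeries g).map (inVar i) a b) := by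
    intro i a b
    ext m
    rw [MvPowerSeries.coeff_C_mul, MvPowerSeries.coeff_mul_C, Matrix.map_apply, coeff_inVar]
    split_ifs
    · rcases m i with _ | n
      · rw [coeff_zero_genSeries]; split_ifs <;> simp
      · rw [coeff_succ_genSeries]; exact hg _
    · simp
  have h1 := RTTPair.twist commute_y_sub_x commute_x_mul_y h (hc 0) (hc 1)
  have h2 : ∀ i, (genSeries fun i => g i * γ ^ parity i).map (inVar i) = Matrix.of fun a b =>
      (genSeries g).map (inVar i) a b * MvPowerSeries.C γ ^ (deg a + deg b) := by
    intro i
    ext a b m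
    rw [Matrix.of_apply, ← map_pow, MvPowerSeries.coeff_mul_C, Matrix.map_apply, Matrix.map_apply,
      coeff_inVar, coeff_inVar]
    split_ifs
    · rcases m i with _ | n
      · rw [coeff_zero_genSeries, coeff_zero_genSeries]
        split_ifs with hab
        · subst hab
          -- The constant term `1` on the diagonal is multiplied by an even power of `γ`; here `γ² =
          -- 1` is needed.
          rw [← two_mul, pow_mul, pow_two, hγ, one_pow, mul_one]
        · simp
      · rw [coeff_succ_genSeries, coeff_succ_genSeries]; rfl
    · simp
  rw [SatisfiesRTT, h2, h2]
  exact h1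

theorem SatisfiesRTT.map_genSeries {A : Type*} [Ring A] (f : A →+* D) {g : Gen M N → A}
    (h : SatisfiesRTT (genSeries g)) : SatisfiesRTT (genSeries fun i => f (g i)) := by
  rw [satisfiesRTT_iff] at h ⊢
  rw [← genSeries_map, rttLHS_map, rttRHS_map, h]

theorem satisfiesRTT_one : SatisfiesRTT (1 : Matrix (Idx M N) (Idx M N) (PowerSeries D)) := by
  have h1 : ∀ i, (1 : Matrix (Idx M N) (Idx M N) (PowerSeries D)).map (inVar i) = 1 := fun i =>
    Matrix.map_one _ (map_zero (inVarHom i)) (map_one (inVarHom i))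
  rw [SatisfiesRTT, h1, h1, RTTPair]
  have h2 : leg₁ (1 : Matrix (Idx M N) (Idx M N) (MvPowerSeries (Fin 2) D)) = 1 := by
    ext ⟨a, c⟩ ⟨b, d⟩
    rw [leg₁_apply]
    by_cases h : a = b <;> by_cases h' : c = d <;> simp [h, h', Matrix.one_apply]
  have h3 : leg₂ (1 : Matrix (Idx M N) (Idx M N) (MvPowerSeries (Fin 2) D)) = 1 := by
    ext ⟨a, c⟩ ⟨b, d⟩
    rw [leg₂_apply]
    by_cases h : a = b <;> by_cases h' : c = d <;> simp [h, h', Matrix.one_apply]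
  rw [h2, h3, mul_one, mul_one, one_mul, one_mul]

end Evaluation

end TwistedSuperYangian

end

noncomputable section

namespace TwistedSuperYangian

open Matrix

/-! ### Leading coefficients of polynomial solutions -/

section Lead

variable {M N : ℕ} {B : Type*} [Ring B]

/-- The entries of the coefficient of `u^{-(k + 1)}` in `X` are polynomials of degree at most `k`,
with coefficients `F` in degree `k`. -/
structure Lead (X : Matrix (Idx M N) (Idx M N) (PowerSeries (Polynomial B))) (F : Gen M N → B) :
    Prop where
  zero : ∀ a b, PowerSeries.coeff 0 (X a b) = if a = b then 1 else 0
  natDegree_le : ∀ a b k, (PowerSeries.coeff (k + 1) (X a b)).natDegree ≤ k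
  coeff_eq : ∀ a b k, (PowerSeries.coeff (k + 1) (X a b)).coeff k = F (a, b, k)

variable {X Y : Matrix (Idx M N) (Idx M N) (PowerSeries (Polynomial B))} {F G : Gen M N → B}

/-- Two nonconstant coefficients at `u^{-(i + 1)}` and `u^{-(j + 1)}` multiply to degree at most `i
+ j`, one less than what is allowed at `u^{-(i + j + 2)}`. So only products with a constant term
reach the top degree, and leading coefficients of a product of matrices add. -/
theorem Lead.coeff_mul_coeff (hX : Lead X F) (hY : Lead Y G) (a b c : Idx M N) {n : ℕ} {p : ℕ × ℕ}
    (hp : p.1 + p.2 = n) :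
    (PowerSeries.coeff (p.1 + 1) (X a c) * PowerSeries.coeff p.2 (Y c b)).natDegree ≤ n ∧
      (PowerSeries.coeff (p.1 + 1) (X a c) * PowerSeries.coeff p.2 (Y c b)).coeff n =
        if p.2 = 0 then if c = b then F (a, c, n) else 0 else 0 := by
  obtain ⟨i, _ | j⟩ := p
  · simp only [add_zero] at hp
    subst hp
    rw [hY.zero]
    simp only [if_true]
    split_ifs
    · rw [mul_one]
      exact ⟨hX.natDegree_le _ _ _, hX.coeff_eq _ _ _⟩
    · simp
  · have h1 : (PowerSeries.coeff (i + 1) (X a c) * PowerSeries.coeff (j + 1) (Y c b)).natDegree ≤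
        i + j :=
      Polynomial.natDegree_mul_le.trans (add_le_add (hX.natDegree_le _ _ _) (hY.natDegree_le _ _ _))
    simp only at hp
    refine ⟨h1.trans (by omega), ?_⟩
    rw [if_neg (Nat.succ_ne_zero _), Polynomial.coeff_eq_zero_of_natDegree_lt]
    exact lt_of_le_of_lt h1 (by omega)

theorem Lead.coeff_mul (hX : Lead X F) (Y : Matrix (Idx M N) (Idx M N) (PowerSeries (Polynomial B)))
    (a b : Idx M N) (n : ℕ) :
    PowerSeries.coeff (n + 1) ((X * Y) a b) = PowerSeries.coeff (n + 1) (Y a b) +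
      ∑ c, ∑ p ∈ Finset.HasAntidiagonal.antidiagonal n,
        PowerSeries.coeff (p.1 + 1) (X a c) * PowerSeries.coeff p.2 (Y c b) := by
  simp only [Matrix.mul_apply, map_sum, PowerSeries.coeff_mul, Finset.Nat.sum_antidiagonal_succ,
    hX.zero, Finset.sum_add_distrib]
  simp [-Fintype.sum_sum_type]

/-- The leading coefficients of a product. -/
theorem Lead.mul (hX : Lead X F) (hY : Lead Y G) : Lead (X * Y) fun g => F g + G g where
  zero := coeff_mul_zero hX.zero hY.zero
  natDegree_le a b k := by
    rw [hX.coeff_mul Y]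
    refine Polynomial.natDegree_add_le_of_degree_le (hY.natDegree_le _ _ _)
      (Polynomial.natDegree_sum_le_of_forall_le _ _ fun c _ =>
        Polynomial.natDegree_sum_le_of_forall_le _ _ fun p hp => ?_)
    exact (hX.coeff_mul_coeff hY a b c (Finset.HasAntidiagonal.mem_antidiagonal.1 hp)).1
  coeff_eq a b k := by
    rw [hX.coeff_mul Y, Polynomial.coeff_add, hY.coeff_eq, add_comm]
    congr 1
    simp only [Polynomial.finsetSum_coeff]
    have h1 : ∀ c, ∑ p ∈ Finset.HasAntidiagonal.antidiagonal k,
        (PowerSeries.coeff (p.1 + 1) (X a c) * PowerSeries.coeff p.2 (Y c b)).coeff k =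
        if c = b then F (a, c, k) else 0 := by
      intro c
      rw [Finset.sum_eq_single (k, 0)]
      · rw [(hX.coeff_mul_coeff hY a b c (add_zero k)).2, if_pos rfl]
      · intro p hp hne
        have hp := Finset.HasAntidiagonal.mem_antidiagonal.1 hp
        rw [(hX.coeff_mul_coeff hY a b c hp).2, if_neg]
        rintro h
        exact hne (Prod.ext (by simpa [h] using hp) h)
      · simp
    simp only [h1]
    simp [-Fintype.sum_sum_type]

/-- The leading coefficients of the transposed matrix. -/
theorem Lead.tau (hX : Lead X F) (θ : Idx M N → ℤˣ) :
    Lead (tau θ X) fun g => starSign θ g • F (star g) := by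
  have h1 : ∀ a b k, PowerSeries.coeff (k + 1) (TwistedSuperYangian.tau θ X a b) =
      starSign θ (a, b, k) • PowerSeries.coeff (k + 1) (X (bar b) (bar a)) := by
    intro a b k
    rw [TwistedSuperYangian.tau, transp_apply, Matrix.map_apply, Units.smul_def, map_zsmul,
      coeff_negArg, ← Units.smul_def, starSign, mul_comm, mul_smul]
  have h2 : ∀ (s : ℤˣ) (f : Polynomial B), (s • f).natDegree = f.natDegree := by
    intro s f
    rcases Int.units_eq_one_or s with rfl | rfl <;> simp [Units.smul_def]
  refine ⟨coeff_tau_zero θ hX.zero, fun a b k => ?_, fun a b k => ?_⟩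
  · rw [h1, h2]
    exact hX.natDegree_le _ _ _
  · rw [h1, Units.smul_def, Polynomial.coeff_smul, hX.coeff_eq]
    rfl

theorem lead_genSeries {t : Gen M N → Polynomial B} (ht : ∀ g, (t g).natDegree ≤ g.2.2) :
    Lead (genSeries t) fun g => (t g).coeff g.2.2 where
  zero := coeff_zero_genSeries t
  natDegree_le a b k := by
    rw [coeff_succ_genSeries]
    exact ht (a, b, k)
  coeff_eq a b k := by rw [coeff_succ_genSeries]

end Lead

end TwistedSuperYangian

end

noncomputable section

namespace TwistedSuperYangian

/-! ### Combinatorics of ordered words -/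

section Words

variable {M N : ℕ} {θ : Idx M N → ℤˣ}

instance : BEq (Gen M N) := instBEqOfDecidableEq

theorem Precedes.antisymm {g h : Gen M N} (h1 : Precedes g h) (h2 : Precedes h g) : g = h := by
  rcases h1 with h1 | ⟨h1, -⟩
  · rcases h2 with h2 | ⟨h2, -⟩
    · omega
    · exact h2.symm
  · exact h1

theorem IsOrdered.tail {g : Gen M N} {l : List (Gen M N)} (h : IsOrdered θ (g :: l)) :
    IsOrdered θ l :=
  ⟨fun i hi => h.1 i (List.mem_cons_of_mem _ hi), h.2.of_cons⟩

theorem IsOrdered.erase {l : List (Gen M N)} (h : IsOrdered θ l) (g : Gen M N) :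
    IsOrdered θ (l.erase g) :=
  ⟨fun i hi => h.1 i (List.mem_of_mem_erase hi), h.2.sublist List.erase_sublist⟩

theorem IsOrdered.eq_of_perm {l l' : List (Gen M N)} (h : IsOrdered θ l) (h' : IsOrdered θ l')
    (hp : l.Perm l') : l = l' :=
  hp.eq_of_pairwise (fun _ _ _ _ h1 h2 => Precedes.antisymm h1 h2) h.2 h'.2

/-- A letter that is repeated is even and its occurrences are consecutive. -/
theorem IsOrdered.of_mem {g : Gen M N} {l : List (Gen M N)} (h : IsOrdered θ (g :: l))
    (hg : g ∈ l) : Even (parity g) ∧ g :: l.erase g = l := by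
  have h1 := (List.pairwise_cons.1 h.2).1
  have h2 : Even (parity g) := by
    rcases h1 g hg with h | h
    · omega
    · exact h.2
  refine ⟨h2, IsOrdered.eq_of_perm (θ := θ) ⟨?_, ?_⟩ h.tail (List.perm_cons_erase hg).symm⟩
  · intro i hi
    rcases List.mem_cons.1 hi with rfl | hi
    · exact h.1 _ (by simp)
    · exact h.tail.1 _ (List.mem_of_mem_erase hi)
  · refine List.pairwise_cons.2 ⟨fun i hi => h1 i (List.mem_of_mem_erase hi), ?_⟩
    exact (h.tail.erase g).2

variable (θ) in
/-- The pairing of two letters in the evaluation solution. -/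
def pairing (g h : Gen M N) : ℤ :=
  (-1) ^ deg h.2.1 * ((if g = h then 1 else 0) + (starSign θ g : ℤ) * if star g = h then 1 else 0)

/-- Two distinct basic letters are never partners, because a basic letter with a different partner
strictly precedes it. -/
theorem pairing_eq_zero {g h : Gen M N} (hg : IsBasic θ g) (hh : IsBasic θ h) (hne : g ≠ h) :
    pairing θ g h = 0 := by
  have : star g ≠ h := by
    rintro rfl
    rcases hg with hg | hg
    · rcases hh with hh | hh
      · rw [star_star] at hh; omega
      · rw [star_star] at hh; exact hne hh.1
    · exact hne hg.1.symm
  simp [pairing, hne, this]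

/-- The value is `±1`, or `±2` for a basic letter that is its own partner: its sign is then `1`, so
the two terms do not cancel. -/
theorem pairing_self_ne_zero {h : Gen M N} (hh : IsBasic θ h) : pairing θ h h ≠ 0 := by
  have : ((-1 : ℤ) ^ deg h.2.1) ≠ 0 := pow_ne_zero _ (by decide)
  by_cases hs : star h = h
  · have h1 : starSign θ h = 1 := by
      rcases hh with hh | hh
      · rw [hs] at hh; omega
      · exact hh.2
    simp [pairing, hs, h1]
  · simp [pairing, hs]

/-- The parity of a word. -/
def wordParity (l : List (Gen M N)) : ℕ := (l.map parity).sum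

@[simp] theorem wordParity_nil : wordParity ([] : List (Gen M N)) = 0 := rfl

@[simp] theorem wordParity_cons (g : Gen M N) (l : List (Gen M N)) :
    wordParity (g :: l) = parity g + wordParity l := by simp [wordParity]

end Words

/-! ### Contraction of a word with a letter -/

section Contraction

variable {M N : ℕ} {θ : Idx M N → ℤˣ} {B : Type*} [Ring B] (σ : Gen M N → B)

variable (θ) in
/-- The sum of the words obtained from a word by contracting one of its letters with `h`. -/
def contraction (h : Gen M N) : List (Gen M N) → B
  | [] => 0
  | g :: l => (-1 : ℤˣ) ^ (deg h.1 * parity g) • (σ g * contraction h l) +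
      pairing θ g h • (-1 : ℤˣ) ^ (deg h.2.1 * wordParity l) • monomial σ l

/-- Only occurrences of `h` itself contribute. An odd letter occurs at most once; for an even letter
all occurrences contribute with the same sign, so they add up to the multiplicity. The explicit sign
for even `h` is what the induction needs to exclude cancellation. -/
theorem contraction_of_isOrdered {h : Gen M N} (hh : IsBasic θ h) {l : List (Gen M N)}
    (hl : IsOrdered θ l) : ∃ s : ℤˣ,
      (Even (parity h) → s = (-1 : ℤˣ) ^ (deg h.2.1 * wordParity l)) ∧
      contraction θ σ h l = (l.count h * pairing θ h h : ℤ) • s • monomial σ (l.erase h) := by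
  have hdeg : Even (parity h) → deg h.1 = deg h.2.1 := by
    intro he
    rw [parity] at he
    rcases deg_cases h.1 with h1 | h1 <;> rcases deg_cases h.2.1 with h2 | h2 <;>
      simp_all
  induction l with
  | nil => exact ⟨1, by simp [contraction]⟩
  | cons g l ih =>
    obtain ⟨s, hs, h1⟩ := ih hl.tail
    by_cases hg : g = h
    · subst hg
      refine ⟨(-1 : ℤˣ) ^ (deg g.2.1 * wordParity l), fun he => ?_, ?_⟩
      · rw [wordParity_cons, mul_add, pow_add, pow_mul' _ _ (parity g), he.neg_one_pow]
        simp
      · rw [contraction, h1, List.erase_cons_head, List.count_cons_self]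
        by_cases hm : g ∈ l
        · obtain ⟨he, h2⟩ := hl.of_mem hm
          have h3 : (-1 : ℤˣ) ^ (deg g.1 * parity g) = 1 := by
            rw [mul_comm, pow_mul, he.neg_one_pow, one_pow]
          rw [h3, one_smul, mul_smul_comm, mul_smul_comm, ← monomial_cons, h2, hs he]
          push_cast
          rw [add_mul, add_smul, one_mul]
        · simp [List.count_eq_zero_of_not_mem hm]
    · refine ⟨(-1 : ℤˣ) ^ (deg h.1 * parity g) * s, fun he => ?_, ?_⟩
      · rw [hs he, hdeg he, wordParity_cons, mul_add, pow_add]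
      · rw [contraction, h1, pairing_eq_zero (hl.1 g (by simp)) hh hg, zero_smul, add_zero,
          List.erase_cons_tail (by simpa using hg), List.count_cons_of_ne hg, monomial_cons,
          mul_smul_comm, mul_smul_comm,
          smul_comm ((-1 : ℤˣ) ^ _) (_ : ℤ), smul_smul ((-1 : ℤˣ) ^ _) s]

end Contraction

/-! ### Matrices over two copies of the graded space -/

section Step

variable {M N : ℕ} {B : Type*} [Ring B]

/-- The parity of the index set of two copies of the graded space. -/
def deg₂ : Idx M N ⊕ Idx M N → ℕ := Sum.elim deg deg

/-- Matrices on two copies of the graded space, with polynomial entries. -/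
abbrev DoubleMat (M N : ℕ) (B : Type*) [Ring B] : Type _ :=
  Matrix (Idx M N ⊕ Idx M N) (Idx M N ⊕ Idx M N) (Polynomial B)

/-- The scalar matrices. -/
def scalarHom (M N : ℕ) (B : Type*) [Ring B] : B →+* DoubleMat M N B :=
  (Matrix.scalar _).comp Polynomial.C

/-- The parity operator. -/
def parityMat (M N : ℕ) (B : Type*) [Ring B] : DoubleMat M N B :=
  Matrix.diagonal fun i => (-1) ^ deg₂ i

/-- The variable of the polynomials. -/
def varMat (M N : ℕ) (B : Type*) [Ring B] : DoubleMat M N B := Matrix.scalar _ Polynomial.X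

/-- The elementary matrices on the first copy, with a sign. -/
def unitMat (B : Type*) [Ring B] (a b : Idx M N) : DoubleMat M N B :=
  (-1 : ℤˣ) ^ deg b • Matrix.single (Sum.inl a) (Sum.inl b) 1

theorem scalarHom_mul_apply (b : B) (X : DoubleMat M N B) (i j : Idx M N ⊕ Idx M N) :
    (scalarHom M N B b * X) i j = Polynomial.C b * X i j := by
  simp [scalarHom, Matrix.scalar_apply, Matrix.diagonal_mul]

theorem varMat_mul_apply (X : DoubleMat M N B) (i j : Idx M N ⊕ Idx M N) :
    (varMat M N B * X) i j = Polynomial.X * X i j := by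
  simp [varMat, Matrix.scalar_apply, Matrix.diagonal_mul]

theorem varMat_pow_mul_apply (k : ℕ) (X : DoubleMat M N B) (i j : Idx M N ⊕ Idx M N) :
    (varMat M N B ^ k * X) i j = Polynomial.X ^ k * X i j := by
  induction k with
  | zero => simp
  | succ k ih => rw [pow_succ', mul_assoc, varMat_mul_apply, ih, pow_succ', mul_assoc]

theorem parityMat_pow_mul_apply (p : ℕ) (X : DoubleMat M N B) (i j : Idx M N ⊕ Idx M N) :
    (parityMat M N B ^ p * X) i j = (-1 : ℤˣ) ^ (deg₂ i * p) • X i j := by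
  rw [parityMat, Matrix.diagonal_pow, Matrix.diagonal_mul]
  rw [Pi.pow_apply, ← pow_mul]
  rcases neg_one_pow_eq_or (ℤˣ) (deg₂ i * p) with h | h <;>
    rcases Nat.even_or_odd (deg₂ i * p) with h' | h' <;>
    simp_all [h'.neg_one_pow]

end Step

end TwistedSuperYangian

end

noncomputable section

namespace TwistedSuperYangian

/-! ### Expansion of monomials in the evaluation generators -/

section Expansion

variable {M N : ℕ} {B : Type*} [Ring B] [Algebra ℂ B] (σ : Gen M N → B)

/-- The span of the monomials of length at most `m`. -/
def lengthFilt (m : ℤ) : Submodule ℂ B :=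
  Submodule.span ℂ {b | ∃ l : List (Gen M N), (l.length : ℤ) ≤ m ∧ monomial σ l = b}

variable {σ}

theorem monomial_mem_lengthFilt {l : List (Gen M N)} {m : ℤ} (h : (l.length : ℤ) ≤ m) :
    monomial σ l ∈ lengthFilt σ m := Submodule.subset_span ⟨l, h, rfl⟩

theorem lengthFilt_mono {m n : ℤ} (h : m ≤ n) : lengthFilt σ m ≤ lengthFilt σ n :=
  Submodule.span_mono fun _ ⟨l, hl, hb⟩ => ⟨l, hl.trans h, hb⟩

theorem gen_mul_mem_lengthFilt {m : ℤ} (g : Gen M N) {b : B} (hb : b ∈ lengthFilt σ m) :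
    σ g * b ∈ lengthFilt σ (m + 1) := by
  refine (Submodule.span_le (p := (lengthFilt σ (m + 1)).comap (LinearMap.mulLeft ℂ (σ g)))).2 ?_ hb
  rintro _ ⟨l, hl, rfl⟩
  have : monomial σ (g :: l) ∈ lengthFilt σ (m + 1) :=
    monomial_mem_lengthFilt (by simpa using hl)
  simpa using this

variable (σ) in
/-- The matrices with coefficients in the span of the monomials of length at most `m`. -/
def doubleFilt (m : ℤ) : AddSubgroup (DoubleMat M N B) where
  carrier := {X | ∀ i j n, (X i j).coeff n ∈ lengthFilt σ m}
  add_mem' hX hY i j n := by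
    rw [Matrix.add_apply, Polynomial.coeff_add]
    exact add_mem (hX i j n) (hY i j n)
  zero_mem' i j n := by simp
  neg_mem' hX i j n := by
    rw [Matrix.neg_apply, Polynomial.coeff_neg]
    exact neg_mem (hX i j n)

theorem doubleFilt_mono {m n : ℤ} (h : m ≤ n) : doubleFilt σ m ≤ doubleFilt σ n :=
  fun _ hX i j k => lengthFilt_mono h (hX i j k)

theorem units_smul_mem_doubleFilt {m : ℤ} (s : ℤˣ) {X : DoubleMat M N B} (hX : X ∈ doubleFilt σ m) :
    s • X ∈ doubleFilt σ m := by
  rcases Int.units_eq_one_or s with rfl | rfl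
  · simpa using hX
  · simpa using hX

variable (σ) in
/-- The diagonal part of a generator. -/
def diagPart (g : Gen M N) : DoubleMat M N B :=
  scalarHom M N B (σ g) * parityMat M N B ^ parity g

/-- The generators of the evaluation solution. -/
def evalGen (B : Type*) [Ring B] (g : Gen M N) : DoubleMat M N B :=
  varMat M N B ^ g.2.2 * unitMat B g.1 g.2.1

variable (θ : Idx M N → ℤˣ)

/-- The symmetrised generators of the evaluation solution. -/
def symmEval (B : Type*) [Ring B] (g : Gen M N) : DoubleMat M N B :=
  evalGen B g + starSign θ g • evalGen B (star g)

theorem diagPart_mul_apply (g : Gen M N) (X : DoubleMat M N B) (i j : Idx M N ⊕ Idx M N) :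
    (diagPart σ g * X) i j = (-1 : ℤˣ) ^ (deg₂ i * parity g) • (Polynomial.C (σ g) * X i j) := by
  rw [diagPart, mul_assoc, scalarHom_mul_apply, parityMat_pow_mul_apply, mul_smul_comm]

theorem evalGen_mul_apply (g : Gen M N) (X : DoubleMat M N B) (i j : Idx M N ⊕ Idx M N) :
    (evalGen B g * X) i j = if i = Sum.inl g.1 then
      (-1 : ℤˣ) ^ deg g.2.1 • (Polynomial.X ^ g.2.2 * X (Sum.inl g.2.1) j) else 0 := by
  rw [evalGen, mul_assoc, varMat_pow_mul_apply, unitMat, smul_mul_assoc, Matrix.smul_apply]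
  split_ifs with h
  · subst h
    rw [Matrix.single_mul_apply_same, one_mul, mul_smul_comm]
  · rw [Matrix.single_mul_apply_of_ne _ _ _ _ _ h, smul_zero, mul_zero]

theorem diagPart_mul_mem {m : ℤ} (g : Gen M N) {X : DoubleMat M N B} (hX : X ∈ doubleFilt σ m) :
    diagPart σ g * X ∈ doubleFilt σ (m + 1) := by
  intro i j n
  rw [diagPart_mul_apply, Units.smul_def, Polynomial.coeff_smul, ← Units.smul_def,
    Polynomial.coeff_C_mul]
  exact units_smul_mem _ (gen_mul_mem_lengthFilt g (hX i j n))

theorem evalGen_mul_mem {m : ℤ} (g : Gen M N) {X : DoubleMat M N B} (hX : X ∈ doubleFilt σ m) :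
    evalGen B g * X ∈ doubleFilt σ m := by
  intro i j n
  rw [evalGen_mul_apply]
  split_ifs
  · rw [Units.smul_def, Polynomial.coeff_smul, ← Units.smul_def, Polynomial.coeff_X_pow_mul']
    refine units_smul_mem _ ?_
    split_ifs
    · exact hX _ _ _
    · exact Submodule.zero_mem _
  · simp

theorem symmEval_mul_mem {m : ℤ} (g : Gen M N) {X : DoubleMat M N B} (hX : X ∈ doubleFilt σ m) :
    symmEval θ B g * X ∈ doubleFilt σ m := by
  rw [symmEval, add_mul, smul_mul_assoc]
  exact add_mem (evalGen_mul_mem g hX) (units_smul_mem_doubleFilt _ (evalGen_mul_mem _ hX))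

variable (σ) in
/-- The part of a monomial that is linear in the symmetrised evaluation generators. -/
def linearPart : List (Gen M N) → DoubleMat M N B
  | [] => 0
  | g :: l => diagPart σ g * linearPart l + symmEval θ B g * monomial (diagPart σ) l

theorem monomial_diagPart_apply (l : List (Gen M N)) (i j : Idx M N ⊕ Idx M N) :
    monomial (diagPart σ) l i j = if i = j then
      (-1 : ℤˣ) ^ (deg₂ i * wordParity l) • Polynomial.C (monomial σ l) else 0 := by
  induction l with
  | nil => simp [Matrix.one_apply]
  | cons g l ih =>
    rw [monomial_cons, diagPart_mul_apply, ih]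
    split_ifs
    · rw [monomial_cons, wordParity_cons, mul_add, pow_add, mul_smul_comm, smul_smul, map_mul]
    · simp

theorem monomial_diagPart_mem (l : List (Gen M N)) :
    monomial (diagPart σ) l ∈ doubleFilt σ l.length := by
  intro i j n
  rw [monomial_diagPart_apply]
  split_ifs
  · rw [Units.smul_def, Polynomial.coeff_smul, ← Units.smul_def, Polynomial.coeff_C]
    refine units_smul_mem _ ?_
    split_ifs
    · exact monomial_mem_lengthFilt le_rfl
    · exact Submodule.zero_mem _
  · simp

theorem linearPart_mem (l : List (Gen M N)) : linearPart σ θ l ∈ doubleFilt σ (l.length - 1) := by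
  induction l with
  | nil => exact zero_mem _
  | cons g l ih =>
    refine add_mem (doubleFilt_mono ?_ (diagPart_mul_mem g ih))
      (doubleFilt_mono ?_ (symmEval_mul_mem θ g (monomial_diagPart_mem l))) <;> simp

/-- What remains contains at least two evaluation letters, and these do not count towards the length
in the old generators. -/
theorem monomial_sub_mem (l : List (Gen M N)) :
    monomial (fun g => diagPart σ g + symmEval θ B g) l -
      (monomial (diagPart σ) l + linearPart σ θ l) ∈ doubleFilt σ (l.length - 2) := by
  induction l with
  | nil => simp [linearPart]
  | cons g l ih =>
    set m := monomial (fun g => diagPart σ g + symmEval θ B g) l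
    set d := monomial (diagPart σ) l with hd
    have h1 : (diagPart σ g + symmEval θ B g) * m -
        (diagPart σ g * d + (diagPart σ g * linearPart σ θ l + symmEval θ B g * d)) =
        diagPart σ g * (m - (d + linearPart σ θ l)) + symmEval θ B g * (m - (d + linearPart σ θ l)) +
          symmEval θ B g * linearPart σ θ l := by noncomm_ring
    rw [monomial_cons, monomial_cons, linearPart, ← hd, h1]
    refine add_mem (add_mem (doubleFilt_mono ?_ (diagPart_mul_mem g ih))
      (doubleFilt_mono ?_ (symmEval_mul_mem θ g ih)))
      (doubleFilt_mono ?_ (symmEval_mul_mem θ g (linearPart_mem θ l))) <;> simp <;> omega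

variable (B) in
/-- The functional that reads off the coefficient of the letter `h`. -/
def readOff (h : Gen M N) : DoubleMat M N B →ₗ[ℂ] B where
  toFun X := (X (Sum.inl h.1) (Sum.inl h.2.1)).coeff h.2.2 -
    (X (Sum.inr h.1) (Sum.inr h.2.1)).coeff h.2.2
  map_add' X Y := by simp only [Matrix.add_apply, Polynomial.coeff_add]; abel
  map_smul' c X := by
    simp only [Matrix.smul_apply, Polynomial.coeff_smul, smul_sub, RingHom.id_apply]

theorem readOff_apply (h : Gen M N) (X : DoubleMat M N B) : readOff B h X =
    (X (Sum.inl h.1) (Sum.inl h.2.1)).coeff h.2.2 -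
      (X (Sum.inr h.1) (Sum.inr h.2.1)).coeff h.2.2 := rfl

theorem readOff_mem {m : ℤ} (h : Gen M N) {X : DoubleMat M N B} (hX : X ∈ doubleFilt σ m) :
    readOff B h X ∈ lengthFilt σ m := sub_mem (hX _ _ _) (hX _ _ _)

/-- The diagonal part acts identically on both copies. This is the purpose of the second copy, where
evaluation generators act by zero: the difference removes the terms without evaluation letters. -/
theorem readOff_monomial_diagPart (h : Gen M N) (l : List (Gen M N)) :
    readOff B h (monomial (diagPart σ) l) = 0 := by
  rw [readOff_apply, monomial_diagPart_apply, monomial_diagPart_apply, sub_eq_zero]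
  simp only [Sum.inl.injEq, Sum.inr.injEq]
  rfl

theorem readOff_diagPart_mul (h g : Gen M N) (X : DoubleMat M N B) :
    readOff B h (diagPart σ g * X) = (-1 : ℤˣ) ^ (deg h.1 * parity g) • (σ g * readOff B h X) := by
  rw [readOff_apply, diagPart_mul_apply, diagPart_mul_apply, readOff_apply, mul_sub, smul_sub]
  simp only [Units.smul_def, Polynomial.coeff_smul, Polynomial.coeff_C_mul]
  rfl

theorem readOff_evalGen_mul (h g : Gen M N) (l : List (Gen M N)) :
    readOff B h (evalGen B g * monomial (diagPart σ) l) = if g = h then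
      (-1 : ℤˣ) ^ deg h.2.1 • (-1 : ℤˣ) ^ (deg h.2.1 * wordParity l) • monomial σ l else 0 := by
  rw [readOff_apply, evalGen_mul_apply, evalGen_mul_apply, if_neg Sum.inr_ne_inl,
    Polynomial.coeff_zero, sub_zero, monomial_diagPart_apply]
  by_cases h1 : h.1 = g.1
  · rw [if_pos (congrArg Sum.inl h1)]
    by_cases h2 : g.2.1 = h.2.1
    · rw [if_pos (congrArg Sum.inl h2), Units.smul_def, Polynomial.coeff_smul, mul_smul_comm,
        Units.smul_def (_ ^ _) (_ * _), Polynomial.coeff_smul, Polynomial.coeff_X_pow_mul', h2]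
      by_cases h3 : g.2.2 = h.2.2
      · rw [if_pos h3.le, if_pos (Prod.ext h1.symm (Prod.ext h2 h3)), h3, Nat.sub_self,
          Polynomial.coeff_C_zero]
        rfl
      · rw [if_neg fun h' => h3 (congrArg (fun i => i.2.2) h'), Polynomial.coeff_C]
        split_ifs
        · omega
        · simp
        · simp
    · rw [if_neg fun h' => h2 (Sum.inl.inj h'), if_neg fun h' => h2 (congrArg (fun i => i.2.1) h')]
      simp
  · rw [if_neg fun h' => h1 (Sum.inl.inj h'), if_neg fun h' => h1 (congrArg Prod.fst h').symm,
      Polynomial.coeff_zero]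

/-- A product with one evaluation letter has a nonzero coefficient at `h` only if that letter or its
partner is `h`. The parity operators on its left contribute the row sign of `h`, those on its right
the column sign, exactly as in `contraction`. -/
theorem readOff_linearPart (h : Gen M N) (l : List (Gen M N)) :
    readOff B h (linearPart σ θ l) = contraction θ σ h l := by
  induction l with
  | nil => simp [linearPart, contraction]
  | cons g l ih =>
    rw [linearPart, map_add, readOff_diagPart_mul, ih, contraction, symmEval, add_mul,
      smul_mul_assoc, map_add, Units.smul_def (starSign θ g), map_zsmul, readOff_evalGen_mul,
      readOff_evalGen_mul]
    congr 1
    rw [pairing]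
    rcases Int.units_eq_one_or (starSign θ g) with hs | hs <;>
      rcases deg_cases h.2.1 with hd | hd <;>
      split_ifs <;> simp [hs, hd, two_mul]

end Expansion

end TwistedSuperYangian

end

noncomputable section

namespace TwistedSuperYangian

/-! ### Functionals separating ordered monomials of a given length -/

section Separation

variable {M N : ℕ} (θ : Idx M N → ℤˣ)

/-- The symmetrised generators. -/
def symmetrise {B : Type*} [Ring B] (F : Gen M N → B) (g : Gen M N) : B :=
  F g + starSign θ g • F (star g)

/-- The ordered monomials of length `n` are separated by functionals that vanish on the shorter
monomials. -/
def Separates {B : Type*} [Ring B] [Algebra ℂ B] (n : ℕ) (σ : Gen M N → B) : Prop :=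
  ∀ H : List (Gen M N), IsOrdered θ H → H.length = n → ∃ Φ : B →ₗ[ℂ] ℂ,
    (∀ G : List (Gen M N), G.length < n → Φ (monomial σ G) = 0) ∧
    ∀ G : List (Gen M N), IsOrdered θ G → G.length = n → (Φ (monomial σ G) ≠ 0 ↔ G = H)

theorem separates_zero (σ : Gen M N → ℂ) : Separates θ 0 σ := by
  intro H hH h0
  refine ⟨LinearMap.id, fun G hG => absurd hG (Nat.not_lt_zero _), fun G hG hG0 => ?_⟩
  rw [List.length_eq_zero_iff] at h0 hG0
  simp [h0, hG0]

variable {θ} {B : Type*} [Ring B] [Algebra ℂ B] {σ : Gen M N → B}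

/-- The new factor reads off the first letter `i` of `H`, and the old functional then detects the
tail. Terms with two or more letters in the new factor leave too short a word in the old generators
and are killed. -/
theorem Separates.step {n : ℕ} (h : Separates θ n σ) :
    Separates θ (n + 1) fun g => diagPart σ g + symmEval θ B g := by
  intro H hH hn
  obtain _ | ⟨i, H⟩ := H
  · simp at hn
  have hi : IsBasic θ i := hH.1 i (by simp)
  have hn : H.length = n := by simpa using hn
  obtain ⟨Φ, hΦ, hΦ'⟩ := h H hH.tail hn
  have h0 : ∀ m : ℤ, m < n → ∀ b ∈ lengthFilt σ m, Φ b = 0 := by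
    intro m hm b hb
    refine (Submodule.span_le (p := LinearMap.ker Φ)).2 ?_ hb
    rintro _ ⟨l, hl, rfl⟩
    exact hΦ l (by omega)
  have h1 : ∀ G : List (Gen M N), G.length ≤ n + 1 →
      Φ (readOff B i (monomial (fun g => diagPart σ g + symmEval θ B g) G)) =
        Φ (contraction θ σ i G) := by
    intro G hG
    have h2 := h0 _ (by omega) _ (readOff_mem i (monomial_sub_mem (σ := σ) θ G))
    rwa [map_sub, map_add, readOff_monomial_diagPart, zero_add, readOff_linearPart, map_sub,
      sub_eq_zero] at h2
  refine ⟨Φ ∘ₗ readOff B i, fun G hG => ?_, fun G hG hGn => ?_⟩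
  · rw [LinearMap.comp_apply, h1 G hG.le, ← readOff_linearPart]
    exact h0 _ (by omega) _ (readOff_mem i (linearPart_mem θ G))
  · obtain ⟨s, -, hs⟩ := contraction_of_isOrdered σ hi hG
    rw [LinearMap.comp_apply, h1 G hGn.le, hs, Units.smul_def, map_zsmul, map_zsmul, smul_ne_zero_iff,
      smul_ne_zero_iff, mul_ne_zero_iff, Nat.cast_ne_zero, Ne, List.count_eq_zero]
    simp only [not_not, pairing_self_ne_zero hi, Ne, not_false_eq_true, and_true, Units.ne_zero,
      true_and]
    by_cases hm : i ∈ G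
    · have h3 := List.length_erase_of_mem hm
      have h4 := hΦ' (G.erase i) (hG.erase i) (by omega)
      rw [Ne] at h4
      rw [h4]
      constructor
      · rintro ⟨-, h5⟩
        exact hG.eq_of_perm hH (h5 ▸ List.perm_cons_erase hm)
      · rintro rfl
        exact ⟨hm, List.erase_cons_head _ _⟩
    · refine iff_of_false (fun h' => hm h'.1) ?_
      rintro rfl
      exact hm (by simp)

end Separation

/-! ### Construction of the separating solutions -/

section Model

variable {M N : ℕ}

theorem parity_star (g : Gen M N) : parity (star g) = parity g := by
  simp [parity, star, deg_bar, add_comm]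

theorem unitMat_mul (B : Type*) [Ring B] (a b c d : Idx M N) :
    unitMat B a b * unitMat B c d = if b = c then (-1 : ℤˣ) ^ deg b • unitMat B a d else 0 := by
  rw [unitMat, unitMat, unitMat, smul_mul_smul_comm]
  split_ifs with h
  · subst h
    rw [Matrix.single_mul_single_same, mul_one, smul_smul]
  · rw [Matrix.single_mul_single_of_ne _ _ _ _ (fun h' => h (Sum.inl.inj h')), smul_zero]

theorem varMat_commute (B : Type*) [Ring B] (X : DoubleMat M N B) : Commute (varMat M N B) X :=
  Matrix.scalar_commute _ (fun _ => Polynomial.commute_X _) _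

theorem scalarHom_commute {B : Type*} [Ring B] (b : B) {X : DoubleMat M N B}
    (h : ∀ i j, Commute (Polynomial.C b) (X i j)) : Commute (scalarHom M N B b) X :=
  Matrix.scalar_commute_iff.2 (Matrix.ext fun i j => h i j)

theorem scalarHom_commute_parityMat {B : Type*} [Ring B] (b : B) :
    Commute (scalarHom M N B b) (parityMat M N B) := by
  refine scalarHom_commute b fun i j => ?_
  rw [parityMat, Matrix.diagonal_apply]
  split_ifs
  · exact (Commute.neg_one_right _).pow_right _
  · exact Commute.zero_right _

theorem scalarHom_commute_unitMat {B : Type*} [Ring B] (b : B) (c d : Idx M N) :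
    Commute (scalarHom M N B b) (unitMat B c d) := by
  refine scalarHom_commute b fun i j => ?_
  rw [unitMat, Matrix.smul_apply, Matrix.single_apply]
  refine Commute.smul_right ?_ _
  split_ifs
  · exact Commute.one_right _
  · exact Commute.zero_right _

theorem parityMat_mul_self (B : Type*) [Ring B] : parityMat M N B * parityMat M N B = 1 := by
  rw [parityMat, Matrix.diagonal_mul_diagonal, ← Matrix.diagonal_one]
  congr 1
  funext i
  rw [← pow_add, ← two_mul, pow_mul]
  simp

theorem parityMat_pow_mul_unitMat (B : Type*) [Ring B] (p : ℕ) (c d : Idx M N) :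
    parityMat M N B ^ p * unitMat B c d =
      (-1 : ℤˣ) ^ (p * (deg c + deg d)) • (unitMat B c d * parityMat M N B ^ p) := by
  have h1 : parityMat M N B * unitMat B c d =
      (-1 : ℤˣ) ^ (deg c + deg d) • (unitMat B c d * parityMat M N B) := by
    ext1 i j
    rw [Matrix.smul_apply, parityMat, Matrix.diagonal_mul, Matrix.mul_diagonal, unitMat,
      Matrix.smul_apply, Matrix.single_apply]
    split_ifs with h
    · obtain ⟨rfl, rfl⟩ := h
      change (-1) ^ deg c * _ = _ • (_ * (-1) ^ deg d)
      rcases deg_cases c with hc | hc <;> rcases deg_cases d with hd | hd <;> simp [hc, hd]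
    · simp
  induction p with
  | zero => simp
  | succ p ih =>
    rw [pow_succ, mul_assoc, h1, mul_smul_comm, ← mul_assoc, ih, smul_mul_assoc, smul_smul,
      mul_assoc, ← pow_add, add_mul, one_mul, add_comm (p * _)]

/-- For every length there is a polynomial solution of the RTT relation whose symmetrised leading
coefficients separate the ordered monomials of this length. -/
theorem exists_model (θ : Idx M N → ℤˣ) (n : ℕ) : ∃ (B : Type) (_ : Ring B) (_ : Algebra ℂ B)
    (t : Gen M N → Polynomial B), SatisfiesRTT (genSeries t) ∧ (∀ g, (t g).natDegree ≤ g.2.2) ∧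
      Separates θ n (symmetrise θ fun g => (t g).coeff g.2.2) := by
  induction n with
  | zero =>
    refine ⟨ℂ, inferInstance, inferInstance, fun _ => 0, ?_, fun g => by simp, separates_zero θ _⟩
    convert satisfiesRTT_one
    ext a b n
    rcases n with _ | n
    · rw [coeff_zero_genSeries, Matrix.one_apply]
      split_ifs <;> simp
    · rw [coeff_succ_genSeries, Matrix.one_apply]
      split_ifs <;> simp [PowerSeries.coeff_one]
  | succ n ih =>
    obtain ⟨B, _, _, t, ht, hdeg, hsep⟩ := ih
    let f : Polynomial B →+* Polynomial (DoubleMat M N B) := Polynomial.mapRingHom (scalarHom M N B)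
    let γ : Polynomial (DoubleMat M N B) := Polynomial.C (parityMat M N B)
    -- Two variables are multiplied: the outer one measures the degree, and its leading coefficients
    -- retain the inner one, which tells apart the letters `(a, b, n)` with different `n`.
    let z : Polynomial (DoubleMat M N B) := Polynomial.X * Polynomial.C (varMat M N B)
    let e : Idx M N → Idx M N → Polynomial (DoubleMat M N B) := fun a b =>
      Polynomial.C (unitMat B a b)
    let g₁ : Gen M N → Polynomial (DoubleMat M N B) := fun g => f (t g) * γ ^ parity g
    let g₂ : Gen M N → Polynomial (DoubleMat M N B) := fun g => z ^ g.2.2 * e g.1 g.2.1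
    have hz : ∀ d, Commute z d := fun d => by
      refine Commute.mul_left (Polynomial.commute_X d) ?_
      ext1 k
      rw [Polynomial.coeff_C_mul, Polynomial.coeff_mul_C]
      exact varMat_commute B _
    have hγ : ∀ i, Commute γ (f (t i)) := by
      intro i
      ext1 k
      rw [Polynomial.coeff_C_mul, Polynomial.coeff_mul_C, Polynomial.coe_mapRingHom,
        Polynomial.coeff_map]
      exact (scalarHom_commute_parityMat _).symm
    have he : ∀ i c d, Commute (f (t i)) (e c d) := by
      intro i c d
      ext1 k
      rw [Polynomial.coeff_C_mul, Polynomial.coeff_mul_C, Polynomial.coe_mapRingHom,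
        Polynomial.coeff_map]
      exact scalarHom_commute_unitMat _ _ _
    have h₁ : SatisfiesRTT (genSeries g₁) := by
      refine (ht.map_genSeries f).twist (γ := γ) ?_ hγ
      rw [← map_mul, parityMat_mul_self, map_one]
    have h₂ : SatisfiesRTT (genSeries g₂) := by
      refine satisfiesRTT_evaluation hz fun a b c d => ?_
      rw [← map_mul, unitMat_mul]
      split_ifs
      · rw [Units.smul_def, Units.smul_def, map_zsmul]
      · exact map_zero _
    have hL₁ : Lead (genSeries g₁) fun g => scalarHom M N B ((t g).coeff g.2.2) *
        parityMat M N B ^ parity g := by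
      have h1 : ∀ g, g₁ g = (t g).map (scalarHom M N B) * Polynomial.C (parityMat M N B ^ parity g) :=
        fun g => by simp only [g₁, γ, map_pow]; rfl
      convert lead_genSeries (t := g₁) fun g => ?_ with g
      · rw [h1, Polynomial.coeff_mul_C, Polynomial.coeff_map]
      · rw [h1]
        exact (Polynomial.natDegree_mul_C_le _ _).trans (Polynomial.natDegree_map_le.trans (hdeg g))
    have hL₂ : Lead (genSeries g₂) fun g => evalGen B g := by
      have h1 : ∀ g, g₂ g = Polynomial.X ^ g.2.2 * Polynomial.C (evalGen B g) := fun g => by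
        simp only [g₂, z, e, evalGen, map_mul, map_pow]
        rw [(Polynomial.commute_X _).mul_pow, mul_assoc]
      convert lead_genSeries (t := g₂) fun g => ?_ with g
      · rw [h1, Polynomial.coeff_mul_C]
        simp
      · rw [h1]
        exact (Polynomial.natDegree_mul_C_le _ _).trans (Polynomial.natDegree_X_pow_le _)
    have hL := hL₁.mul hL₂
    have hmul : SatisfiesRTT (genSeries g₁ * genSeries g₂) := by
      refine h₁.mul h₂ fun i j => ?_
      -- The parity operator anticommutes with odd matrix units. It turns ordinary commutation of
      -- old and new factors into the supercommutation required for their product.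
      have h3 : γ ^ parity i * e j.1 j.2.1 = genSign i j • (e j.1 j.2.1 * γ ^ parity i) := by
        simp only [γ, e, ← map_pow, ← map_mul, parityMat_pow_mul_unitMat]
        rw [Units.smul_def, map_zsmul]
        rfl
      simp only [g₁, g₂]
      rw [mul_assoc, ← mul_assoc (γ ^ _), ← ((hz _).pow_left _).eq, mul_assoc, h3,
        mul_smul_comm, mul_smul_comm, ← mul_assoc, ← ((hz _).pow_left _).eq, mul_assoc, mul_assoc,
        ← mul_assoc (f _), (he i _ _).eq, mul_assoc]
    have hgen : genSeries g₁ * genSeries g₂ = genSeries fun g : Gen M N =>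
        PowerSeries.coeff (g.2.2 + 1) ((genSeries g₁ * genSeries g₂) g.1 g.2.1) :=
      eq_genSeries _ hL.zero
    refine ⟨DoubleMat M N B, inferInstance, inferInstance, _, hgen ▸ hmul,
      fun g => hL.natDegree_le _ _ _, ?_⟩
    convert hsep.step using 2 with g
    rw [symmetrise, hL.coeff_eq, hL.coeff_eq, diagPart, symmEval, symmetrise,
      Units.smul_def (starSign θ g), Units.smul_def (starSign θ g), Units.smul_def (starSign θ g),
      map_add, map_zsmul, add_mul, smul_mul_assoc, smul_add]
    simp only [Prod.mk.eta, parity_star]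
    abel

end Model

end TwistedSuperYangian

end

noncomputable section

namespace TwistedSuperYangian

/-! ### Linear independence of ordered monomials and the isomorphism -/

section Independence

variable {M N : ℕ} (θ : Idx M N → ℤˣ)

/-- The degree of a word: the sum of the degrees of its letters. -/
def wordDegree (l : List (Gen M N)) : ℕ := (l.map fun g => g.2.2).sum

theorem monomial_lead {B : Type*} [Ring B] {s : Gen M N → Polynomial B}
    (hs : ∀ g, (s g).natDegree ≤ g.2.2) (l : List (Gen M N)) :
    (monomial s l).natDegree ≤ wordDegree l ∧
      (monomial s l).coeff (wordDegree l) = monomial (fun g => (s g).coeff g.2.2) l := by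
  induction l with
  | nil => simp [wordDegree]
  | cons g l ih =>
    rw [monomial_cons, monomial_cons, ← ih.2]
    have : wordDegree (g :: l) = g.2.2 + wordDegree l := by simp [wordDegree]
    rw [this]
    exact ⟨Polynomial.natDegree_mul_le_of_le (hs g) ih.1,
      Polynomial.coeff_mul_add_eq_of_natDegree_le (hs g) ih.1⟩

theorem map_monomial {A B : Type*} [Ring A] [Ring B] [Algebra ℂ A] [Algebra ℂ B] (f : A →ₐ[ℂ] B)
    (σ : Gen M N → A) (l : List (Gen M N)) :
    f (monomial σ l) = monomial (fun g => f (σ g)) l := by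
  rw [monomial, map_list_prod, List.map_map]
  rfl

/-- Leading coefficients of a product add, and those of `τ[T(u)]` are the signed partners. So `S(u)
= T(u) τ[T(u)]` has exactly the symmetrised leading coefficients that the model separates. -/
theorem exists_separating_hom (n : ℕ) : ∃ (B : Type) (_ : Ring B) (_ : Algebra ℂ B)
    (ψ : Yangian M N →ₐ[ℂ] Polynomial B), (∀ g, (ψ (Sgen θ g)).natDegree ≤ g.2.2) ∧
      Separates θ n (fun g => (ψ (Sgen θ g)).coeff g.2.2) := by
  obtain ⟨B, _, _, t, ht, hdeg, hsep⟩ := exists_model θ n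
  obtain ⟨ψ, hψ⟩ := exists_yangian_hom t ht
  have h1 : (S θ).map (PowerSeries.map (ψ : Yangian M N →+* Polynomial B)) =
      genSeries t * tau θ (genSeries t) := by
    rw [S, Matrix.map_mul, ← tau_map, T, genSeries_map]
    simp only [RingHom.coe_coe, hψ]
  have hL := (lead_genSeries hdeg).mul ((lead_genSeries hdeg).tau θ)
  have h2 : ∀ g, ψ (Sgen θ g) =
      PowerSeries.coeff (g.2.2 + 1) ((genSeries t * tau θ (genSeries t)) g.1 g.2.1) := by
    intro g
    rw [← h1, Matrix.map_apply, PowerSeries.coeff_map]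
    rfl
  refine ⟨B, _, _, ψ, fun g => ?_, ?_⟩
  · rw [h2]
    exact hL.natDegree_le _ _ _
  · convert hsep using 2 with g
    rw [h2, hL.coeff_eq]
    rfl

/-- The ordered monomials in the generators of the twisted super Yangian are linearly
independent. -/
theorem eq_zero_of_linearCombination_monomial {c : List (Gen M N) →₀ ℂ}
    (hc : ∀ l ∈ c.support, IsOrdered θ l)
    (h0 : Finsupp.linearCombination ℂ (monomial (Sgen θ)) c = 0) : c = 0 := by
  by_contra hne
  -- For `J` maximal in degree and then in length, the coefficient in degree `wordDegree J` removes
  -- words of smaller degree, of whatever length, and the functional for `J` removes the rest.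
  obtain ⟨J, hJ, hmax⟩ := Finset.exists_max_image c.support
    (fun l => toLex (wordDegree l, l.length)) (Finsupp.support_nonempty_iff.2 hne)
  obtain ⟨B, _, _, ψ, hdeg, hsep⟩ := exists_separating_hom θ J.length
  obtain ⟨Φ, hΦ, hΦ'⟩ := hsep J (hc J hJ) rfl
  have h1 : ∀ l ∈ c.support, l ≠ J →
      Φ ((ψ (monomial (Sgen θ) l)).coeff (wordDegree J)) = 0 := by
    intro l hl hlJ
    have hle := hmax l hl
    rw [map_monomial]
    obtain ⟨h2, h3⟩ := monomial_lead hdeg l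
    rcases Prod.Lex.toLex_le_toLex.1 hle with h4 | ⟨h4, h5⟩
    · rw [Polynomial.coeff_eq_zero_of_natDegree_lt (h2.trans_lt h4), map_zero]
    · simp only at h4 h5
      rw [← h4, h3]
      rcases h5.lt_or_eq with h5 | h5
      · exact hΦ l h5
      · by_contra h6
        exact hlJ ((hΦ' l (hc l hl) h5).1 h6)
  have h2 : Φ ((ψ (monomial (Sgen θ) J)).coeff (wordDegree J)) ≠ 0 := by
    rw [map_monomial, (monomial_lead hdeg J).2]
    exact (hΦ' J (hc J hJ) rfl).2 rfl
  have h3 := congrArg (fun a => Φ ((ψ a).coeff (wordDegree J))) h0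
  simp only [Finsupp.linearCombination_apply, Finsupp.sum, map_sum, map_smul,
    Polynomial.finsetSum_coeff, Polynomial.coeff_smul, map_zero, Polynomial.coeff_zero] at h3
  rw [Finset.sum_eq_single J] at h3
  · exact mul_ne_zero (Finsupp.mem_support_iff.1 hJ) h2 h3
  · intro l hl hlJ
    rw [h1 l hl hlJ, smul_zero]
  · intro h
    exact absurd hJ h

theorem adjoin_range_sigma (θ₀ : ℤˣ) :
    Algebra.adjoin ℂ (Set.range (sigma θ θ₀)) = ⊤ := by
  have h1 : Set.range (sigma θ θ₀) = RingQuot.mkAlgHom ℂ (TwistedRel θ θ₀) ''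
      Set.range (FreeAlgebra.ι ℂ) := by
    rw [← Set.range_comp]
    rfl
  rw [h1, ← AlgHom.map_adjoin, FreeAlgebra.adjoin_range_ι, Algebra.map_top,
    AlgHom.range_eq_top]
  exact RingQuot.mkAlgHom_surjective ℂ _

/-- The images of a spanning family, the ordered monomials in the `σ`, are linearly independent. -/
theorem injective_of_sigma {θ₀ : ℤˣ}
    {φ : Presented θ θ₀ →ₐ[ℂ] Yangian M N} (hφ : ∀ g, φ (sigma θ θ₀ g) = Sgen θ g) :
    Function.Injective φ := by
  rw [injective_iff_map_eq_zero]
  intro a ha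
  have h1 : a ∈ orderedSpan (sigma θ θ₀) θ :=
    adjoin_le_orderedSpan (supercommutator_mem (reflection_sigma θ θ₀))
      (sub_star_mem (symmetry_sigma θ θ₀)) (by rw [adjoin_range_sigma]; trivial)
  have h2 : orderedSpan (sigma θ θ₀) θ =
      Submodule.span ℂ (monomial (sigma θ θ₀) '' {l | IsOrdered θ l}) := rfl
  rw [h2, Finsupp.mem_span_image_iff_linearCombination] at h1
  obtain ⟨c, hc, rfl⟩ := h1
  have h3 : Finsupp.linearCombination ℂ (monomial (Sgen θ)) c = 0 := by
    rw [← ha, Finsupp.linearCombination_apply, Finsupp.linearCombination_apply, map_finsuppSum]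
    refine Finsupp.sum_congr fun l _ => ?_
    rw [map_smul, map_monomial, funext hφ]
  rw [eq_zero_of_linearCombination_monomial θ (fun l hl => hc hl) h3, map_zero]

end Independence

end TwistedSuperYangian

theorem mainTheorem1 (M N : ℕ) (θ : TwistedSuperYangian.Idx M N → ℤˣ) (θ₀ : ℤˣ)
    (hθ : ∀ a : TwistedSuperYangian.Idx M N,
      (-1 : ℤˣ) ^ TwistedSuperYangian.deg a * θ a * θ (TwistedSuperYangian.bar a) = θ₀) :
    TwistedSuperYangian.reflLHS θ (TwistedSuperYangian.S θ) =
        TwistedSuperYangian.reflRHS θ (TwistedSuperYangian.S θ) ∧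
      TwistedSuperYangian.tau θ (TwistedSuperYangian.S θ) =
        TwistedSuperYangian.symmRHS θ₀ (TwistedSuperYangian.S θ) ∧
      ∃ φ : TwistedSuperYangian.Presented θ θ₀ ≃ₐ[ℂ] TwistedSuperYangian.twistedYangian θ,
        ∀ g : TwistedSuperYangian.Gen M N,
          (φ (TwistedSuperYangian.sigma θ θ₀ g) : TwistedSuperYangian.Yangian M N) =
            TwistedSuperYangian.Sgen θ g := by
  open TwistedSuperYangian in
  have hr : reflLHS θ (S θ) = reflRHS θ (S θ) := satisfiesRTT_T.reflection hθ
  have hs : tau θ (S θ) = symmRHS θ₀ (S θ) := satisfiesRTT_T.symmetry hθ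
  refine ⟨hr, hs, ?_⟩
  rw [S_eq_genSeries] at hr hs
  obtain ⟨φ, hφ⟩ := exists_presented_hom θ θ₀ (Sgen θ) hr hs
  have hinj := injective_of_sigma θ hφ
  -- Both algebras are generated by corresponding families, so the image is the whole twisted
  -- Yangian.
  have hrange : φ.range = twistedYangian θ := by
    rw [twistedYangian, ← Algebra.map_top, ← adjoin_range_sigma θ θ₀, AlgHom.map_adjoin,
      ← Set.range_comp]
    congr 2
    exact funext hφ
  refine ⟨(AlgEquiv.ofInjective φ hinj).trans (Subalgebra.equivOfEq _ _ hrange), fun g => ?_⟩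
  exact hφ g

end
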